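/- Let $n \ge 3$ and $2 \le k \le n$, and let $(\overline M, g)$, $\overline M = M \cup \partial M$, be a smooth compact Riemannian manifold of dimension $n$ with boundary $\partial M$. For $\lambda \in \mathbb{R}^n$ let $\sigma_j(\lambda)$ be the $j$-th elementary symmetric function, let $\Gamma_j = \{\lambda \in \mathbb{R}^n : \sigma_1(\lambda) > 0, \dots, \sigma_j(\lambda) > 0\}$, and for an endomorphism $A$ with real eigenvalues $\lambda(A)$ write $\sigma_j(A) = \sigma_j(\lambda(A))$. For a function $v$ on $\overline M$ put $$\mathcal{W}[v] = g^{-1}\Big(\nabla^2 v - dv \otimes dv + \Big(\frac{\Delta v}{n-2} + |\nabla v|^2\Big) g - \frac{\mathrm{Ric}_g}{n-2}\Big).$$ Let $\alpha, \alpha_0, \varphi \in C^\infty(\overline M)$ with $\alpha_0 > 0$ on $\overline M$, and let $v \in C^3(\overline M)$ be $(k-1)$-admissible, that is, $\lambda(\mathcal{W}[v])(x) \in \Gamma_{k-1}$ for all $x \in \overline M$, and satisfy $$\sigma_k\big((n-2)e^{-2v}\mathcal{W}[v]\big) + \alpha(x)\, \sigma_{k-1}\big((n-2)e^{-2v}\mathcal{W}[v]\big)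 = \alpha_0(x) \quad \text{on } \overline M, \qquad v = \varphi \quad \text{on } \partial M.$$ Then $$|\nabla^2 v| \le C \quad \text{on } \partial M,$$ where $C > 0$ depends only on $(\overline M, g)$, $n$, $k$, on upper bounds for $\|v\|_{C^1(\overline M)}$, $\|\varphi\|_{C^3(\overline M)}$, $\|\alpha\|_{C^1(\overline M)}$, $\|\alpha_0\|_{C^1(\overline M)}$, and on a positive lower bound for $\min_{\overline M} \alpha_0$. Here norms, derivatives and curvature are those of $g$. -/

import Mathlib

open scoped Manifold ContDiff ENNReal NNReal

noncomputable section

namespace KRicci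

/-- A smooth Riemannian metric on a manifold `M` with boundary, of dimension `n`. -/
abbrev Metric (n : ℕ) [NeZero n] (M : Type*) [TopologicalSpace M]
    [ChartedSpace (EuclideanHalfSpace n) M] [IsManifold (𝓡∂ n) ∞ M] : Type _ :=
  Bundle.ContMDiffRiemannianMetric (𝓡∂ n) ∞ (EuclideanSpace ℝ (Fin n))
    (fun x : M => TangentSpace (𝓡∂ n) x)

/-- The `i`-th partial derivative in the closed half-space (one-sided in the direction normal to
the boundary at boundary points). -/
def partialDeriv {n : ℕ} [NeZero n] (i : Fin n) (f : EuclideanSpace ℝ (Fin n) → ℝ)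
    (y : EuclideanSpace ℝ (Fin n)) : ℝ :=
  fderivWithin ℝ f (Set.range (𝓡∂ n)) y (EuclideanSpace.single i 1)

section Local

variable {n : ℕ} [NeZero n] {M : Type*} [TopologicalSpace M]
  [ChartedSpace (EuclideanHalfSpace n) M] [IsManifold (𝓡∂ n) ∞ M]

/-- The coordinate vector field `∂_i` of the chart around `x₀`, at the point with coordinates `y`:
the push-forward of the `i`-th basis vector under the inverse of the chart. -/
def coordVec (x₀ : M) (y : EuclideanSpace ℝ (Fin n)) (i : Fin n) :
    TangentSpace (𝓡∂ n) ((extChartAt (𝓡∂ n) x₀).symm y) :=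
  mfderivWithin 𝓘(ℝ, EuclideanSpace ℝ (Fin n)) (𝓡∂ n) (extChartAt (𝓡∂ n) x₀).symm
    (Set.range (𝓡∂ n)) y (EuclideanSpace.single i (1 : ℝ) : EuclideanSpace ℝ (Fin n))

/-- The components `g_ij` of the metric in the chart around `x₀`. -/
def gram (g : Metric n M) (x₀ : M) (y : EuclideanSpace ℝ (Fin n)) : Matrix (Fin n) (Fin n) ℝ :=
  Matrix.of fun i j =>
    g.inner ((extChartAt (𝓡∂ n) x₀).symm y) (coordVec x₀ y i) (coordVec x₀ y j)

/-- The Christoffel symbols `Γ^l_{ij}` of the Levi-Civita connection in the chart around `x₀`. -/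
def christoffel (g : Metric n M) (x₀ : M) (l i j : Fin n) (y : EuclideanSpace ℝ (Fin n)) : ℝ :=
  (1 / 2) * ∑ m, (gram g x₀ y)⁻¹ l m *
    (partialDeriv i (fun z => gram g x₀ z m j) y + partialDeriv j (fun z => gram g x₀ z i m) y
      - partialDeriv m (fun z => gram g x₀ z i j) y)

/-- The covariant derivative of a covariant tensor `T` of rank `m` given by its components in the
chart around `x₀`:
`∇_k T_{i₁…i_m} = ∂_k T_{i₁…i_m} - ∑_a ∑_l Γ^l_{k i_a} T_{i₁…l…i_m}`. The index of differentiation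
is put first. -/
def covDeriv (g : Metric n M) (x₀ : M) {m : ℕ}
    (T : EuclideanSpace ℝ (Fin n) → (Fin m → Fin n) → ℝ) :
    EuclideanSpace ℝ (Fin n) → (Fin (m + 1) → Fin n) → ℝ :=
  fun y J => partialDeriv (J 0) (fun z => T z (Fin.tail J)) y
    - ∑ a : Fin m, ∑ l, christoffel g x₀ l (J 0) (J a.succ) y *
        T y (Function.update (Fin.tail J) a l)

/-- The components of the iterated covariant derivative `∇^m f` of a function `f` on `M`, in the
chart around `x₀`. -/
def iterCovDeriv (g : Metric n M) (f : M → ℝ) (x₀ : M) :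
    (m : ℕ) → EuclideanSpace ℝ (Fin n) → (Fin m → Fin n) → ℝ
  | 0 => fun y _ => f ((extChartAt (𝓡∂ n) x₀).symm y)
  | m + 1 => covDeriv g x₀ (iterCovDeriv g f x₀ m)

/-- The components `Ric_ij` of the Ricci tensor in the chart around `x₀` (with the sign for which
round spheres have positive Ricci curvature). -/
def ricci (g : Metric n M) (x₀ : M) (y : EuclideanSpace ℝ (Fin n)) : Matrix (Fin n) (Fin n) ℝ :=
  Matrix.of fun i j =>
    ∑ l, partialDeriv l (christoffel g x₀ l i j) y
      - ∑ l, partialDeriv j (christoffel g x₀ l i l) y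
      + ∑ l, ∑ m, christoffel g x₀ l l m y * christoffel g x₀ m i j y
      - ∑ l, ∑ m, christoffel g x₀ l j m y * christoffel g x₀ m i l y

end Local

section Pointwise

variable {n : ℕ} [NeZero n] {M : Type*} [TopologicalSpace M]
  [ChartedSpace (EuclideanHalfSpace n) M] [IsManifold (𝓡∂ n) ∞ M]

/-- The matrix `g_ij` at the point `x`, in the chart around `x`. -/
def gramAt (g : Metric n M) (x : M) : Matrix (Fin n) (Fin n) ℝ :=
  gram g x (extChartAt (𝓡∂ n) x x)

/-- The components of `∇^m f` at the point `x`, in the chart around `x`. -/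
def nablaAt (g : Metric n M) (m : ℕ) (f : M → ℝ) (x : M) : (Fin m → Fin n) → ℝ :=
  iterCovDeriv g f x m (extChartAt (𝓡∂ n) x x)

/-- The pointwise norm `|∇^m f|` at `x`, with respect to the metric `g`: the square of the norm
is `∑ g^{i₁j₁} ⋯ g^{i_m j_m} ∇_{i₁…i_m} f ∇_{j₁…j_m} f`. -/
def nablaNorm (g : Metric n M) (m : ℕ) (f : M → ℝ) (x : M) : ℝ :=
  Real.sqrt (∑ I : Fin m → Fin n, ∑ J : Fin m → Fin n,
    (∏ a, (gramAt g x)⁻¹ (I a) (J a)) * nablaAt g m f x I * nablaAt g m f x J)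

/-- The `C^m` norm `∑_{j ≤ m} sup_M |∇^j f|`, as an extended nonnegative real. -/
def cNorm (g : Metric n M) (m : ℕ) (f : M → ℝ) : ℝ≥0∞ :=
  ∑ j ∈ Finset.range (m + 1), ⨆ x : M, ENNReal.ofReal (nablaNorm g j f x)

/-- The Hessian `∇_ij f` at the point `x`. -/
def hessAt (g : Metric n M) (f : M → ℝ) (x : M) : Matrix (Fin n) (Fin n) ℝ :=
  Matrix.of fun i j => nablaAt g 2 f x ![i, j]

/-- The differential `∇_i f` at the point `x`. -/
def diffAt (g : Metric n M) (f : M → ℝ) (x : M) : Fin n → ℝ :=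
  fun i => nablaAt g 1 f x ![i]

/-- The Laplace-Beltrami operator `Δf = g^{ij} ∇_ij f`. -/
def laplacian (g : Metric n M) (f : M → ℝ) (x : M) : ℝ :=
  ∑ i, ∑ j, (gramAt g x)⁻¹ i j * hessAt g f x i j

/-- The matrix of the endomorphism of the tangent space at `x`
`𝒲[v] = g⁻¹ (∇²v - dv ⊗ dv + (Δv / (n - 2) + |∇v|²) g - Ric_g / (n - 2))`. -/
def W (g : Metric n M) (v : M → ℝ) (x : M) : Matrix (Fin n) (Fin n) ℝ :=
  (gramAt g x)⁻¹ * (hessAt g v x - Matrix.vecMulVec (diffAt g v x) (diffAt g v x)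
    + (laplacian g v x / ((n : ℝ) - 2) + nablaNorm g 1 v x ^ 2) • gramAt g x
    - ((n : ℝ) - 2)⁻¹ • ricci g x (extChartAt (𝓡∂ n) x x))

end Pointwise

/-- The eigenvalues `λ(A)` of a real matrix with real eigenvalues, counted with multiplicity. -/
def eigenvalues {n : ℕ} (A : Matrix (Fin n) (Fin n) ℝ) : Multiset ℝ := A.charpoly.roots

/-- `σ_k(λ(A))`, the `k`-th elementary symmetric function of the eigenvalues of `A`. -/
def sigma {n : ℕ} (k : ℕ) (A : Matrix (Fin n) (Fin n) ℝ) : ℝ := (eigenvalues A).esymm k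

/-- Gårding's cone `Γ_k`: all of `σ_1, …, σ_k` are positive. -/
def gardingCone (k : ℕ) : Set (Multiset ℝ) := {s | ∀ j : ℕ, 1 ≤ j → j ≤ k → 0 < s.esymm j}

section Equation

variable {n : ℕ} [NeZero n] {M : Type*} [TopologicalSpace M]
  [ChartedSpace (EuclideanHalfSpace n) M] [IsManifold (𝓡∂ n) ∞ M]

/-- `v` is `k`-admissible on `M`: `λ(𝒲[v](x)) ∈ Γ_k` for all `x`. -/
def Admissible (g : Metric n M) (k : ℕ) (v : M → ℝ) : Prop :=
  ∀ x : M, eigenvalues (W g v x) ∈ gardingCone k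

/-- The equation
`σ_k((n - 2) e^{-2v} 𝒲[v]) + α σ_{k-1}((n - 2) e^{-2v} 𝒲[v]) = α₀` on `M`. -/
def Solves (g : Metric n M) (k : ℕ) (α α₀ v : M → ℝ) : Prop :=
  ∀ x : M,
    sigma k ((((n : ℝ) - 2) * Real.exp (-2 * v x)) • W g v x)
      + α x * sigma (k - 1) ((((n : ℝ) - 2) * Real.exp (-2 * v x)) • W g v x) = α₀ x

end Equation

end KRicci

end

noncomputable section

namespace KRicci

/-! ### Newton's inequalities for elementary symmetric functions -/

section Newton

open Polynomial

/-! The estimate rests on the trace term `Δv/(n-2)` in `𝒲`. Let F_i = σ_{k-1;i} + α σ_{k-2;i} be the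
coefficients of the linearised equation in a frame diagonalising `𝒲`. On admissible solutions
Newton's inequalities and the equation give F_i ≥ 0, with no sign condition on α
(`linearized_coeff_nonneg`), and ∑ F_i ≥ c (1 + σ_{k-1}) (`exists_trace_lower_bound`). After
division by ∑ F_i the weights q_i ≥ 0 have sum 1, and the trace term adds 1/(n-2) to each weight in
front of D²v. So the resulting operator b^{ij}∂_i∂_j is uniformly elliptic with bounded coefficients
even where single F_i degenerate (`exists_elliptic_matrix`). Euler's identity and the differentiated
equation produce terms of size O(1 + σ_{k-1}), which the normalisation makes bounded
(`exists_normalized_linearization`). Hence |b^{ij} v_ij| ≤ C and |b^{ij} (∂_a v)_ij| ≤ C (1 +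
|D²v|).

In a chart the boundary is {x_0 = 0}, and for tangential a the function w_a = ∂_a(v - φ) vanishes on
it. Since b^{00} ≥ θ, the first bound expresses v_00 through the other second derivatives, so |D²v|
is controlled by ∑ |Dw_a|. The linear growth is absorbed by passing to u = ±w_a + ∑ w_c², because
the squares contribute 2θ ∑ |Dw_c|² (`exists_quadratic_absorption`). A barrier then bounds ∂_0 u,
hence ∂_0 w_a, at the centre (`exists_normal_derivative_bound`). The tangential derivatives of w_a
vanish there, and v_00 follows from the equation once more (`exists_boundary_hessian_bound`).

The rest carries this to the manifold. `nablaNorm` and `W` are computed at x in the chart around x,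
while the estimate needs one chart for a whole half ball. Covariant derivatives and the Ricci tensor
are therefore shown to transform as tensors (`IsCoordChange`): norms agree between charts and the
matrices of `𝒲` are similar. Compactness leaves finitely many charts. -/

theorem esymm_cons (a : ℝ) (s : Multiset ℝ) (k : ℕ) :
    (a ::ₘ s).esymm (k + 1) = s.esymm (k + 1) + a * s.esymm k := by
  simp only [Multiset.esymm, Multiset.powersetCard_cons, Multiset.map_add, Multiset.sum_add,
    Multiset.map_map, Function.comp_def, Multiset.prod_cons, Multiset.sum_map_mul_left]

theorem esymm_zero (s : Multiset ℝ) : s.esymm 0 = 1 := by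
  simp [Multiset.esymm]

theorem esymm_of_card_lt {s : Multiset ℝ} {k : ℕ} (h : s.card < k) : s.esymm k = 0 := by
  simp [Multiset.esymm, Multiset.powersetCard_eq_empty k h]

/-- Rolle's theorem counted with multiplicity: `p` has at most one root more than its derivative, so
a full set of real roots of `p` leaves a full set for the derivative. -/
theorem splits_derivative {p : ℝ[X]} (hp : p.Splits) : (derivative p).Splits := by
  by_cases h0 : p.natDegree = 0
  · rw [natDegree_eq_zero.1 h0 |>.choose_spec.symm]; simp
  · rw [splits_iff_card_roots] at hp ⊢
    have h1 := p.card_roots_le_derivative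
    have h2 := (derivative p).card_roots'
    have h3 := natDegree_derivative_lt h0
    omega

theorem splits_iterate_derivative {p : ℝ[X]} (hp : p.Splits) (d : ℕ) :
    (derivative^[d] p).Splits := by
  induction d with
  | zero => simpa
  | succ d ih => rw [Function.iterate_succ_apply']; exact splits_derivative ih

/-- For nonzero r this is the Cauchy–Schwarz inequality (∑ 1/r)² ≤ m ∑ 1/r². Induction on the
factors avoids dividing by the r. -/
theorem coeff_prod_X_add_C_ineq (t : Multiset ℝ) :
    2 * (t.card : ℝ) * ((t.map fun r => X + C r).prod.coeff 0 * (t.map fun r => X + C r).prod.coeff 2)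
      ≤ ((t.card : ℝ) - 1) * (t.map fun r => X + C r).prod.coeff 1 ^ 2 := by
  induction t using Multiset.induction with
  | empty => simp [coeff_one]
  | cons r t ih =>
    rw [Multiset.map_cons, Multiset.prod_cons]
    set Q := (t.map fun r => X + C r).prod with hQ
    have e0 : ((X + C r) * Q).coeff 0 = r * Q.coeff 0 := by simp [add_mul]
    have e1 : ((X + C r) * Q).coeff 1 = Q.coeff 0 + r * Q.coeff 1 := by
      simp [add_mul, coeff_X_mul]
    have e2 : ((X + C r) * Q).coeff 2 = Q.coeff 1 + r * Q.coeff 2 := by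
      simp [add_mul, coeff_X_mul]
    rw [e0, e1, e2, Multiset.card_cons]
    push_cast
    rcases Nat.eq_zero_or_pos t.card with h | h
    · rw [Multiset.card_eq_zero] at h
      subst h
      simp [hQ, coeff_one]
    · have hm : (0 : ℝ) < t.card := by exact_mod_cast h
      set m : ℝ := (t.card : ℝ)
      set A := Q.coeff 0
      set B := Q.coeff 1
      set D := Q.coeff 2
      -- Multiplied by `m`, the new defect is a square plus a nonnegative multiple of the defect in
      -- the induction hypothesis.
      have key : m * ((m + 1 - 1) * (A + r * B) ^ 2 - 2 * (m + 1) * (r * A * (B + r * D)))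
          = (m * A - r * B) ^ 2 + (m + 1) * r ^ 2 * ((m - 1) * B ^ 2 - 2 * m * (A * D)) := by ring
      have : 0 ≤ m * ((m + 1 - 1) * (A + r * B) ^ 2 - 2 * (m + 1) * (r * A * (B + r * D))) := by
        rw [key]
        have := sub_nonneg.2 ih
        positivity
      have := nonneg_of_mul_nonneg_right this hm
      linarith

theorem splits_coeff_ineq {p : ℝ[X]} (hp : p.Splits) :
    2 * (p.natDegree : ℝ) * (p.coeff 0 * p.coeff 2) ≤ ((p.natDegree : ℝ) - 1) * p.coeff 1 ^ 2 := by
  have hc := splits_iff_card_roots.1 hp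
  have h := C_leadingCoeff_mul_prod_multiset_X_sub_C hc
  have h2 := coeff_prod_X_add_C_ineq (p.roots.map fun r => -r)
  simp only [Multiset.map_map, Function.comp_def, map_neg, ← sub_eq_add_neg, Multiset.card_map,
    hc] at h2
  set q := (p.roots.map fun a => X - C a).prod
  have e : ∀ i, p.coeff i = p.leadingCoeff * q.coeff i := fun i => by
    conv_lhs => rw [← h]
    simp
  rw [e 0, e 1, e 2]
  nlinarith [mul_le_mul_of_nonneg_left h2 (sq_nonneg p.leadingCoeff)]

/-- Newton's inequality. -/
theorem newton (s : Multiset ℝ) (j : ℕ) (hj : j + 2 ≤ s.card) :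
    ((j : ℝ) + 2) * (s.card - j) * (s.esymm (j + 2) * s.esymm j)
      ≤ (j + 1) * (s.card - j - 1) * s.esymm (j + 1) ^ 2 := by
  obtain ⟨d, hd⟩ := Nat.exists_eq_add_of_le hj
  -- Differentiating `P` exactly `d = s.card - (j + 2)` times keeps it real-rooted and leaves degree
  -- `j + 2`. Up to factorials its three lowest coefficients are then σ_{j+2}, σ_{j+1}, σ_j.
  set P : ℝ[X] := (s.map fun r => X + C r).prod with hP
  have hsp : P.Splits := by
    refine Splits.multisetProd fun f hf => ?_
    obtain ⟨r, -, rfl⟩ := Multiset.mem_map.1 hf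
    exact Splits.X_add_C r
  have hdeg : P.natDegree = s.card := by
    rw [hP, natDegree_multiset_prod_of_monic]
    · simp [Multiset.map_map]
    · intro f hf
      obtain ⟨r, -, rfl⟩ := Multiset.mem_map.1 hf
      exact monic_X_add_C r
  have hdeg' : (derivative^[d] P).natDegree = j + 2 := by
    refine le_antisymm ((natDegree_iterate_derivative P d).trans (by omega))
      (le_natDegree_of_ne_zero ?_)
    rw [coeff_iterate_derivative, hP, Multiset.prod_X_add_C_coeff _ (by omega),
      show s.card - (j + 2 + d) = 0 by omega, esymm_zero, nsmul_eq_mul, mul_one]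
    exact_mod_cast (Nat.descFactorial_pos.2 (by omega)).ne'
  have h := splits_coeff_ineq (splits_iterate_derivative hsp d)
  have e0 : (derivative^[d] P).coeff 0 = (d.factorial : ℝ) * s.esymm (j + 2) := by
    rw [coeff_iterate_derivative, hP, Multiset.prod_X_add_C_coeff _ (by omega)]
    simp only [zero_add, Nat.descFactorial_self, nsmul_eq_mul]
    congr 2; omega
  have e1 : (derivative^[d] P).coeff 1 = (d.factorial : ℝ) * (d + 1) * s.esymm (j + 1) := by
    rw [coeff_iterate_derivative, hP, Multiset.prod_X_add_C_coeff _ (by omega),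
      Nat.add_comm 1 d]
    rw [show (d + 1).descFactorial d = d.factorial * (d + 1) by
      have := Nat.factorial_mul_descFactorial (n := d + 1) (k := d) (by omega)
      rw [Nat.factorial_succ] at this
      simp at this
      linarith]
    rw [show s.card - (d + 1) = j + 1 by omega]
    push_cast [nsmul_eq_mul]
    ring
  have e2 : 2 * (derivative^[d] P).coeff 2
      = (d.factorial : ℝ) * (d + 1) * (d + 2) * s.esymm j := by
    rw [coeff_iterate_derivative, hP, Multiset.prod_X_add_C_coeff _ (by omega),
      Nat.add_comm 2 d]
    have h3 : 2 * (d + 2).descFactorial d = d.factorial * (d + 1) * (d + 2) := by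
      have := Nat.factorial_mul_descFactorial (n := d + 2) (k := d) (by omega)
      rw [Nat.factorial_succ, Nat.factorial_succ] at this
      simp at this
      linarith
    rw [show s.card - (d + 2) = j by omega]
    have h3' : (2 : ℝ) * ((d + 2).descFactorial d : ℕ) = d.factorial * (d + 1) * (d + 2) := by
      exact_mod_cast h3
    rw [nsmul_eq_mul, ← mul_assoc, h3']
  rw [hdeg', e1, show ∀ n a b : ℝ, 2 * n * (a * b) = n * (a * (2 * b)) by intros; ring, e0, e2] at h
  have hf : (0 : ℝ) < (d.factorial : ℝ) ^ 2 * (d + 1) := by positivity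
  have hcd : (s.card : ℝ) = j + 2 + d := by exact_mod_cast hd
  rw [hcd]
  push_cast at h
  refine le_of_mul_le_mul_left ?_ hf
  nlinarith [h]

theorem newton_weak (s : Multiset ℝ) (j : ℕ) :
    s.esymm (j + 2) * s.esymm j ≤ s.esymm (j + 1) ^ 2 := by
  by_cases hj : j + 2 ≤ s.card
  · have h := newton s j hj
    have hc : (j : ℝ) + 2 ≤ s.card := by exact_mod_cast hj
    by_contra! hlt
    have h1 : (0 : ℝ) < ((j : ℝ) + 2) * (s.card - j) := by
      have : (0 : ℝ) ≤ j := j.cast_nonneg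
      exact mul_pos (by linarith) (by linarith)
    have h2 := mul_lt_mul_of_pos_left hlt h1
    have h3 : ((j : ℝ) + 1) * (s.card - j - 1) ≤ ((j : ℝ) + 2) * (s.card - j) := by nlinarith
    nlinarith [mul_le_mul_of_nonneg_right h3 (sq_nonneg (s.esymm (j + 1)))]
  · rw [esymm_of_card_lt (by omega : s.card < j + 2), zero_mul]
    positivity

end Newton

/-! ### Gårding cones: sign and size of the linearised coefficients -/

section Garding

/-- Suppose σ_j(t) > 0 ≥ σ_{j+1}(t). Positivity of σ_{j+1}(t) + a σ_j(t) forces a > 0 and a σ_j(t) >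
-σ_{j+1}(t). Positivity of σ_{j+2}(t) + a σ_{j+1}(t) then gives σ_{j+2}(t) σ_j(t) > σ_{j+1}(t)²,
against Newton. -/
theorem esymm_pos_of_cons {a : ℝ} {t : Multiset ℝ} {m : ℕ}
    (h : ∀ j, 1 ≤ j → j ≤ m + 1 → 0 < (a ::ₘ t).esymm j) :
    ∀ j ≤ m, 0 < t.esymm j := by
  intro j hj
  induction j with
  | zero => simp [esymm_zero]
  | succ j ih =>
    have ihj := ih (by omega)
    by_contra! hneg
    have h1 := h (j + 1) (by omega) (by omega)
    have h2 := h (j + 2) (by omega) (by omega)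
    rw [esymm_cons] at h1
    rw [show j + 2 = (j + 1) + 1 from rfl, esymm_cons] at h2
    have hN := newton_weak t j
    have ha : 0 < a := by
      by_contra! ha
      nlinarith
    have h3 := mul_pos h1 h2
    nlinarith [mul_pos ha ihj]

/-- Each product of `j` entries survives the removal of any of the `s.card - j` others. This
evaluates the trace of the linearisation. -/
theorem sum_esymm_erase (s : Multiset ℝ) (j : ℕ) :
    (s.map fun a => (s.erase a).esymm j).sum = ((s.card : ℝ) - j) * s.esymm j := by
  induction s using Multiset.induction generalizing j with
  | empty =>
    rcases Nat.eq_zero_or_pos j with rfl | hj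
    · simp
    · simp [esymm_of_card_lt (s := 0) (k := j) (by simpa using hj)]
  | cons a t ih =>
    have h : ∀ i, ((a ::ₘ t).map fun b => ((a ::ₘ t).erase b).esymm i).sum
        = t.esymm i + (t.map fun b => (a ::ₘ t.erase b).esymm i).sum := by
      intro i
      rw [Multiset.map_cons, Multiset.sum_cons, Multiset.erase_cons_head]
      congr 2
      refine Multiset.map_congr rfl fun b hb => ?_
      rw [Multiset.erase_cons_tail_of_mem hb]
    rw [h]
    cases j with
    | zero => simp [esymm_zero]; ring
    | succ j =>
      simp only [esymm_cons, Multiset.sum_map_add, Multiset.sum_map_mul_left, ih,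
        Multiset.card_cons]
      push_cast
      ring

/-- Euler's identity for the homogeneous function σ_{j+1}, whose derivative in the entry `a` is σ_j
of the remaining entries. -/
theorem sum_mul_esymm_erase (s : Multiset ℝ) (j : ℕ) :
    (s.map fun a => a * (s.erase a).esymm j).sum = ((j : ℝ) + 1) * s.esymm (j + 1) := by
  have h : (s.map fun a => a * (s.erase a).esymm j)
      = s.map fun a => s.esymm (j + 1) - (s.erase a).esymm (j + 1) := by
    refine Multiset.map_congr rfl fun a ha => ?_
    conv_rhs => rw [← Multiset.cons_erase ha, esymm_cons, Multiset.erase_cons_head]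
    ring
  rw [h, Multiset.sum_map_sub, sum_esymm_erase]
  simp
  ring

/-- By Newton the ratios σ_{i+1}/σ_i decrease in i, and their product telescopes to σ_{m+1}; the
last ratio is the smallest factor. -/
theorem ratio_pow_le {s : Multiset ℝ} {m : ℕ} (h : ∀ j, 1 ≤ j → j ≤ m + 1 → 0 < s.esymm j) :
    (s.esymm (m + 1) / s.esymm m) ^ (m + 1) ≤ s.esymm (m + 1) := by
  induction m with
  | zero => simp [esymm_zero]
  | succ m ih =>
    have ih' := ih fun j h1 h2 => h j h1 (by omega)
    have p0 : 0 < s.esymm m := by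
      rcases Nat.eq_zero_or_pos m with rfl | hm
      · simp [esymm_zero]
      · exact h m hm (by omega)
    have p1 := h (m + 1) (by omega) (by omega)
    have p2 := h (m + 1 + 1) (by omega) (by omega)
    have hN := newton_weak s m
    have hr : s.esymm (m + 1 + 1) / s.esymm (m + 1) ≤ s.esymm (m + 1) / s.esymm m := by
      rw [div_le_div_iff₀ p1 p0]; nlinarith
    calc (s.esymm (m + 1 + 1) / s.esymm (m + 1)) ^ (m + 1 + 1)
        = (s.esymm (m + 1 + 1) / s.esymm (m + 1)) ^ (m + 1)
          * (s.esymm (m + 1 + 1) / s.esymm (m + 1)) := pow_succ _ _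
      _ ≤ s.esymm (m + 1) * (s.esymm (m + 1 + 1) / s.esymm (m + 1)) := by
          gcongr
          exact (pow_le_pow_left₀ (by positivity) hr _).trans ih'
      _ = s.esymm (m + 1 + 1) := by field_simp

/-- The linearised coefficients `σ_{k-1;i} + α σ_{k-2;i}` (with `k = m + 2`) are nonnegative. -/
theorem linearized_coeff_nonneg {a : ℝ} {t : Multiset ℝ} {m : ℕ} {α α₀ : ℝ} (hα₀ : 0 ≤ α₀)
    (h : ∀ j, 1 ≤ j → j ≤ m + 1 → 0 < (a ::ₘ t).esymm j)
    (he : (a ::ₘ t).esymm (m + 2) + α * (a ::ₘ t).esymm (m + 1) = α₀) :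
    0 ≤ t.esymm (m + 1) + α * t.esymm m := by
  have hp := h (m + 1) (by omega) le_rfl
  have ht := esymm_pos_of_cons h m le_rfl
  have hN := newton_weak t m
  rw [show m + 2 = (m + 1) + 1 from rfl] at he hN
  rw [esymm_cons, esymm_cons] at he
  rw [esymm_cons] at hp
  refine nonneg_of_mul_nonneg_right (b := t.esymm (m + 1) + α * t.esymm m) ?_ hp
  -- Multiplication by the positive σ_{m+1} allows α to be eliminated with the equation. What
  -- remains is Newton's defect for `t` plus α₀ σ_m(t), so the sign of α plays no role.
  have : (t.esymm (m + 1) + a * t.esymm m) * (t.esymm (m + 1) + α * t.esymm m)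
     = (t.esymm (m + 1) ^ 2 - t.esymm (m + 1 + 1) * t.esymm m) + α₀ * t.esymm m := by
    rw [← he]; ring
  rw [this]
  have := mul_nonneg hα₀ ht.le
  linarith

/-- Lower bound for the trace of the linearisation (with `k = m + 2`). -/
theorem exists_trace_lower_bound (n m : ℕ) (hn : m + 2 ≤ n) (m₀ : ℝ) (hm₀ : 0 < m₀) :
    ∃ c : ℝ, 0 < c ∧ ∀ (s : Multiset ℝ) (α α₀ : ℝ), s.card = n → m₀ ≤ α₀ →
      (∀ j, 1 ≤ j → j ≤ m + 1 → 0 < s.esymm j) →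
      s.esymm (m + 2) + α * s.esymm (m + 1) = α₀ →
      c * (1 + s.esymm (m + 1))
        ≤ ((n : ℝ) - (m + 1)) * s.esymm (m + 1) + α * (((n : ℝ) - m) * s.esymm m) := by
  refine ⟨min (1 / (2 * (m + 2))) (m₀ / 2), by positivity, ?_⟩
  intro s α α₀ hs hα₀ h he
  set c := min (1 / (2 * ((m : ℝ) + 2))) (m₀ / 2)
  have hc1 : c ≤ 1 / (2 * ((m : ℝ) + 2)) := min_le_left _ _
  have hc2 : c ≤ m₀ / 2 := min_le_right _ _
  have hc0 : 0 < c := by positivity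
  have hnm : (m : ℝ) + 2 ≤ n := by exact_mod_cast hn
  have p1 := h (m + 1) (by omega) le_rfl
  have p0 : 0 < s.esymm m := by
    rcases Nat.eq_zero_or_pos m with rfl | hm
    · simp [esymm_zero]
    · exact h m hm (by omega)
  have hN := newton s m (by omega)
  rw [hs] at hN
  have hr := ratio_pow_le h
  set E2 := s.esymm (m + 2)
  set E1 := s.esymm (m + 1)
  set E0 := s.esymm m
  have hα : α = (α₀ - E2) / E1 := by field_simp; linarith
  have hm : (0 : ℝ) ≤ m := m.cast_nonneg
  -- After multiplication by `E1` and elimination of α, the sharp constant in Newton's inequality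
  -- leaves the surplus `E1 ^ 2 / (m + 2)`. The weak form `newton_weak` would not.
  have t1 : 1 / ((m : ℝ) + 2) * E1 ^ 2 + m₀ * E0
      ≤ E1 * (((n : ℝ) - (m + 1)) * E1 + α * (((n : ℝ) - m) * E0)) := by
    rw [hα]
    have : E1 * (((n : ℝ) - (m + 1)) * E1 + (α₀ - E2) / E1 * (((n : ℝ) - m) * E0))
      = ((n : ℝ) - (m + 1)) * E1 ^ 2 + (α₀ - E2) * (((n : ℝ) - m) * E0) := by
      field_simp
    rw [this]
    have a1 : m₀ * E0 ≤ α₀ * (((n : ℝ) - m) * E0) := by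
      have : m₀ * 1 ≤ α₀ * ((n : ℝ) - m) := by
        apply mul_le_mul hα₀ (by linarith) (by norm_num) (by linarith)
      nlinarith
    have a2 : ((n : ℝ) - m) * (E2 * E0) ≤ (m + 1) * (n - m - 1) * E1 ^ 2 / (m + 2) := by
      rw [le_div_iff₀ (by linarith)]; linarith
    have a3 : 1 / ((m : ℝ) + 2) * E1 ^ 2
        ≤ ((n : ℝ) - (m + 1)) * E1 ^ 2 - (m + 1) * (n - m - 1) * E1 ^ 2 / (m + 2) := by
      have : ((n : ℝ) - (m + 1)) * E1 ^ 2 - (m + 1) * (n - m - 1) * E1 ^ 2 / (m + 2)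
        = 1 / ((m : ℝ) + 2) * (((n : ℝ) - m - 1) * E1 ^ 2) := by field_simp; ring
      rw [this]
      gcongr
      nlinarith [sq_nonneg E1]
    nlinarith
  have t2 : min 1 (E0 / E1) ≥ 0 := by positivity
  -- If `E0 < E1`, the ratio exceeds 1 and `ratio_pow_le` gives `E1 ≥ 1`. In the first case the
  -- quadratic term of `t1` pays for everything; in the second `m₀ * E0` pays for the part linear in
  -- `E1`.
  have t3 : 1 ≤ E1 ∨ E1 ≤ E0 := by
    by_contra! hcon
    have : 1 < E1 / E0 := by rw [lt_div_iff₀ p0]; linarith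
    have := one_le_pow₀ (n := m + 1) this.le
    linarith
  have t4 : E1 * (c * (1 + E1)) ≤ 1 / ((m : ℝ) + 2) * E1 ^ 2 + m₀ * E0 := by
    have hc1' : c * 2 ≤ 1 / ((m : ℝ) + 2) := by
      calc c * 2 ≤ 1 / (2 * ((m : ℝ) + 2)) * 2 := by gcongr
        _ = 1 / ((m : ℝ) + 2) := by field_simp
    rcases t3 with h1 | h1
    · have : c * (E1 + E1 ^ 2) ≤ c * (2 * E1 ^ 2) := by gcongr; nlinarith
      nlinarith [mul_le_mul_of_nonneg_right hc1' (sq_nonneg E1), mul_pos hm₀ p0]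
    · have : c * E1 ≤ m₀ * E0 := mul_le_mul (by linarith) h1 p1.le hm₀.le
      nlinarith [mul_le_mul_of_nonneg_right hc1' (sq_nonneg E1), mul_pos hc0 (sq_pos_of_pos p1)]
  exact le_of_mul_le_mul_left (t4.trans t1) p1

end Garding

/-! ### Derivatives of σ_k of a matrix and the normalised linearisation -/

section Linearization

open Matrix

variable {n : ℕ}

/-- The multiset of values of a vector. -/
abbrev vals (l : Fin n → ℝ) : Multiset ℝ := Finset.univ.val.map l

/-- The `k`-th elementary symmetric function of the eigenvalues as a polynomial in the entries. -/
def symCoeff (k : ℕ) (a : Fin n → Fin n → ℝ) : ℝ :=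
  (-1) ^ k * (Matrix.of a).charpoly.coeff (n - k)

/-- The entries of a matrix, as an element of a normed space. -/
def ent (A : Matrix (Fin n) (Fin n) ℝ) : Fin n → Fin n → ℝ := fun i j => A i j

theorem ent_of (X : Fin n → Fin n → ℝ) : ent (Matrix.of X) = X := rfl

/-- The derivative of `symCoeff k` at the matrix `A` in the direction `B`. -/
def dSym (k : ℕ) (A B : Matrix (Fin n) (Fin n) ℝ) : ℝ :=
  fderiv ℝ (symCoeff k) (ent A) (ent B)

theorem prod_X_sub_C_vals (l : Fin n → ℝ) : ∏ i, (Polynomial.X - Polynomial.C (l i))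
    = ((vals l).map fun a => Polynomial.X - Polynomial.C a).prod := by
  rw [vals, Multiset.map_map]
  rfl

theorem eigenvalues_of_diagonalized {A P Q : Matrix (Fin n) (Fin n) ℝ} {l : Fin n → ℝ}
    (hPQ : P * Q = 1) (hD : Q * A * P = diagonal l) : eigenvalues A = vals l := by
  have h1 : A.charpoly = (diagonal l).charpoly := by
    rw [← hD, charpoly_mul_comm, ← mul_assoc, hPQ, one_mul]
  rw [eigenvalues, h1, charpoly_diagonal, prod_X_sub_C_vals,
    Polynomial.roots_multiset_prod_X_sub_C]

theorem symCoeff_ent (k : ℕ) (A : Matrix (Fin n) (Fin n) ℝ) :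
    symCoeff k (ent A) = (-1) ^ k * A.charpoly.coeff (n - k) := rfl

theorem symCoeff_diagonal {k : ℕ} (hk : k ≤ n) (l : Fin n → ℝ) :
    symCoeff k (ent (diagonal l)) = (vals l).esymm k := by
  rw [symCoeff_ent, charpoly_diagonal, prod_X_sub_C_vals,
    Multiset.prod_X_sub_C_coeff _ (by simp)]
  simp only [vals, Multiset.card_map, Finset.card_val, Finset.card_univ, Fintype.card_fin]
  rw [show n - (n - k) = k by omega, ← mul_assoc, ← mul_pow]
  norm_num

theorem symCoeff_conj (k : ℕ) {A P Q : Matrix (Fin n) (Fin n) ℝ} (hPQ : P * Q = 1) :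
    symCoeff k (ent (Q * A * P)) = symCoeff k (ent A) := by
  rw [symCoeff_ent, symCoeff_ent, charpoly_mul_comm, ← mul_assoc, hPQ, one_mul]

/-- `sigma` sees only the real roots of the characteristic polynomial, so it agrees with the
coefficient when the matrix is diagonalisable over ℝ. The coefficient is polynomial in the entries
and can be differentiated. -/
theorem sigma_eq_symCoeff {k : ℕ} (hk : k ≤ n) {A P Q : Matrix (Fin n) (Fin n) ℝ}
    {l : Fin n → ℝ} (hPQ : P * Q = 1) (hD : Q * A * P = diagonal l) :
    sigma k A = symCoeff k (ent A) := by
  rw [sigma, eigenvalues_of_diagonalized hPQ hD, ← symCoeff_diagonal hk, ← hD, symCoeff_conj k hPQ]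

theorem contDiff_symCoeff (k : ℕ) : ContDiff ℝ ω (symCoeff (n := n) k) := by
  have h : symCoeff (n := n) k = fun a => (-1) ^ k *
      MvPolynomial.aeval (fun p : Fin n × Fin n => a p.1 p.2)
        ((charpoly.univ ℝ (Fin n)).coeff (n - k)) := by
    funext a
    unfold symCoeff
    congr 1
    exact (charpoly.univ_coeff_eval₂Hom (Fin n) (RingHom.id ℝ) (fun p => a p.1 p.2) (n - k)).symm
  rw [h]
  refine contDiff_const.mul (AnalyticOnNhd.contDiff ?_)
  refine AnalyticOnNhd.aeval_mvPolynomial (fun p => ?_) _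
  exact fun a _ => (((ContinuousLinearMap.proj (R := ℝ) (φ := fun _ : Fin n => ℝ) p.2).comp
    (ContinuousLinearMap.proj (R := ℝ) (φ := fun _ : Fin n => Fin n → ℝ) p.1))).analyticAt a

theorem differentiable_symCoeff (k : ℕ) : Differentiable ℝ (symCoeff (n := n) k) :=
  (contDiff_symCoeff k).differentiable (by simp)

/-- Conjugation, as a continuous linear map. -/
def conjL (Q P : Matrix (Fin n) (Fin n) ℝ) : (Fin n → Fin n → ℝ) →L[ℝ] (Fin n → Fin n → ℝ) :=
  LinearMap.toContinuousLinearMap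
    { toFun := fun X => ent (Q * Matrix.of X * P)
      map_add' := fun X Y => by
        rw [← ent_of X, ← ent_of Y]
        change ent (Q * (Matrix.of X + Matrix.of Y) * P)
          = ent (Q * Matrix.of X * P + Q * Matrix.of Y * P)
        rw [mul_add, add_mul]
      map_smul' := fun c X => by
        change ent (Q * (c • Matrix.of X) * P) = ent (c • (Q * Matrix.of X * P))
        rw [Matrix.mul_smul, Matrix.smul_mul] }

theorem conjL_ent (Q P A : Matrix (Fin n) (Fin n) ℝ) :
    conjL Q P (ent A) = ent (Q * A * P) := rfl

theorem dSym_conj (k : ℕ) {P Q : Matrix (Fin n) (Fin n) ℝ} (hPQ : P * Q = 1)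
    (A B : Matrix (Fin n) (Fin n) ℝ) :
    dSym k A B = dSym k (Q * A * P) (Q * B * P) := by
  have h : symCoeff (n := n) k = symCoeff k ∘ conjL Q P := by
    funext X
    exact (symCoeff_conj k (A := Matrix.of X) hPQ).symm
  unfold dSym
  conv_lhs => rw [h]
  rw [fderiv_comp _ (differentiable_symCoeff k _) (conjL Q P).differentiableAt]
  simp [conjL_ent]

theorem dSym_smul (k : ℕ) (A B : Matrix (Fin n) (Fin n) ℝ) (c : ℝ) :
    dSym k A (c • B) = c * dSym k A B :=
  (fderiv ℝ (symCoeff k) (ent A)).map_smul c (ent B)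

theorem dSym_sum (k : ℕ) (A : Matrix (Fin n) (Fin n) ℝ) {ι : Type*} (s : Finset ι)
    (B : ι → Matrix (Fin n) (Fin n) ℝ) :
    dSym k A (∑ i ∈ s, B i) = ∑ i ∈ s, dSym k A (B i) := by
  have : ent (∑ i ∈ s, B i) = ∑ i ∈ s, ent (B i) := by
    funext x y
    simp [ent, Matrix.sum_apply]
  rw [dSym, this, map_sum]
  rfl

theorem vals_eq_cons (l : Fin n → ℝ) (i : Fin n) :
    vals l = l i ::ₘ (vals l).erase (l i) :=
  (Multiset.cons_erase (Multiset.mem_map_of_mem l (Finset.mem_univ i))).symm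

theorem vals_update (l : Fin n → ℝ) (i : Fin n) (x : ℝ) :
    vals (Function.update l i x) = x ::ₘ (vals l).erase (l i) := by
  have h : ∀ l : Fin n → ℝ, vals l = l i ::ₘ (Finset.univ.erase i).val.map l := fun l => by
    rw [← Multiset.map_cons, Finset.erase_val, Multiset.cons_erase (Finset.mem_univ_val i)]
  rw [h (Function.update l i x), Function.update_self, h l, Multiset.erase_cons_head]
  congr 1
  refine Multiset.map_congr rfl fun j hj => ?_
  exact Function.update_of_ne (Finset.ne_of_mem_erase (Finset.mem_def.2 hj)) _ _

/-- Off the diagonal, conjugation by the diagonal matrix with a single entry 2 at `i` fixes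
`diagonal l` and doubles the matrix unit (i, j), so the derivative there equals twice itself. On the
diagonal, only the `i`-th eigenvalue moves and σ_{k+1} is affine in it. -/
theorem dSym_diagonal {k : ℕ} (hk : k + 1 ≤ n) (l : Fin n → ℝ)
    (B : Matrix (Fin n) (Fin n) ℝ) :
    dSym (k + 1) (diagonal l) B = ∑ i, ((vals l).erase (l i)).esymm k * B i i := by
  have hoff : ∀ i j, i ≠ j → dSym (k + 1) (diagonal l) (Matrix.single i j (1 : ℝ)) = 0 := by
    intro i j hij
    set d : Fin n → ℝ := Function.update 1 i 2 with hd
    set d' : Fin n → ℝ := Function.update 1 i 2⁻¹ with hd'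
    have hdd : ∀ x, d x * d' x = 1 := fun x => by
      by_cases hx : x = i
      · subst hx; simp [hd, hd']
      · simp [hd, hd', hx]
    have hPQ : (diagonal d' : Matrix (Fin n) (Fin n) ℝ) * diagonal d = 1 := by
      rw [diagonal_mul_diagonal, ← diagonal_one]
      congr 1; funext x; rw [mul_comm, hdd]
    have h := dSym_conj (k + 1) hPQ (diagonal l) (Matrix.single i j (1 : ℝ))
    have c1 : diagonal d * diagonal l * diagonal d' = diagonal l := by
      rw [diagonal_mul_diagonal, diagonal_mul_diagonal]
      congr 1; funext x
      calc d x * l x * d' x = (d x * d' x) * l x := by ring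
        _ = l x := by rw [hdd, one_mul]
    have c2 : diagonal d * Matrix.single i j (1 : ℝ) * diagonal d'
        = (2 : ℝ) • Matrix.single i j (1 : ℝ) := by
      ext x y
      rw [mul_diagonal, diagonal_mul, Matrix.smul_apply]
      by_cases hx : i = x
      · by_cases hy : j = y
        · subst hx hy
          simp [hd, hd', hij.symm]
        · simp [hy]
      · simp [hx]
    rw [c1, c2, dSym_smul] at h
    linarith
  have hdiag : ∀ i, dSym (k + 1) (diagonal l) (Matrix.single i i (1 : ℝ))
      = ((vals l).erase (l i)).esymm k := by
    intro i
    have h1 : HasDerivAt (fun t : ℝ => symCoeff (k + 1)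
        (ent (diagonal l) + t • ent (Matrix.single i i (1 : ℝ))))
        (dSym (k + 1) (diagonal l) (Matrix.single i i (1 : ℝ))) 0 := by
      have hg : HasDerivAt (fun t : ℝ => ent (diagonal l)
          + t • ent (Matrix.single i i (1 : ℝ))) (ent (Matrix.single i i (1 : ℝ))) 0 := by
        have := ((hasDerivAt_id (0 : ℝ)).smul_const
          (ent (Matrix.single i i (1 : ℝ)))).const_add (ent (diagonal l))
        simpa using this
      have hf := (differentiable_symCoeff (n := n) (k + 1)
        (ent (diagonal l) + (0 : ℝ) • ent (Matrix.single i i (1 : ℝ)))).hasFDerivAt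
      have := hf.comp_hasDerivAt (0 : ℝ) hg
      rw [zero_smul, add_zero] at this
      exact this
    have h2 : (fun t : ℝ => symCoeff (k + 1)
        (ent (diagonal l) + t • ent (Matrix.single i i (1 : ℝ))))
        = fun t => ((vals l).erase (l i)).esymm (k + 1)
          + (l i + t) * ((vals l).erase (l i)).esymm k := by
      funext t
      have : ent (diagonal l) + t • ent (Matrix.single i i (1 : ℝ))
          = ent (diagonal (Function.update l i (l i + t))) := by
        change ent (diagonal l + t • Matrix.single i i (1 : ℝ)) = _
        congr 1
        ext x y
        rw [Matrix.add_apply, Matrix.smul_apply]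
        by_cases hx : x = i
        · subst hx
          by_cases hy : x = y
          · subst hy; simp
          · simp [hy]
        · by_cases hy : x = y
          · subst hy; simp [hx, Ne.symm hx]
          · simp [hy, Ne.symm hx]
      rw [this, symCoeff_diagonal hk, vals_update, esymm_cons]
    rw [h2] at h1
    have h3 : HasDerivAt (fun t : ℝ => ((vals l).erase (l i)).esymm (k + 1)
          + (l i + t) * ((vals l).erase (l i)).esymm k) (((vals l).erase (l i)).esymm k) 0 := by
      have := ((((hasDerivAt_id (0 : ℝ)).const_add (l i)).mul_const
        (((vals l).erase (l i)).esymm k)).const_add (((vals l).erase (l i)).esymm (k + 1)))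
      simpa using this
    exact h1.unique h3
  conv_lhs => rw [Matrix.matrix_eq_sum_single B]
  simp only [dSym_sum]
  refine Finset.sum_congr rfl fun i _ => ?_
  have hs : ∀ j, Matrix.single i j (B i j) = B i j • Matrix.single i j (1 : ℝ) := fun j => by
    rw [Matrix.smul_single, smul_eq_mul, mul_one]
  simp only [hs, dSym_smul]
  rw [Finset.sum_eq_single i]
  · rw [hdiag, mul_comm]
  · intro j _ hj
    rw [hoff i j hj.symm, mul_zero]
  · simp

theorem dSym_eq {k : ℕ} (hk : k + 1 ≤ n) {A P Q : Matrix (Fin n) (Fin n) ℝ}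
    {l : Fin n → ℝ} (hPQ : P * Q = 1) (hD : Q * A * P = diagonal l)
    (B : Matrix (Fin n) (Fin n) ℝ) :
    dSym (k + 1) A B = ∑ i, ((vals l).erase (l i)).esymm k * (Q * B * P) i i := by
  rw [dSym_conj (k + 1) hPQ, hD, dSym_diagonal hk]

/-- With `G = Bᵀ * B`, the endomorphism `G⁻¹ * S` is conjugate under `B` to the symmetric matrix B⁻ᵀ
S B⁻¹, to which the spectral theorem applies. The columns of `P` form a `G`-orthonormal eigenbasis.
-/
theorem exists_simultaneous_diagonalization {G S : Matrix (Fin n) (Fin n) ℝ} (hG : G.PosDef)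
    (hS : Sᵀ = S) : ∃ (P Q : Matrix (Fin n) (Fin n) ℝ) (l : Fin n → ℝ),
      P * Q = 1 ∧ Q * P = 1 ∧ P * Pᵀ = G⁻¹ ∧ Qᵀ * Q = G ∧ Q * (G⁻¹ * S) * P = diagonal l := by
  obtain ⟨B, hB⟩ : ∃ B : Matrix (Fin n) (Fin n) ℝ, G = Bᵀ * B := by
    open scoped MatrixOrder in
    obtain ⟨B, hB⟩ := CStarAlgebra.nonneg_iff_eq_star_mul_self.1 hG.posSemidef.nonneg
    exact ⟨B, by simpa [star_eq_conjTranspose] using hB⟩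
  have hdet : IsUnit G.det := (Matrix.isUnit_iff_isUnit_det G).1 hG.isUnit
  have hBdet : IsUnit B.det := by
    rw [hB, det_mul] at hdet
    exact isUnit_of_mul_isUnit_right hdet
  have b1 : B * B⁻¹ = 1 := mul_nonsing_inv B hBdet
  have b2 : B⁻¹ * B = 1 := nonsing_inv_mul B hBdet
  have b3 : (B⁻¹)ᵀ * Bᵀ = 1 := by rw [← transpose_mul, b1, transpose_one]
  have hGinv : G⁻¹ = B⁻¹ * (B⁻¹)ᵀ := by
    rw [hB, Matrix.mul_inv_rev, transpose_nonsing_inv]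
  set T := (B⁻¹)ᵀ * S * B⁻¹ with hT
  have hTs : T.IsHermitian := by
    rw [Matrix.IsHermitian, conjTranspose_eq_transpose_of_trivial, hT, transpose_mul, transpose_mul,
      transpose_transpose, hS, mul_assoc]
  set U : Matrix (Fin n) (Fin n) ℝ := (hTs.eigenvectorUnitary : Matrix (Fin n) (Fin n) ℝ) with hU
  have u1 : U * Uᵀ = 1 := by
    have := Unitary.mul_star_self_of_mem hTs.eigenvectorUnitary.2
    rwa [star_eq_conjTranspose, conjTranspose_eq_transpose_of_trivial] at this
  have u2 : Uᵀ * U = 1 := by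
    have := Unitary.star_mul_self_of_mem hTs.eigenvectorUnitary.2
    rwa [star_eq_conjTranspose, conjTranspose_eq_transpose_of_trivial] at this
  obtain ⟨l, hsp⟩ : ∃ l, T = U * diagonal l * Uᵀ := by
    refine ⟨hTs.eigenvalues, ?_⟩
    have := hTs.spectral_theorem
    rw [Unitary.conjStarAlgAut_apply, star_eq_conjTranspose,
      conjTranspose_eq_transpose_of_trivial] at this
    simpa using this
  refine ⟨B⁻¹ * U, Uᵀ * B, l, ?_, ?_, ?_, ?_, ?_⟩
  · calc B⁻¹ * U * (Uᵀ * B) = B⁻¹ * (U * Uᵀ) * B := by simp only [mul_assoc]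
      _ = 1 := by rw [u1, mul_one, b2]
  · calc Uᵀ * B * (B⁻¹ * U) = Uᵀ * (B * B⁻¹) * U := by simp only [mul_assoc]
      _ = 1 := by rw [b1, mul_one, u2]
  · calc B⁻¹ * U * (B⁻¹ * U)ᵀ = B⁻¹ * (U * Uᵀ) * (B⁻¹)ᵀ := by
          rw [transpose_mul]; simp only [mul_assoc]
      _ = G⁻¹ := by rw [u1, mul_one, hGinv]
  · calc (Uᵀ * B)ᵀ * (Uᵀ * B) = Bᵀ * (U * Uᵀ) * B := by
          rw [transpose_mul, transpose_transpose]; simp only [mul_assoc]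
      _ = G := by rw [u1, mul_one, hB]
  · calc Uᵀ * B * (G⁻¹ * S) * (B⁻¹ * U) = Uᵀ * (B * B⁻¹) * ((B⁻¹)ᵀ * S * B⁻¹) * U := by
          rw [hGinv]; simp only [mul_assoc]
      _ = (Uᵀ * U) * diagonal l * (Uᵀ * U) := by
          rw [b1, mul_one, ← hT, hsp]; simp only [mul_assoc]
      _ = diagonal l := by rw [u2, one_mul, mul_one]

/-- The linearised operator at a solution, normalised to have trace one, with the bounds that
follow from the equation and from the differentiated equation. -/
theorem exists_normalized_linearization (n k : ℕ) (hk : 2 ≤ k) (hkn : k ≤ n) (m₀ K : ℝ)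
    (hm₀ : 0 < m₀) :
    ∃ C : ℝ, 0 < C ∧ ∀ (G S : Matrix (Fin n) (Fin n) ℝ) (α α₀ : ℝ), G.PosDef → Sᵀ = S →
      (∀ j, 1 ≤ j → j ≤ k - 1 → 0 < sigma j (G⁻¹ * S)) →
      sigma k (G⁻¹ * S) + α * sigma (k - 1) (G⁻¹ * S) = α₀ → m₀ ≤ α₀ → α₀ ≤ K → |α| ≤ K →
      ∃ (P Q : Matrix (Fin n) (Fin n) ℝ) (q : Fin n → ℝ),
        P * Q = 1 ∧ Q * P = 1 ∧ P * Pᵀ = G⁻¹ ∧ Qᵀ * Q = G ∧ (∀ i, 0 ≤ q i) ∧ ∑ i, q i = 1 ∧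
        |∑ i, q i * (Q * (G⁻¹ * S) * P) i i| ≤ C ∧
        ∀ (B : Matrix (Fin n) (Fin n) ℝ) (β β₀ : ℝ), |β| ≤ K → |β₀| ≤ K →
          dSym k (G⁻¹ * S) B + α * dSym (k - 1) (G⁻¹ * S) B
            + β * symCoeff (k - 1) (ent (G⁻¹ * S)) = β₀ →
          |∑ i, q i * (Q * B * P) i i| ≤ C := by
  obtain ⟨m, rfl⟩ := Nat.exists_eq_add_of_le' hk
  obtain ⟨c, hc, hcc⟩ := exists_trace_lower_bound n m hkn m₀ hm₀
  -- All quantities to be estimated are at most `(m + 2) * (|K| + 1) * (1 + σ)`, and the trace of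
  -- the linearisation is at least `c * (1 + σ)`.
  refine ⟨((m : ℝ) + 2) * (|K| + 1) / c, by positivity, ?_⟩
  intro G S α α₀ hG hS hpos heq hα₀ hα₀K hαK
  obtain ⟨P, Q, l, hPQ, hQP, hPP, hQQ, hD⟩ := exists_simultaneous_diagonalization hG hS
  have hsig : ∀ j, sigma j (G⁻¹ * S) = (vals l).esymm j := fun j => by
    rw [sigma, eigenvalues_of_diagonalized hPQ hD]
  have hk1 : m + 2 - 1 = m + 1 := rfl
  rw [hk1] at *
  have hsc : symCoeff (m + 1) (ent (G⁻¹ * S)) = (vals l).esymm (m + 1) := by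
    rw [← sigma_eq_symCoeff (by omega) hPQ hD, hsig]
  simp only [hsig] at hpos heq
  -- The derivative of σ_{m+2} + α σ_{m+1} in the `i`-th eigenvalue; the weights `q` are these
  -- divided by their sum.
  set r : Fin n → ℝ := fun i => ((vals l).erase (l i)).esymm (m + 1)
    + α * ((vals l).erase (l i)).esymm m with hr
  have hr0 : ∀ i, 0 ≤ r i := fun i => by
    refine linearized_coeff_nonneg (a := l i) (α₀ := α₀) (by linarith) ?_ ?_
    · rw [← vals_eq_cons]; exact hpos
    · rw [← vals_eq_cons]; exact heq
  have hcard : (vals l).card = n := by simp [vals]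
  have hsum : ∑ i, r i = ((n : ℝ) - (m + 1)) * (vals l).esymm (m + 1)
      + α * (((n : ℝ) - m) * (vals l).esymm m) := by
    have h1 := sum_esymm_erase (vals l) (m + 1)
    have h2 := sum_esymm_erase (vals l) m
    simp only [vals, Multiset.map_map, Function.comp_def] at h1 h2
    change ∑ i, _ = _ at h1
    change ∑ i, _ = _ at h2
    simp only [hr, Finset.sum_add_distrib, ← Finset.mul_sum]
    rw [h1, h2]
    simp
  set σ := (vals l).esymm (m + 1) with hσ
  have hσpos : 0 < σ := hpos (m + 1) (by omega) le_rfl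
  have hτ : c * (1 + σ) ≤ ∑ i, r i := by
    rw [hsum]; exact hcc (vals l) α α₀ hcard hα₀ hpos heq
  set τ := ∑ i, r i with hτd
  have hτ0 : 0 < τ := lt_of_lt_of_le (by positivity) hτ
  have hlin : ∀ B : Matrix (Fin n) (Fin n) ℝ,
      dSym (m + 2) (G⁻¹ * S) B + α * dSym (m + 1) (G⁻¹ * S) B
        = ∑ i, r i * (Q * B * P) i i := fun B => by
    rw [dSym_eq (k := m + 1) hkn hPQ hD, dSym_eq (k := m) (by omega) hPQ hD,
      Finset.mul_sum, ← Finset.sum_add_distrib]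
    refine Finset.sum_congr rfl fun i _ => ?_
    simp only [hr]; ring
  have hdiv : ∀ B : Matrix (Fin n) (Fin n) ℝ, ∑ i, r i / τ * (Q * B * P) i i
      = (∑ i, r i * (Q * B * P) i i) / τ := fun B => by
    rw [Finset.sum_div]
    exact Finset.sum_congr rfl fun i _ => by ring
  have hbound : ∀ x : ℝ, |x| ≤ ((m : ℝ) + 2) * (|K| + 1) * (1 + σ) →
      |x / τ| ≤ ((m : ℝ) + 2) * (|K| + 1) / c := fun x hx => by
    rw [abs_div, abs_of_pos hτ0, div_le_div_iff₀ hτ0 hc]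
    calc |x| * c ≤ ((m : ℝ) + 2) * (|K| + 1) * (1 + σ) * c := by gcongr
      _ = ((m : ℝ) + 2) * (|K| + 1) * (c * (1 + σ)) := by ring
      _ ≤ _ := by gcongr
  have hmm : (0 : ℝ) ≤ m := m.cast_nonneg
  have hKa : K ≤ |K| := le_abs_self K
  refine ⟨P, Q, fun i => r i / τ, hPQ, hQP, hPP, hQQ, fun i => div_nonneg (hr0 i) hτ0.le, ?_, ?_, ?_⟩
  · rw [← Finset.sum_div, ← hτd, div_self hτ0.ne']
  · rw [hdiv]
    apply hbound
    have h1 := sum_mul_esymm_erase (vals l) (m + 1)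
    have h2 := sum_mul_esymm_erase (vals l) m
    simp only [vals, Multiset.map_map, Function.comp_def] at h1 h2
    change ∑ i, _ = _ at h1
    change ∑ i, _ = _ at h2
    -- By Euler's identity the sum is (m+2) σ_{m+2} + (m+1) α σ_{m+1}; the equation removes σ_{m+2},
    -- which has no a priori bound.
    have h3 : ∑ i, r i * (Q * (G⁻¹ * S) * P) i i
        = ((m : ℝ) + 2) * α₀ - α * σ := by
      have : ∑ i, r i * (Q * (G⁻¹ * S) * P) i i
          = (∑ i, l i * ((vals l).erase (l i)).esymm (m + 1))
            + α * ∑ i, l i * ((vals l).erase (l i)).esymm m := by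
        rw [Finset.mul_sum, ← Finset.sum_add_distrib]
        refine Finset.sum_congr rfl fun i _ => ?_
        rw [hD, diagonal_apply_eq]; simp only [hr]; ring
      rw [this, h1, h2, ← heq]
      change _ * (vals l).esymm (m + 2) + α * (_ * σ) = _
      push_cast
      ring
    rw [h3, abs_le]
    obtain ⟨ha, hb⟩ := abs_le.1 hαK
    constructor <;> nlinarith [abs_nonneg K, mul_nonneg hmm (abs_nonneg K), mul_nonneg hmm hσpos.le,
      mul_nonneg (mul_nonneg hmm (abs_nonneg K)) hσpos.le, mul_nonneg (abs_nonneg K) hσpos.le]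
  · intro B β β₀ hβ hβ₀ hB
    rw [hdiv, ← hlin]
    apply hbound
    rw [hsc] at hB
    have : dSym (m + 2) (G⁻¹ * S) B + α * dSym (m + 1) (G⁻¹ * S) B
        = β₀ - β * σ := by linarith
    rw [this, abs_le]
    obtain ⟨ha, hb⟩ := abs_le.1 hβ
    obtain ⟨ha', hb'⟩ := abs_le.1 hβ₀
    constructor <;> nlinarith [abs_nonneg K, mul_nonneg hmm (abs_nonneg K), mul_nonneg hmm hσpos.le,
      mul_nonneg (mul_nonneg hmm (abs_nonneg K)) hσpos.le, mul_nonneg (abs_nonneg K) hσpos.le]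

end Linearization

/-! ### One-sided calculus on the closed half-space -/

section HalfSpaceCalculus

open Filter Topology

variable {n : ℕ} [NeZero n]

/-- The closed half-space. -/
abbrev halfSpace (n : ℕ) [NeZero n] : Set (EuclideanSpace ℝ (Fin n)) := Set.range (𝓡∂ n)

/-- `f` is of class `C^m` at `z`, up to the boundary of the half-space. -/
abbrev SmoothAt {F : Type*} [NormedAddCommGroup F] [NormedSpace ℝ F] (m : WithTop ℕ∞)
    (f : EuclideanSpace ℝ (Fin n) → F) (z : EuclideanSpace ℝ (Fin n)) : Prop :=
  ContDiffWithinAt ℝ m f (halfSpace n) z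

theorem mem_halfSpace {z : EuclideanSpace ℝ (Fin n)} : z ∈ halfSpace n ↔ 0 ≤ z 0 := by
  rw [halfSpace, range_modelWithCornersEuclideanHalfSpace]; rfl

theorem uniqueDiffOn_halfSpace : UniqueDiffOn ℝ (halfSpace n) := (𝓡∂ n).uniqueDiffOn

theorem isClosed_halfSpace : IsClosed (halfSpace n) := (𝓡∂ n).isClosed_range

theorem halfSpace_mem_nhds {z : EuclideanSpace ℝ (Fin n)} (hz : 0 < z 0) : halfSpace n ∈ 𝓝 z := by
  have : {y : EuclideanSpace ℝ (Fin n) | 0 < y 0} ∈ 𝓝 z := by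
    refine IsOpen.mem_nhds (isOpen_lt continuous_const ?_) hz
    exact (EuclideanSpace.proj (𝕜 := ℝ) (0 : Fin n)).continuous
  exact mem_of_superset this fun y hy => mem_halfSpace.2 (le_of_lt hy)

variable {f f' : EuclideanSpace ℝ (Fin n) → ℝ} {z : EuclideanSpace ℝ (Fin n)}

theorem SmoothAt.diffAt {F : Type*} [NormedAddCommGroup F] [NormedSpace ℝ F]
    {f : EuclideanSpace ℝ (Fin n) → F} {m : WithTop ℕ∞} (hf : SmoothAt m f z) (hm : m ≠ 0) :
    DifferentiableWithinAt ℝ f (halfSpace n) z :=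
  ContDiffWithinAt.differentiableWithinAt hf hm

theorem partialDeriv_def (i : Fin n) :
    partialDeriv i f z = fderivWithin ℝ f (halfSpace n) z (EuclideanSpace.single i 1) := rfl

theorem partialDeriv_congr (hz : z ∈ halfSpace n) (h : f =ᶠ[𝓝[halfSpace n] z] f') (i : Fin n) :
    partialDeriv i f z = partialDeriv i f' z := by
  rw [partialDeriv, partialDeriv, h.fderivWithin_eq (h.eq_of_nhdsWithin hz)]

theorem partialDeriv_const (c : ℝ) (i : Fin n) : partialDeriv i (fun _ => c) z = 0 := by
  simp [partialDeriv_def]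

theorem partialDeriv_add (hz : z ∈ halfSpace n) (hf : DifferentiableWithinAt ℝ f (halfSpace n) z)
    (hf' : DifferentiableWithinAt ℝ f' (halfSpace n) z) (i : Fin n) :
    partialDeriv i (fun y => f y + f' y) z = partialDeriv i f z + partialDeriv i f' z := by
  simp only [partialDeriv_def]
  rw [fderivWithin_fun_add (uniqueDiffOn_halfSpace z hz) hf hf']; rfl

theorem partialDeriv_sub (hz : z ∈ halfSpace n) (hf : DifferentiableWithinAt ℝ f (halfSpace n) z)
    (hf' : DifferentiableWithinAt ℝ f' (halfSpace n) z) (i : Fin n) :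
    partialDeriv i (fun y => f y - f' y) z = partialDeriv i f z - partialDeriv i f' z := by
  simp only [partialDeriv_def]
  rw [fderivWithin_fun_sub (uniqueDiffOn_halfSpace z hz) hf hf']; rfl

theorem partialDeriv_mul (hz : z ∈ halfSpace n) (hf : DifferentiableWithinAt ℝ f (halfSpace n) z)
    (hf' : DifferentiableWithinAt ℝ f' (halfSpace n) z) (i : Fin n) :
    partialDeriv i (fun y => f y * f' y) z
      = partialDeriv i f z * f' z + f z * partialDeriv i f' z := by
  simp only [partialDeriv_def]
  rw [fderivWithin_fun_mul (uniqueDiffOn_halfSpace z hz) hf hf']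
  simp; ring

theorem partialDeriv_const_mul (hz : z ∈ halfSpace n)
    (hf : DifferentiableWithinAt ℝ f (halfSpace n) z) (c : ℝ) (i : Fin n) :
    partialDeriv i (fun y => c * f y) z = c * partialDeriv i f z := by
  rw [partialDeriv_mul hz (differentiableWithinAt_const c) hf, partialDeriv_const]; ring

theorem partialDeriv_sum {ι : Type*} (s : Finset ι) {F : ι → EuclideanSpace ℝ (Fin n) → ℝ}
    (hz : z ∈ halfSpace n) (hf : ∀ a ∈ s, DifferentiableWithinAt ℝ (F a) (halfSpace n) z)
    (i : Fin n) :
    partialDeriv i (fun y => ∑ a ∈ s, F a y) z = ∑ a ∈ s, partialDeriv i (F a) z := by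
  simp only [partialDeriv_def]
  rw [fderivWithin_fun_sum (uniqueDiffOn_halfSpace z hz) hf]
  simp

theorem partialDeriv_comp_real {φ : ℝ → ℝ} {c : ℝ} (hz : z ∈ halfSpace n)
    (hf : DifferentiableWithinAt ℝ f (halfSpace n) z) (hφ : HasDerivAt φ c (f z)) (i : Fin n) :
    partialDeriv i (fun y => φ (f y)) z = c * partialDeriv i f z := by
  have := (hφ.comp_hasFDerivWithinAt z hf.hasFDerivWithinAt).fderivWithin
    (uniqueDiffOn_halfSpace z hz)
  simp only [partialDeriv_def]
  change fderivWithin ℝ (φ ∘ f) _ z _ = _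
  rw [this]; simp

theorem partialDeriv_coord (hz : z ∈ halfSpace n) (i j : Fin n) :
    partialDeriv i (fun y => y j) z = if i = j then 1 else 0 := by
  have : HasFDerivWithinAt (fun y : EuclideanSpace ℝ (Fin n) => y j)
      (EuclideanSpace.proj (𝕜 := ℝ) j) (halfSpace n) z :=
    (EuclideanSpace.proj (𝕜 := ℝ) j).hasFDerivWithinAt
  rw [partialDeriv, this.fderivWithin (uniqueDiffOn_halfSpace z hz)]
  simp [eq_comm]

theorem fderivWithin_eq_sum (ξ : EuclideanSpace ℝ (Fin n)) :
    fderivWithin ℝ f (halfSpace n) z ξ = ∑ i, ξ i * partialDeriv i f z := by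
  have : ξ = ∑ i, ξ i • EuclideanSpace.single i (1 : ℝ) := by
    ext j
    simp [Pi.single_apply]
  conv_lhs => rw [this]
  simp [partialDeriv_def]

theorem SmoothAt.partialDeriv {m k : WithTop ℕ∞} (hf : SmoothAt k f z) (hz : z ∈ halfSpace n)
    (hk : m + 1 ≤ k) (i : Fin n) : SmoothAt m (KRicci.partialDeriv i f) z := by
  have := hf.fderivWithin_right uniqueDiffOn_halfSpace hk hz
  exact this.clm_apply contDiffWithinAt_const

theorem SmoothAt.eventually_smoothAt {F : Type*} [NormedAddCommGroup F] [NormedSpace ℝ F]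
    {f : EuclideanSpace ℝ (Fin n) → F} {m : ℕ} (hf : SmoothAt m f z) (hz : z ∈ halfSpace n) :
    ∀ᶠ y in 𝓝[halfSpace n] z, SmoothAt m f y := by
  have := ContDiffWithinAt.eventually hf (by simp)
  rwa [Set.insert_eq_of_mem hz] at this

/-- Symmetry persists up to the boundary because every point of the half-space is a limit of
interior points. -/
theorem partialDeriv_comm (hz : z ∈ halfSpace n) (hf : SmoothAt 2 f z) (i j : Fin n) :
    partialDeriv i (partialDeriv j f) z = partialDeriv j (partialDeriv i f) z := by
  have hd : DifferentiableWithinAt ℝ (fderivWithin ℝ f (halfSpace n)) (halfSpace n) z :=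
    (hf.fderivWithin_right uniqueDiffOn_halfSpace (m := 1) (by norm_num) hz).differentiableWithinAt
      (by simp)
  have key : ∀ i j, partialDeriv i (partialDeriv j f) z
      = fderivWithin ℝ (fderivWithin ℝ f (halfSpace n)) (halfSpace n) z (EuclideanSpace.single i 1)
        (EuclideanSpace.single j 1) := fun i j => by
    have h := hd.hasFDerivWithinAt.clm_apply
      (hasFDerivWithinAt_const (EuclideanSpace.single j (1 : ℝ)) z (halfSpace n))
    rw [partialDeriv]
    change fderivWithin ℝ (fun y => fderivWithin ℝ f (halfSpace n) y (EuclideanSpace.single j 1))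
      (halfSpace n) z _ = _
    rw [h.fderivWithin (uniqueDiffOn_halfSpace z hz)]
    simp
  rw [key, key]
  have hcl : z ∈ closure (interior (halfSpace n)) := (𝓡∂ n).range_subset_closure_interior hz
  exact (ContDiffWithinAt.isSymmSndFDerivWithinAt hf (by simp) uniqueDiffOn_halfSpace hcl hz) _ _

theorem partialDeriv_comp {ψ : EuclideanSpace ℝ (Fin n) → EuclideanSpace ℝ (Fin n)}
    (hz : z ∈ halfSpace n) (hψ : DifferentiableWithinAt ℝ ψ (halfSpace n) z)
    (hm : ∀ᶠ y in 𝓝[halfSpace n] z, ψ y ∈ halfSpace n)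
    (hf : DifferentiableWithinAt ℝ f (halfSpace n) (ψ z)) (i : Fin n) :
    partialDeriv i (fun y => f (ψ y)) z
      = ∑ j, partialDeriv i (fun y => ψ y j) z * partialDeriv j f (ψ z) := by
  have h1 : HasFDerivWithinAt f (fderivWithin ℝ f (halfSpace n) (ψ z)) (halfSpace n) (ψ z) :=
    hf.hasFDerivWithinAt
  have h2 : Tendsto ψ (𝓝[halfSpace n] z) (𝓝[halfSpace n] (ψ z)) :=
    tendsto_nhdsWithin_iff.2 ⟨hψ.continuousWithinAt, hm⟩
  -- `ψ` is known to stay in the half-space only near `z`, so the derivatives are composed along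
  -- filters.
  have h3 := HasFDerivAtFilter.comp (L := 𝓝[halfSpace n] z ×ˢ pure z)
    (L' := 𝓝[halfSpace n] (ψ z) ×ˢ pure (ψ z)) h1 hψ.hasFDerivWithinAt
    (by
      refine Tendsto.prodMap h2 ?_
      exact (tendsto_pure_pure ψ z))
  have h4 : HasFDerivWithinAt (f ∘ ψ) _ (halfSpace n) z := h3
  rw [partialDeriv]
  change fderivWithin ℝ (f ∘ ψ) _ z _ = _
  rw [h4.fderivWithin (uniqueDiffOn_halfSpace z hz), ContinuousLinearMap.comp_apply,
    fderivWithin_eq_sum]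
  refine Finset.sum_congr rfl fun j _ => ?_
  congr 1
  have h5 : HasFDerivWithinAt (fun y => ψ y j)
      ((EuclideanSpace.proj (𝕜 := ℝ) j).comp (fderivWithin ℝ ψ (halfSpace n) z)) (halfSpace n) z :=
    (EuclideanSpace.proj (𝕜 := ℝ) j).hasFDerivAt.comp_hasFDerivWithinAt z hψ.hasFDerivWithinAt
  rw [partialDeriv, h5.fderivWithin (uniqueDiffOn_halfSpace z hz)]
  simp

theorem SmoothAt.comp {F : Type*} [NormedAddCommGroup F] [NormedSpace ℝ F] {m : WithTop ℕ∞}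
    {f : EuclideanSpace ℝ (Fin n) → F} {ψ : EuclideanSpace ℝ (Fin n) → EuclideanSpace ℝ (Fin n)}
    (hf : SmoothAt m f (ψ z)) (hψ : SmoothAt m ψ z)
    (hm : ∀ᶠ y in 𝓝[halfSpace n] z, ψ y ∈ halfSpace n) :
    SmoothAt m (fun y => f (ψ y)) z := by
  have := ContDiffWithinAt.comp_of_preimage_mem_nhdsWithin (g := f) (f := ψ) (x := z)
    (s := halfSpace n) (t := halfSpace n) hf hψ hm
  exact this

/-- The second derivative test: the Hessian is nonpositive at an interior local maximum. -/
theorem hessian_nonpos_of_isLocalMax (hz : 0 < z 0) (hf : SmoothAt 2 f z) (hmax : IsLocalMax f z)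
    (ξ : Fin n → ℝ) : ∑ i, ∑ j, partialDeriv i (partialDeriv j f) z * (ξ i * ξ j) ≤ 0 := by
  have hH := halfSpace_mem_nhds hz
  have hzH : z ∈ halfSpace n := mem_of_mem_nhds hH
  set X : EuclideanSpace ℝ (Fin n) := WithLp.toLp 2 ξ with hX
  have hline : ∀ t : ℝ, HasDerivAt (fun t : ℝ => z + t • X) X t := fun t => by
    simpa using ((hasDerivAt_id t).smul_const X).const_add z
  have hder : ∀ (h : EuclideanSpace ℝ (Fin n) → ℝ) (t : ℝ), halfSpace n ∈ 𝓝 (z + t • X) →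
      DifferentiableWithinAt ℝ h (halfSpace n) (z + t • X) →
      HasDerivAt (fun t : ℝ => h (z + t • X)) (∑ j, ξ j * partialDeriv j h (z + t • X)) t := by
    intro h t hn hh
    have h1 := hh.hasFDerivWithinAt.hasFDerivAt hn
    have h2 := h1.comp_hasDerivAt t (hline t)
    have h3 := fderivWithin_eq_sum (f := h) (z := z + t • X) X
    rw [h3] at h2
    exact h2
  have hcont : ContinuousAt (fun t : ℝ => z + t • X) 0 := (hline 0).continuousAt
  have htend : Tendsto (fun t : ℝ => z + t • X) (𝓝 0) (𝓝 z) := by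
    have := hcont.tendsto; simpa using this
  have hev : ∀ᶠ t : ℝ in 𝓝 0, halfSpace n ∈ 𝓝 (z + t • X)
      ∧ DifferentiableWithinAt ℝ f (halfSpace n) (z + t • X) := by
    have e1 : ∀ᶠ y in 𝓝 z, halfSpace n ∈ 𝓝 y := eventually_mem_nhds_iff.2 hH
    have e2 : ∀ᶠ y in 𝓝 z, SmoothAt (2 : ℕ) f y := by
      have := SmoothAt.eventually_smoothAt (m := 2) hf hzH
      rwa [nhdsWithin_eq_nhds.2 hH] at this
    have e3 := htend.eventually (e1.and e2)
    exact e3.mono fun t ht => ⟨ht.1, ht.2.diffAt (by simp)⟩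
  set F : ℝ → ℝ := fun t => f (z + t • X) with hF
  have hF1 : deriv F =ᶠ[𝓝 0] fun t => ∑ j, ξ j * partialDeriv j f (z + t • X) :=
    hev.mono fun t ht => (hder f t ht.1 ht.2).deriv
  have hF2 : deriv (deriv F) 0
      = ∑ i, ∑ j, partialDeriv i (partialDeriv j f) z * (ξ i * ξ j) := by
    rw [hF1.deriv_eq]
    have : ∀ j ∈ Finset.univ, HasDerivAt (fun t : ℝ => ξ j * partialDeriv j f (z + t • X))
        (ξ j * ∑ i, ξ i * partialDeriv i (partialDeriv j f) (z + (0 : ℝ) • X)) 0 := fun j _ => by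
      refine (hder (partialDeriv j f) 0 ?_ ?_).const_mul (ξ j)
      · simpa using hH
      · rw [zero_smul, add_zero]
        exact (SmoothAt.partialDeriv (m := 1) hf hzH (by norm_num) j).diffAt (by simp)
    rw [(HasDerivAt.fun_sum this).deriv]
    simp only [zero_smul, add_zero, Finset.mul_sum]
    rw [Finset.sum_comm]
    exact Finset.sum_congr rfl fun i _ => Finset.sum_congr rfl fun j _ => by ring
  have hFmax : IsLocalMax F 0 := by
    have : ∀ᶠ y in 𝓝 z, f y ≤ f z := hmax
    have h3 := htend.eventually this
    exact h3.mono fun t ht => by simpa [hF] using ht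
  -- A positive second derivative along the line would make 0 also a local minimum of `F`. Then `F`
  -- is locally constant and its second derivative is zero.
  by_contra! hpos
  rw [← hF2] at hpos
  have hFc : ContinuousAt F 0 := by
    obtain ⟨h1, h2⟩ := hev.self_of_nhds
    exact (hder f 0 h1 h2).continuousAt
  have hmin := isLocalMin_of_deriv_deriv_pos hpos hFmax.deriv_eq_zero hFc
  have hcst : F =ᶠ[𝓝 0] fun _ => F 0 := by
    filter_upwards [hmin, hFmax] with t h1 h2 using le_antisymm h2 h1
  have hd : deriv F =ᶠ[𝓝 0] fun _ => 0 := by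
    have := hcst.deriv
    simpa using this
  rw [hd.deriv_eq] at hpos
  simp at hpos

end HalfSpaceCalculus

/-! ### Algebra of second partial derivatives -/

section SecondDerivatives

open Filter Topology

variable {n : ℕ} [NeZero n] {f f' : EuclideanSpace ℝ (Fin n) → ℝ} {z : EuclideanSpace ℝ (Fin n)}

theorem SmoothAt.eventually_diffAt (hf : SmoothAt 2 f z) (hz : z ∈ halfSpace n) :
    ∀ᶠ y in 𝓝[halfSpace n] z, y ∈ halfSpace n ∧ DifferentiableWithinAt ℝ f (halfSpace n) y := by
  have := SmoothAt.eventually_smoothAt (m := 2) hf hz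
  filter_upwards [this, self_mem_nhdsWithin] with y hy hyH
  exact ⟨hyH, hy.diffAt (by simp)⟩

theorem SmoothAt.partialDeriv_one (hf : SmoothAt 2 f z) (hz : z ∈ halfSpace n) (i : Fin n) :
    DifferentiableWithinAt ℝ (KRicci.partialDeriv i f) (halfSpace n) z :=
  (SmoothAt.partialDeriv (m := 1) hf hz (by norm_num) i).diffAt (by simp)

theorem hessian_add (hz : z ∈ halfSpace n) (hf : SmoothAt 2 f z) (hf' : SmoothAt 2 f' z)
    (i j : Fin n) : partialDeriv i (partialDeriv j fun y => f y + f' y) z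
      = partialDeriv i (partialDeriv j f) z + partialDeriv i (partialDeriv j f') z := by
  rw [← partialDeriv_add hz (hf.partialDeriv_one hz j) (hf'.partialDeriv_one hz j)]
  refine partialDeriv_congr hz ?_ i
  filter_upwards [hf.eventually_diffAt hz, hf'.eventually_diffAt hz] with y h1 h2
  exact partialDeriv_add h1.1 h1.2 h2.2 j

theorem hessian_sub (hz : z ∈ halfSpace n) (hf : SmoothAt 2 f z) (hf' : SmoothAt 2 f' z)
    (i j : Fin n) : partialDeriv i (partialDeriv j fun y => f y - f' y) z
      = partialDeriv i (partialDeriv j f) z - partialDeriv i (partialDeriv j f') z := by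
  rw [← partialDeriv_sub hz (hf.partialDeriv_one hz j) (hf'.partialDeriv_one hz j)]
  refine partialDeriv_congr hz ?_ i
  filter_upwards [hf.eventually_diffAt hz, hf'.eventually_diffAt hz] with y h1 h2
  exact partialDeriv_sub h1.1 h1.2 h2.2 j

theorem hessian_const_mul (hz : z ∈ halfSpace n) (hf : SmoothAt 2 f z) (c : ℝ)
    (i j : Fin n) : partialDeriv i (partialDeriv j fun y => c * f y) z
      = c * partialDeriv i (partialDeriv j f) z := by
  rw [← partialDeriv_const_mul hz (hf.partialDeriv_one hz j)]
  refine partialDeriv_congr hz ?_ i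
  filter_upwards [hf.eventually_diffAt hz] with y h1
  exact partialDeriv_const_mul h1.1 h1.2 c j

theorem hessian_sum {ι : Type*} (s : Finset ι) {F : ι → EuclideanSpace ℝ (Fin n) → ℝ}
    (hz : z ∈ halfSpace n) (hF : ∀ a ∈ s, SmoothAt 2 (F a) z) (i j : Fin n) :
    partialDeriv i (partialDeriv j fun y => ∑ a ∈ s, F a y) z
      = ∑ a ∈ s, partialDeriv i (partialDeriv j (F a)) z := by
  rw [← partialDeriv_sum s hz fun a ha => (hF a ha).partialDeriv_one hz j]
  refine partialDeriv_congr hz ?_ i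
  have : ∀ᶠ y in 𝓝[halfSpace n] z, ∀ a ∈ s,
      y ∈ halfSpace n ∧ DifferentiableWithinAt ℝ (F a) (halfSpace n) y :=
    (Filter.eventually_all_finset s).2 fun a ha => (hF a ha).eventually_diffAt hz
  filter_upwards [this, self_mem_nhdsWithin] with y h1 hy
  exact partialDeriv_sum s hy (fun a ha => (h1 a ha).2) j

theorem hessian_sq (hz : z ∈ halfSpace n) (hf : SmoothAt 2 f z) (i j : Fin n) :
    partialDeriv i (partialDeriv j fun y => f y * f y) z
      = 2 * (partialDeriv i f z * partialDeriv j f z + f z * partialDeriv i (partialDeriv j f) z) := by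
  have h : partialDeriv j (fun y => f y * f y)
      =ᶠ[𝓝[halfSpace n] z] fun y => 2 * (f y * partialDeriv j f y) := by
    filter_upwards [hf.eventually_diffAt hz] with y h1
    rw [partialDeriv_mul h1.1 h1.2 h1.2]; ring
  have hd := hf.diffAt (by simp)
  have hd' := hf.partialDeriv_one hz j
  rw [partialDeriv_congr hz h, partialDeriv_const_mul hz (hd.fun_mul hd'), partialDeriv_mul hz hd hd']

end SecondDerivatives

/-! ### Solving for the double normal derivative; absorption by squares -/

section Barrier

open Filter Topology

variable {n : ℕ} [NeZero n]

theorem sum_eq_normal_add_tangential (F : Fin n → Fin n → ℝ) :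
    ∑ i, ∑ j, F i j = F 0 0 + ∑ j ∈ Finset.univ.erase 0, F 0 j
      + ∑ i ∈ Finset.univ.erase 0, ∑ j, F i j := by
  rw [← Finset.add_sum_erase _ _ (Finset.mem_univ (0 : Fin n)),
    ← Finset.add_sum_erase _ _ (Finset.mem_univ (0 : Fin n))]

/-- Up to symmetry, every entry of `H` except `H 0 0` has a tangential column index. Since `b 0 0 ≥
θ`, the bound on the contraction with `b` can be solved for `H 0 0`. -/
theorem sum_abs_hessian_le {θ Θ C₀ : ℝ} (hθ : 0 < θ) (hΘ : 0 ≤ Θ)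
    {b : Fin n → Fin n → ℝ} (hell : ∀ ξ : Fin n → ℝ, θ * ∑ i, ξ i ^ 2 ≤ ∑ i, ∑ j, b i j * (ξ i * ξ j))
    (hb : ∀ i j, |b i j| ≤ Θ) {H : Fin n → Fin n → ℝ} (hsymm : ∀ i j, H i j = H j i)
    (hbH : |∑ i, ∑ j, b i j * H i j| ≤ C₀) :
    ∑ i, ∑ j, |H i j| ≤ (C₀ / θ + 2 * Θ / θ + 2) *
      (1 + ∑ a ∈ Finset.univ.erase 0, ∑ j, |H j a|) := by
  set S := ∑ a ∈ Finset.univ.erase 0, ∑ j, |H j a| with hS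
  have hb0 : θ ≤ b 0 0 := by
    have := hell (Pi.single 0 1)
    simpa [Pi.single_apply] using this
  have r1 : ∑ j ∈ Finset.univ.erase 0, |H 0 j| ≤ S :=
    Finset.sum_le_sum fun a _ =>
      Finset.single_le_sum (f := fun j => |H j a|) (fun _ _ => abs_nonneg _) (Finset.mem_univ 0)
  have r2 : ∑ i ∈ Finset.univ.erase 0, ∑ j, |H i j| = S :=
    Finset.sum_congr rfl fun a _ => Finset.sum_congr rfl fun j _ => by rw [hsymm]
  have hS0 : 0 ≤ S := by positivity
  have hC : 0 ≤ C₀ := (abs_nonneg _).trans hbH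
  have q1 : |∑ j ∈ Finset.univ.erase 0, b 0 j * H 0 j| ≤ Θ * S := by
    refine (Finset.abs_sum_le_sum_abs _ _).trans ?_
    calc ∑ j ∈ Finset.univ.erase 0, |b 0 j * H 0 j|
        ≤ ∑ j ∈ Finset.univ.erase 0, Θ * |H 0 j| := by
          refine Finset.sum_le_sum fun j _ => ?_
          rw [abs_mul]; gcongr; exact hb _ _
      _ ≤ Θ * S := by rw [← Finset.mul_sum]; gcongr
  have q2 : |∑ i ∈ Finset.univ.erase 0, ∑ j, b i j * H i j| ≤ Θ * S := by
    refine (Finset.abs_sum_le_sum_abs _ _).trans ?_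
    calc ∑ i ∈ Finset.univ.erase 0, |∑ j, b i j * H i j|
        ≤ ∑ i ∈ Finset.univ.erase 0, ∑ j, Θ * |H i j| := by
          refine Finset.sum_le_sum fun i _ => (Finset.abs_sum_le_sum_abs _ _).trans ?_
          refine Finset.sum_le_sum fun j _ => ?_
          rw [abs_mul]; gcongr; exact hb _ _
      _ = Θ * S := by simp_rw [← Finset.mul_sum]; rw [r2]
  have h00 : θ * |H 0 0| ≤ C₀ + 2 * Θ * S := by
    have e := sum_eq_normal_add_tangential fun i j => b i j * H i j
    calc θ * |H 0 0| ≤ b 0 0 * |H 0 0| := by gcongr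
      _ = |b 0 0 * H 0 0| := by rw [abs_mul, abs_of_pos (lt_of_lt_of_le hθ hb0)]
      _ = |(∑ i, ∑ j, b i j * H i j) - (∑ j ∈ Finset.univ.erase 0, b 0 j * H 0 j)
            - ∑ i ∈ Finset.univ.erase 0, ∑ j, b i j * H i j| := by
          rw [e]; congr 1; ring
      _ ≤ C₀ + Θ * S + Θ * S := by
          refine (abs_sub _ _).trans (add_le_add ((abs_sub _ _).trans (add_le_add hbH q1)) q2)
      _ = _ := by ring
  have h00' : |H 0 0| ≤ (C₀ + 2 * Θ * S) / θ := by
    rw [le_div_iff₀ hθ]; linarith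
  rw [sum_eq_normal_add_tangential fun i j => |H i j|, r2]
  have : (C₀ / θ + 2 * Θ / θ + 2) * (1 + S)
      = (C₀ + 2 * Θ * S) / θ + (2 + C₀ / θ * S + 2 * Θ / θ) + 2 * S := by field_simp; ring
  rw [this]
  have : 0 ≤ C₀ / θ * S + 2 * Θ / θ := by positivity
  linarith

/-- Adding the squares of the tangential derivatives absorbs terms that are linear in the second
derivatives. -/
theorem exists_quadratic_absorption (n : ℕ) [NeZero n] (θ W₀ C₂ : ℝ) (hθ : 0 < θ) (hW₀ : 0 ≤ W₀)
    (hC₂ : 0 ≤ C₂) :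
    ∃ C : ℝ, 0 ≤ C ∧ ∀ (z : EuclideanSpace ℝ (Fin n)) (w : Fin n → EuclideanSpace ℝ (Fin n) → ℝ)
      (b : Fin n → Fin n → ℝ), z ∈ halfSpace n → (∀ a, SmoothAt 2 (w a) z) →
      (∀ ξ : Fin n → ℝ, θ * ∑ i, ξ i ^ 2 ≤ ∑ i, ∑ j, b i j * (ξ i * ξ j)) →
      (∀ a ∈ Finset.univ.erase 0, |w a z| ≤ W₀) →
      (∀ a ∈ Finset.univ.erase 0, |∑ i, ∑ j, b i j * partialDeriv i (partialDeriv j (w a)) z|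
        ≤ C₂ * (1 + ∑ a ∈ Finset.univ.erase 0, ∑ j, |partialDeriv j (w a) z|)) →
      ∀ a ∈ Finset.univ.erase 0, ∀ s : ℝ, |s| ≤ 1 →
        -C ≤ ∑ i, ∑ j, b i j * partialDeriv i (partialDeriv j fun y =>
          s * w a y + ∑ c ∈ Finset.univ.erase 0, w c y * w c y) z := by
  -- With `S` the sum of all |∂_j w_c| over tangential c, ellipticity and Cauchy–Schwarz make the
  -- gradient terms of the squares at least `κ * S ^ 2`. `D` collects the coefficients of the terms
  -- linear in `1 + S`.
  set κ : ℝ := 2 * θ / ((n : ℝ) ^ 2) with hκ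
  set D : ℝ := C₂ + 2 * n * (W₀ * C₂) with hD
  have hn : (0 : ℝ) < n := by exact_mod_cast Nat.pos_of_ne_zero (NeZero.ne n)
  have hκ0 : 0 < κ := by positivity
  -- The negative of the minimum of `κ * S ^ 2 - D * (1 + S)` over real `S`.
  refine ⟨D + D ^ 2 / (4 * κ), by positivity, ?_⟩
  intro z w b hz hw hell hwb hbw a ha s hs
  set S := ∑ a ∈ Finset.univ.erase 0, ∑ j, |partialDeriv j (w a) z| with hS
  set T : Finset (Fin n) := Finset.univ.erase 0 with hT
  have hS0 : 0 ≤ S := by positivity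
  have hess : ∀ i j, partialDeriv i (partialDeriv j fun y =>
          s * w a y + ∑ c ∈ T, w c y * w c y) z
      = s * partialDeriv i (partialDeriv j (w a)) z + ∑ c ∈ T,
        2 * (partialDeriv i (w c) z * partialDeriv j (w c) z
          + w c z * partialDeriv i (partialDeriv j (w c)) z) := fun i j => by
    rw [hessian_add hz (contDiffWithinAt_const.mul (hw a))
      (ContDiffWithinAt.sum fun c _ => (hw c).mul (hw c)), hessian_const_mul hz (hw a),
      hessian_sum T hz fun c _ => (hw c).mul (hw c)]
    congr 1
    exact Finset.sum_congr rfl fun c _ => hessian_sq hz (hw c) i j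
  have hsum : ∑ i, ∑ j, b i j * partialDeriv i (partialDeriv j fun y =>
          s * w a y + ∑ c ∈ T, w c y * w c y) z
      = s * (∑ i, ∑ j, b i j * partialDeriv i (partialDeriv j (w a)) z)
        + ∑ c ∈ T, 2 * ((∑ i, ∑ j, b i j * (partialDeriv i (w c) z * partialDeriv j (w c) z))
          + w c z * ∑ i, ∑ j, b i j * partialDeriv i (partialDeriv j (w c)) z) := by
    simp only [hess, mul_add, Finset.sum_add_distrib, Finset.mul_sum]
    rw [Finset.sum_comm (s := T) (t := Finset.univ), Finset.sum_comm (s := T) (t := Finset.univ)]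
    congr 1
    · exact Finset.sum_congr rfl fun i _ => Finset.sum_congr rfl fun j _ => by ring
    · rw [← Finset.sum_add_distrib, ← Finset.sum_add_distrib]
      refine Finset.sum_congr rfl fun i _ => ?_
      rw [← Finset.sum_add_distrib, Finset.sum_comm (s := T) (t := Finset.univ),
        Finset.sum_comm (s := T) (t := Finset.univ), ← Finset.sum_add_distrib]
      refine Finset.sum_congr rfl fun j _ => ?_
      rw [← Finset.sum_add_distrib, ← Finset.sum_add_distrib]
      exact Finset.sum_congr rfl fun c _ => by ring
  rw [hsum]
  set Q := ∑ c ∈ T, ∑ j, partialDeriv j (w c) z ^ 2 with hQ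
  have hTn : (T.card : ℝ) ≤ n := by
    have : T.card ≤ n := by simpa using Finset.card_le_univ T
    exact_mod_cast this
  have hQ0 : 0 ≤ Q := by positivity
  have hSQ : S ^ 2 ≤ (n : ℝ) ^ 2 * Q := by
    have h1 : S ^ 2 ≤ T.card * ∑ c ∈ T, (∑ j, |partialDeriv j (w c) z|) ^ 2 :=
      sq_sum_le_card_mul_sum_sq
    have h2 : ∑ c ∈ T, (∑ j, |partialDeriv j (w c) z|) ^ 2 ≤ n * Q := by
      rw [hQ, Finset.mul_sum]
      refine Finset.sum_le_sum fun c _ => ?_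
      have := sq_sum_le_card_mul_sum_sq (s := Finset.univ) (f := fun j => |partialDeriv j (w c) z|)
      simpa using this
    calc S ^ 2 ≤ T.card * ∑ c ∈ T, (∑ j, |partialDeriv j (w c) z|) ^ 2 := h1
      _ ≤ n * (n * Q) := by gcongr
      _ = _ := by ring
  have p1 : -(C₂ * (1 + S)) ≤ s * (∑ i, ∑ j, b i j * partialDeriv i (partialDeriv j (w a)) z) := by
    have h1 : |s * (∑ i, ∑ j, b i j * partialDeriv i (partialDeriv j (w a)) z)|
        ≤ 1 * (C₂ * (1 + S)) := by
      rw [abs_mul]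
      exact mul_le_mul hs (hbw a ha) (abs_nonneg _) zero_le_one
    rw [one_mul] at h1
    exact (abs_le.1 h1).1
  have p2 : 2 * θ * Q - 2 * n * (W₀ * (C₂ * (1 + S)))
      ≤ ∑ c ∈ T, 2 * ((∑ i, ∑ j, b i j * (partialDeriv i (w c) z * partialDeriv j (w c) z))
          + w c z * ∑ i, ∑ j, b i j * partialDeriv i (partialDeriv j (w c)) z) := by
    have h1 : ∑ c ∈ T, (2 * θ * (∑ j, partialDeriv j (w c) z ^ 2) - 2 * (W₀ * (C₂ * (1 + S))))
        ≤ ∑ c ∈ T, 2 * ((∑ i, ∑ j, b i j * (partialDeriv i (w c) z * partialDeriv j (w c) z))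
          + w c z * ∑ i, ∑ j, b i j * partialDeriv i (partialDeriv j (w c)) z) := by
      refine Finset.sum_le_sum fun c hc => ?_
      have h2 := hell fun i => partialDeriv i (w c) z
      have h3 : |w c z * ∑ i, ∑ j, b i j * partialDeriv i (partialDeriv j (w c)) z|
          ≤ W₀ * (C₂ * (1 + S)) := by
        rw [abs_mul]
        exact mul_le_mul (hwb c hc) (hbw c hc) (abs_nonneg _) hW₀
      have h4 := (abs_le.1 h3).1
      linarith
    refine le_trans ?_ h1
    rw [Finset.sum_sub_distrib, ← Finset.mul_sum, Finset.sum_const, nsmul_eq_mul]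
    have : (T.card : ℝ) * (2 * (W₀ * (C₂ * (1 + S)))) ≤ n * (2 * (W₀ * (C₂ * (1 + S)))) := by
      gcongr
    linarith
  have p3 : κ * S ^ 2 ≤ 2 * θ * Q := by
    rw [hκ, div_mul_eq_mul_div, div_le_iff₀ (by positivity)]
    calc 2 * θ * S ^ 2 ≤ 2 * θ * ((n : ℝ) ^ 2 * Q) := by gcongr
      _ = _ := by ring
  have p4 : -(D + D ^ 2 / (4 * κ)) ≤ κ * S ^ 2 - D * (1 + S) := by
    have : κ * S ^ 2 - D * (1 + S) + (D + D ^ 2 / (4 * κ)) = κ * (S - D / (2 * κ)) ^ 2 := by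
      field_simp; ring
    have h2 : 0 ≤ κ * (S - D / (2 * κ)) ^ 2 := by positivity
    linarith
  have p5 : D * (1 + S) = C₂ * (1 + S) + 2 * n * (W₀ * (C₂ * (1 + S))) := by rw [hD]; ring
  linarith

end Barrier

/-! ### The barrier and the normal derivative at a flat boundary point -/

section Barrier

open Filter Topology

variable {n : ℕ} [NeZero n]

/-- The part of a closed ball that lies in the half-space. -/
def halfBall (x₀ : EuclideanSpace ℝ (Fin n)) (r : ℝ) : Set (EuclideanSpace ℝ (Fin n)) :=
  Metric.closedBall x₀ r ∩ halfSpace n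

theorem isCompact_halfBall (x₀ : EuclideanSpace ℝ (Fin n)) (r : ℝ) : IsCompact (halfBall x₀ r) :=
  (isCompact_closedBall x₀ r).inter_right isClosed_halfSpace

/-- The barrier `|x'|² + A x_0 - B x_0²`. -/
def barrier (A B : ℝ) (x₀ y : EuclideanSpace ℝ (Fin n)) : ℝ :=
  (∑ c ∈ Finset.univ.erase 0, (y c - x₀ c) * (y c - x₀ c)) + (A * y 0 - B * (y 0 * y 0))

theorem smoothAt_coord (i : Fin n) (z : EuclideanSpace ℝ (Fin n)) :
    SmoothAt 2 (fun y : EuclideanSpace ℝ (Fin n) => y i) z :=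
  (EuclideanSpace.proj (𝕜 := ℝ) i).contDiff.contDiffWithinAt

theorem smoothAt_barrier (A B : ℝ) (x₀ z : EuclideanSpace ℝ (Fin n)) :
    SmoothAt 2 (barrier A B x₀) z := by
  have h := fun c => smoothAt_coord (n := n) c z
  refine (ContDiffWithinAt.sum fun c _ => ?_).add
    ((contDiffWithinAt_const.mul (h 0)).sub (contDiffWithinAt_const.mul ((h 0).mul (h 0))))
  exact ((h c).sub contDiffWithinAt_const).mul ((h c).sub contDiffWithinAt_const)

theorem hessian_coord {z : EuclideanSpace ℝ (Fin n)} (hz : z ∈ halfSpace n) (c i j : Fin n) :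
    partialDeriv i (partialDeriv j fun y => y c) z = 0 := by
  rw [partialDeriv_congr (f' := fun _ => if j = c then 1 else 0) hz, partialDeriv_const]
  filter_upwards [self_mem_nhdsWithin] with y hy using partialDeriv_coord hy j c

theorem hessian_coord_sub {z : EuclideanSpace ℝ (Fin n)} (hz : z ∈ halfSpace n) (c i j : Fin n)
    (a : ℝ) : partialDeriv i (partialDeriv j fun y => y c - a) z = 0 := by
  rw [hessian_sub hz (smoothAt_coord c z) contDiffWithinAt_const, hessian_coord hz,
    partialDeriv_congr (f := partialDeriv j fun _ => a) (f' := fun _ => 0) hz, partialDeriv_const]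
  · ring
  · exact Eventually.of_forall fun y => partialDeriv_const _ _

theorem partialDeriv_coord_sub {z : EuclideanSpace ℝ (Fin n)} (hz : z ∈ halfSpace n) (c i : Fin n)
    (a : ℝ) : partialDeriv i (fun y => y c - a) z = if i = c then 1 else 0 := by
  rw [partialDeriv_sub hz ((smoothAt_coord c z).diffAt (by simp))
    (differentiableWithinAt_const a), partialDeriv_coord hz, partialDeriv_const, sub_zero]

/-- The term with `B` uses only the entry `b 0 0`, which ellipticity bounds below, so a large `B`
makes the barrier a strict supersolution. -/
theorem sum_hessian_barrier (A B : ℝ) (x₀ : EuclideanSpace ℝ (Fin n)) (b : Fin n → Fin n → ℝ)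
    {z : EuclideanSpace ℝ (Fin n)} (hz : z ∈ halfSpace n) :
    ∑ i, ∑ j, b i j * partialDeriv i (partialDeriv j (barrier A B x₀)) z
      = 2 * (∑ c ∈ Finset.univ.erase 0, b c c) - 2 * B * b 0 0 := by
  have h := fun c => smoothAt_coord (n := n) c z
  have hc : ∀ c, SmoothAt 2 (fun y : EuclideanSpace ℝ (Fin n) => y c - x₀ c) z :=
    fun c => (h c).sub contDiffWithinAt_const
  have hess : ∀ i j, partialDeriv i (partialDeriv j (barrier A B x₀)) z
      = (∑ c ∈ Finset.univ.erase 0, 2 * ((if i = c then 1 else 0) * (if j = c then 1 else 0)))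
        - B * (2 * ((if i = 0 then 1 else 0) * (if j = 0 then 1 else 0))) := fun i j => by
    unfold barrier
    rw [hessian_add hz (ContDiffWithinAt.sum fun c _ => (hc c).mul (hc c))
      ((contDiffWithinAt_const.mul (h 0)).sub (contDiffWithinAt_const.mul ((h 0).mul (h 0)))),
      hessian_sub hz (contDiffWithinAt_const.mul (h 0))
        (contDiffWithinAt_const.mul ((h 0).mul (h 0))), hessian_const_mul hz (h 0),
      hessian_const_mul hz ((h 0).mul (h 0)), hessian_sq hz (h 0), hessian_coord hz,
      hessian_sum _ hz fun c _ => (hc c).mul (hc c), partialDeriv_coord hz, partialDeriv_coord hz,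
      mul_zero, mul_zero, zero_sub, add_zero, ← sub_eq_add_neg]
    congr 1
    refine Finset.sum_congr rfl fun c _ => ?_
    rw [hessian_sq hz (hc c), hessian_coord_sub hz, partialDeriv_coord_sub hz,
      partialDeriv_coord_sub hz, mul_zero, add_zero]
  simp only [hess, mul_sub, Finset.sum_sub_distrib, Finset.mul_sum]
  congr 1
  · have : ∀ i, ∑ j, ∑ c ∈ Finset.univ.erase (0 : Fin n),
        b i j * (2 * ((if i = c then 1 else 0) * (if j = c then 1 else 0)))
        = ∑ c ∈ Finset.univ.erase 0, if i = c then 2 * b i c else 0 := fun i => by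
      rw [Finset.sum_comm]
      refine Finset.sum_congr rfl fun c _ => ?_
      by_cases hi : i = c
      · simp [hi]; ring
      · simp [hi]
    simp only [this]
    rw [Finset.sum_comm]
    exact Finset.sum_congr rfl fun c _ => by simp
  · simp; ring

theorem partialDeriv_barrier (A B : ℝ) {x₀ : EuclideanSpace ℝ (Fin n)} (h0 : x₀ 0 = 0) :
    partialDeriv 0 (barrier A B x₀) x₀ = A := by
  have hz : x₀ ∈ halfSpace n := mem_halfSpace.2 h0.ge
  have h := fun c => (smoothAt_coord (n := n) c x₀).diffAt (by simp)
  have hc : ∀ c, DifferentiableWithinAt ℝ (fun y : EuclideanSpace ℝ (Fin n) => y c - x₀ c)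
    (halfSpace n) x₀ := fun c => (h c).sub (differentiableWithinAt_const _)
  unfold barrier
  rw [partialDeriv_add hz (DifferentiableWithinAt.fun_sum fun c _ => (hc c).fun_mul (hc c))
      (((differentiableWithinAt_const A).fun_mul (h 0)).fun_sub
        ((differentiableWithinAt_const B).fun_mul ((h 0).fun_mul (h 0)))),
    partialDeriv_sum _ hz fun c _ => (hc c).fun_mul (hc c),
    partialDeriv_sub hz ((differentiableWithinAt_const A).fun_mul (h 0))
      ((differentiableWithinAt_const B).fun_mul ((h 0).fun_mul (h 0))),
    partialDeriv_const_mul hz (h 0), partialDeriv_const_mul hz ((h 0).fun_mul (h 0)),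
    partialDeriv_mul hz (h 0) (h 0), partialDeriv_coord hz, h0]
  rw [Finset.sum_eq_zero]
  · simp
  · intro c _
    rw [partialDeriv_mul hz (hc c) (hc c)]; simp

/-- On the half ball 0 ≤ z_0 ≤ r, so the choice of `A` gives A z_0 - B z_0² ≥ z_0². The barrier is
thus nonnegative on the flat part and at least r² on the spherical part. -/
theorem sq_dist_le_barrier {A B r : ℝ} {x₀ z : EuclideanSpace ℝ (Fin n)} (h0 : x₀ 0 = 0)
    (hB : 0 ≤ B) (hA : (B + 1) * r ≤ A) (hz : z ∈ halfBall x₀ r) :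
    dist z x₀ ^ 2 ≤ barrier A B x₀ z := by
  have hz0 : 0 ≤ z 0 := mem_halfSpace.1 hz.2
  have hd : dist z x₀ ≤ r := hz.1
  have hsq : dist z x₀ ^ 2 = ∑ i, (z i - x₀ i) ^ 2 := by
    rw [EuclideanSpace.dist_eq, Real.sq_sqrt (by positivity)]
    simp [Real.dist_eq, sq_abs]
  rw [← Finset.add_sum_erase _ _ (Finset.mem_univ (0 : Fin n)), h0, sub_zero] at hsq
  have hz0r : z 0 ≤ r := by
    refine le_trans ?_ hd
    refine le_of_sq_le_sq ?_ dist_nonneg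
    rw [hsq]
    have : 0 ≤ ∑ c ∈ Finset.univ.erase 0, (z c - x₀ c) ^ 2 := by positivity
    linarith
  rw [hsq, barrier]
  simp only [← sq]
  have h1 : (B + 1) * z 0 ≤ A := le_trans (by gcongr) hA
  nlinarith [mul_le_mul_of_nonneg_right h1 hz0]

/-- A subsolution that vanishes on the flat part of the boundary of a half ball has bounded
normal derivative at the centre. -/
theorem exists_normal_derivative_bound (n : ℕ) [NeZero n] (θ Θ r U D : ℝ) (hθ : 0 < θ)
    (hr : 0 < r) (hD : 0 ≤ D) :
    ∃ C : ℝ, 0 ≤ C ∧ ∀ (x₀ : EuclideanSpace ℝ (Fin n)) (u : EuclideanSpace ℝ (Fin n) → ℝ),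
      x₀ 0 = 0 → (∀ z ∈ halfBall x₀ r, SmoothAt 2 u z) → (∀ z ∈ halfBall x₀ r, u z ≤ U) →
      (∀ z ∈ halfBall x₀ r, z 0 = 0 → dist z x₀ < r → u z = 0) →
      (∀ z ∈ halfBall x₀ r, ∃ b : Fin n → Fin n → ℝ,
        (∀ ζ : Fin n → Fin n → ℝ, (∀ ξ : Fin n → ℝ, ∑ i, ∑ j, ζ i j * (ξ i * ξ j) ≤ 0) →
          ∑ i, ∑ j, b i j * ζ i j ≤ 0) ∧
        (∀ ξ : Fin n → ℝ, θ * ∑ i, ξ i ^ 2 ≤ ∑ i, ∑ j, b i j * (ξ i * ξ j)) ∧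
        (∀ i j, |b i j| ≤ Θ) ∧
        -D ≤ ∑ i, ∑ j, b i j * partialDeriv i (partialDeriv j u) z) →
      partialDeriv 0 u x₀ ≤ C := by
  -- Chosen so that `B * b 0 0 ≥ n * |Θ| + 1`, which makes the contraction of `b` with the Hessian
  -- of the barrier at most -2.
  set B : ℝ := (n * |Θ| + 1) / θ with hB
  set A : ℝ := (B + 1) * r with hA
  -- The first summand dominates `u` on the spherical part; the others make `2 * c > D`, so that `u`
  -- minus `c` times the barrier is a strict subsolution.
  set c : ℝ := |U| / r ^ 2 + D + 1 with hc
  have hB0 : 0 ≤ B := by positivity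
  have hc0 : 0 < c := by positivity
  refine ⟨c * A, by positivity, ?_⟩
  intro x₀ u h0 hu hU hflat hsub
  have hx₀H : x₀ ∈ halfSpace n := mem_halfSpace.2 h0.ge
  have hx₀ : x₀ ∈ halfBall x₀ r := ⟨Metric.mem_closedBall_self hr.le, hx₀H⟩
  set Φ : EuclideanSpace ℝ (Fin n) → ℝ := fun y => u y - c * barrier A B x₀ y with hΦ
  have hΦs : ∀ z ∈ halfBall x₀ r, SmoothAt 2 Φ z := fun z hz =>
    (hu z hz).sub (contDiffWithinAt_const.mul (smoothAt_barrier A B x₀ z))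
  -- A positive maximum of `Φ` cannot lie on the sphere (`c` is large), nor on the flat part (`u`
  -- vanishes there), nor inside (strict subsolution).
  have hle : ∀ z ∈ halfBall x₀ r, Φ z ≤ 0 := by
    by_contra! hcon
    obtain ⟨z₁, hz₁, hpos₁⟩ := hcon
    have hcont : ContinuousOn Φ (halfBall x₀ r) := fun z hz =>
      (hΦs z hz).continuousWithinAt.mono Set.inter_subset_right
    obtain ⟨z, hz, hmax⟩ := (isCompact_halfBall x₀ r).exists_isMaxOn ⟨z₁, hz₁⟩ hcont
    have hpos : 0 < Φ z := lt_of_lt_of_le hpos₁ (hmax hz₁)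
    have hbar := sq_dist_le_barrier h0 hB0 le_rfl hz
    have hzr : dist z x₀ < r := by
      refine lt_of_le_of_ne hz.1 fun heq => ?_
      rw [heq] at hbar
      have h1 : |U| ≤ c * barrier A B x₀ z := by
        calc |U| = |U| / r ^ 2 * r ^ 2 := by field_simp
          _ ≤ c * barrier A B x₀ z := by
            apply mul_le_mul _ hbar (by positivity) hc0.le
            rw [hc]; linarith
      have h2 : Φ z = u z - c * barrier A B x₀ z := rfl
      linarith [hU z hz, le_abs_self U]
    have hz0 : 0 < z 0 := by
      refine lt_of_le_of_ne (mem_halfSpace.1 hz.2) fun heq => ?_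
      have h1 := hflat z hz heq.symm hzr
      have h2 : Φ z = u z - c * barrier A B x₀ z := rfl
      have h3 : 0 ≤ c * barrier A B x₀ z := mul_nonneg hc0.le ((sq_nonneg _).trans hbar)
      linarith
    have hnhds : halfBall x₀ r ∈ 𝓝 z :=
      inter_mem (mem_of_superset (Metric.isOpen_ball.mem_nhds hzr) Metric.ball_subset_closedBall)
        (halfSpace_mem_nhds hz0)
    have hloc : IsLocalMax Φ z := hmax.isLocalMax hnhds
    obtain ⟨b, hb1, hb2, hb3, hb4⟩ := hsub z hz
    have h1 := hb1 _ (hessian_nonpos_of_isLocalMax hz0 (hΦs z hz) hloc)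
    have h2 : ∑ i, ∑ j, b i j * partialDeriv i (partialDeriv j Φ) z
        = (∑ i, ∑ j, b i j * partialDeriv i (partialDeriv j u) z)
          - c * (2 * (∑ a ∈ Finset.univ.erase 0, b a a) - 2 * B * b 0 0) := by
      rw [← sum_hessian_barrier A B x₀ b hz.2, Finset.mul_sum, ← Finset.sum_sub_distrib]
      refine Finset.sum_congr rfl fun i _ => ?_
      rw [Finset.mul_sum, ← Finset.sum_sub_distrib]
      refine Finset.sum_congr rfl fun j _ => ?_
      rw [hΦ, hessian_sub hz.2 (hu z hz) (contDiffWithinAt_const.mul (smoothAt_barrier A B x₀ z)),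
        hessian_const_mul hz.2 (smoothAt_barrier A B x₀ z)]
      ring
    have hb0 : θ ≤ b 0 0 := by
      have := hb2 (Pi.single 0 1)
      simpa [Pi.single_apply] using this
    have h3 : ∑ a ∈ Finset.univ.erase (0 : Fin n), b a a ≤ n * |Θ| := by
      calc ∑ a ∈ Finset.univ.erase (0 : Fin n), b a a
          ≤ ∑ a ∈ Finset.univ.erase (0 : Fin n), |Θ| :=
            Finset.sum_le_sum fun a _ => (le_abs_self _).trans ((hb3 a a).trans (le_abs_self _))
        _ ≤ ∑ a : Fin n, |Θ| :=
            Finset.sum_le_sum_of_subset_of_nonneg (Finset.subset_univ _) fun _ _ _ => abs_nonneg _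
        _ = n * |Θ| := by simp
    have h4 : n * |Θ| + 1 ≤ B * b 0 0 := by
      calc n * |Θ| + 1 = B * θ := by rw [hB]; field_simp
        _ ≤ B * b 0 0 := by gcongr
    rw [h2] at h1
    have h5 : c * (2 * (∑ a ∈ Finset.univ.erase 0, b a a) - 2 * B * b 0 0) ≤ c * (-2) := by
      gcongr; linarith
    have h6 : 0 ≤ |U| / r ^ 2 := by positivity
    linarith
  have hΦ0 : Φ x₀ = 0 := by
    have h1 := hflat x₀ hx₀ h0 (by simpa using hr)
    have h2 : barrier A B x₀ x₀ = 0 := by simp [barrier, h0]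
    simp [hΦ, h1, h2]
  -- `Φ` attains its maximum 0 at `x₀`, and direction 0 points into the half ball, so the one-sided
  -- derivative is nonpositive.
  have hder : partialDeriv 0 Φ x₀ ≤ 0 := by
    have hf := ((hΦs x₀ hx₀).diffAt (by simp)).hasFDerivWithinAt.mono
      (Set.inter_subset_right : halfBall x₀ r ⊆ _)
    have hmax : IsLocalMaxOn Φ (halfBall x₀ r) x₀ := by
      filter_upwards [self_mem_nhdsWithin] with z hz
      rw [hΦ0]; exact hle z hz
    have hcone : (r • EuclideanSpace.single (0 : Fin n) (1 : ℝ))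
        ∈ posTangentConeAt (halfBall x₀ r) x₀ := by
      refine mem_posTangentConeAt_of_segment_subset ?_
      rintro y ⟨s, t, hs, ht, hst, rfl⟩
      have e : s • x₀ + t • (x₀ + r • EuclideanSpace.single (0 : Fin n) (1 : ℝ))
          = x₀ + (t * r) • EuclideanSpace.single (0 : Fin n) (1 : ℝ) := by
        rw [smul_add, ← add_assoc, ← add_smul, hst, one_smul, smul_smul]
      rw [e]
      constructor
      · rw [Metric.mem_closedBall, dist_eq_norm, add_sub_cancel_left, norm_smul,
          PiLp.norm_single, Real.norm_of_nonneg (by positivity)]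
        simp only [norm_one, mul_one]
        nlinarith
      · rw [mem_halfSpace]
        simp [h0]
        positivity
    have h1 := hmax.hasFDerivWithinAt_nonpos hf hcone
    rw [map_smul, smul_eq_mul] at h1
    exact nonpos_of_mul_nonpos_right h1 hr
  have hfin : partialDeriv 0 Φ x₀ = partialDeriv 0 u x₀ - c * A := by
    rw [hΦ, partialDeriv_sub hx₀H ((hu x₀ hx₀).diffAt (by simp))
      ((differentiableWithinAt_const c).fun_mul ((smoothAt_barrier A B x₀ x₀).diffAt (by simp))),
      partialDeriv_const_mul hx₀H ((smoothAt_barrier A B x₀ x₀).diffAt (by simp)),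
      partialDeriv_barrier A B h0]
  linarith

end Barrier

/-! ### Hessian estimate at the flat boundary -/

section BoundaryHessian

open Filter Topology

/-- A line in a tangential direction stays in the flat boundary, where `f` vanishes. This is applied
to v - φ and then to its tangential derivatives. -/
theorem partialDeriv_eq_zero_of_flat {n : ℕ} [NeZero n] {f : EuclideanSpace ℝ (Fin n) → ℝ}
    {z : EuclideanSpace ℝ (Fin n)} (hz : z 0 = 0)
    (hf : DifferentiableWithinAt ℝ f (halfSpace n) z)
    (h0 : ∀ᶠ y in 𝓝[halfSpace n] z, y 0 = 0 → f y = 0) {a : Fin n} (ha : a ≠ 0) :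
    partialDeriv a f z = 0 := by
  have hγ : HasDerivWithinAt (fun t : ℝ => z + t • EuclideanSpace.single a (1 : ℝ))
      (EuclideanSpace.single a (1 : ℝ)) Set.univ 0 := by
    have := ((hasDerivAt_id (0 : ℝ)).smul_const (EuclideanSpace.single a (1 : ℝ))).const_add z
    simpa using this
  have hγ0 : ∀ t : ℝ, (z + t • EuclideanSpace.single a (1 : ℝ)) 0 = 0 := fun t => by
    simp [hz, ha]
  have hmaps : Set.MapsTo (fun t : ℝ => z + t • EuclideanSpace.single a (1 : ℝ)) Set.univ
      (halfSpace n) := fun t _ => mem_halfSpace.2 (hγ0 t).ge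
  have hf' : HasFDerivWithinAt f (fderivWithin ℝ f (halfSpace n) z) (halfSpace n)
      (z + (0 : ℝ) • EuclideanSpace.single a (1 : ℝ)) := by
    rw [zero_smul, add_zero]; exact hf.hasFDerivWithinAt
  have h1 := hf'.comp_hasDerivWithinAt (0 : ℝ) hγ hmaps
  rw [hasDerivWithinAt_univ] at h1
  have htend : Tendsto (fun t : ℝ => z + t • EuclideanSpace.single a (1 : ℝ)) (𝓝 0)
      (𝓝[halfSpace n] z) := by
    refine tendsto_nhdsWithin_iff.2 ⟨?_, Eventually.of_forall fun t => hmaps (Set.mem_univ t)⟩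
    have := (hasDerivWithinAt_univ.1 hγ).continuousAt.tendsto
    simpa using this
  have h2 : (f ∘ fun t : ℝ => z + t • EuclideanSpace.single a (1 : ℝ)) =ᶠ[𝓝 0] fun _ => 0 :=
    (htend.eventually h0).mono fun t ht => ht (hγ0 t)
  exact h1.unique ((hasDerivAt_const (0 : ℝ) (0 : ℝ)).congr_of_eventuallyEq h2)

/-- Second derivative estimate at the flat boundary for a function whose first derivatives satisfy
a uniformly elliptic differential inequality. -/
theorem exists_boundary_hessian_bound (n : ℕ) [NeZero n] (θ Θ C₀ r : ℝ) (hθ : 0 < θ) (hΘ : 0 ≤ Θ)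
    (hC₀ : 0 ≤ C₀) (hr : 0 < r) :
    ∃ C : ℝ, 0 ≤ C ∧ ∀ (x₀ : EuclideanSpace ℝ (Fin n)) (v φ : EuclideanSpace ℝ (Fin n) → ℝ),
      x₀ 0 = 0 → (∀ z ∈ halfBall x₀ r, SmoothAt 3 v z) → (∀ z ∈ halfBall x₀ r, SmoothAt 3 φ z) →
      (∀ z ∈ halfBall x₀ r, z 0 = 0 → v z = φ z) →
      (∀ z ∈ halfBall x₀ r, ∀ i, |partialDeriv i v z| ≤ C₀) →
      (∀ z ∈ halfBall x₀ r, ∀ i, |partialDeriv i φ z| ≤ C₀) →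
      (∀ z ∈ halfBall x₀ r, ∀ i j, |partialDeriv i (partialDeriv j φ) z| ≤ C₀) →
      (∀ z ∈ halfBall x₀ r, ∀ i j a,
        |partialDeriv i (partialDeriv j (partialDeriv a φ)) z| ≤ C₀) →
      (∀ z ∈ halfBall x₀ r, ∃ b : Fin n → Fin n → ℝ,
        (∀ ζ : Fin n → Fin n → ℝ, (∀ ξ : Fin n → ℝ, ∑ i, ∑ j, ζ i j * (ξ i * ξ j) ≤ 0) →
          ∑ i, ∑ j, b i j * ζ i j ≤ 0) ∧
        (∀ ξ : Fin n → ℝ, θ * ∑ i, ξ i ^ 2 ≤ ∑ i, ∑ j, b i j * (ξ i * ξ j)) ∧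
        (∀ i j, |b i j| ≤ Θ) ∧
        |∑ i, ∑ j, b i j * partialDeriv i (partialDeriv j v) z| ≤ C₀ ∧
        ∀ a, |∑ i, ∑ j, b i j * partialDeriv i (partialDeriv j (partialDeriv a v)) z|
          ≤ C₀ * (1 + ∑ i, ∑ j, |partialDeriv i (partialDeriv j v) z|)) →
      ∀ i j, |partialDeriv i (partialDeriv j v) x₀| ≤ C := by
  have hn : (0 : ℝ) < n := by exact_mod_cast Nat.pos_of_ne_zero (NeZero.ne n)
  set C₁ : ℝ := C₀ / θ + 2 * Θ / θ + 2 with hC₁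
  have hC₁0 : 0 ≤ C₁ := by positivity
  -- The right-hand side for `w` in place of `v`: |D²v| is replaced by its bound `hN` through |Dw|,
  -- and the last summand accounts for the third derivatives of φ.
  set C₂ : ℝ := C₀ * (1 + C₁ * (1 + n * n * C₀)) + n * n * Θ * C₀ with hC₂
  have hC₂0 : 0 ≤ C₂ := by positivity
  obtain ⟨C₄, hC₄, habs⟩ := exists_quadratic_absorption n θ (2 * C₀) C₂ hθ (by positivity) hC₂0
  obtain ⟨C₅, hC₅, hbar⟩ := exists_normal_derivative_bound n θ Θ r
    (2 * C₀ + n * (2 * C₀ * (2 * C₀))) C₄ hθ hr hC₄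
  refine ⟨C₁ * (1 + n * n * (C₅ + C₀)), by positivity, ?_⟩
  intro x₀ v φ h0 hv hφ hbd hv1 hφ1 hφ2 hφ3 hb
  set T : Finset (Fin n) := Finset.univ.erase 0 with hT
  have hTn : (T.card : ℝ) ≤ n := by
    have : T.card ≤ n := by simpa using Finset.card_le_univ T
    exact_mod_cast this
  have hDH : ∀ z ∈ halfBall x₀ r, z ∈ halfSpace n := fun z hz => hz.2
  set w : Fin n → EuclideanSpace ℝ (Fin n) → ℝ :=
    fun a y => partialDeriv a v y - partialDeriv a φ y with hw
  have hpv : ∀ z ∈ halfBall x₀ r, ∀ a, SmoothAt 2 (partialDeriv a v) z := fun z hz a =>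
    SmoothAt.partialDeriv (hv z hz) (hDH z hz) (by norm_num) a
  have hpφ : ∀ z ∈ halfBall x₀ r, ∀ a, SmoothAt 2 (partialDeriv a φ) z := fun z hz a =>
    SmoothAt.partialDeriv (hφ z hz) (hDH z hz) (by norm_num) a
  have hws : ∀ z ∈ halfBall x₀ r, ∀ a, SmoothAt 2 (w a) z := fun z hz a =>
    (hpv z hz a).sub (hpφ z hz a)
  have hw1 : ∀ z ∈ halfBall x₀ r, ∀ j a, partialDeriv j (w a) z
      = partialDeriv j (partialDeriv a v) z - partialDeriv j (partialDeriv a φ) z :=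
    fun z hz j a => partialDeriv_sub (hDH z hz) ((hpv z hz a).diffAt (by simp))
      ((hpφ z hz a).diffAt (by simp)) j
  have hw2 : ∀ z ∈ halfBall x₀ r, ∀ i j a, partialDeriv i (partialDeriv j (w a)) z
      = partialDeriv i (partialDeriv j (partialDeriv a v)) z
        - partialDeriv i (partialDeriv j (partialDeriv a φ)) z :=
    fun z hz i j a => hessian_sub (hDH z hz) (hpv z hz a) (hpφ z hz a) i j
  have hsymm : ∀ z ∈ halfBall x₀ r, ∀ i j, partialDeriv i (partialDeriv j v) z
      = partialDeriv j (partialDeriv i v) z := fun z hz i j =>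
    partialDeriv_comm (hDH z hz) (ContDiffWithinAt.of_le (hv z hz) (by norm_num)) i j
  have hwb : ∀ z ∈ halfBall x₀ r, ∀ a, |w a z| ≤ 2 * C₀ := fun z hz a => by
    have := (abs_sub (partialDeriv a v z) (partialDeriv a φ z)).trans
      (add_le_add (hv1 z hz a) (hφ1 z hz a))
    linarith
  have hN : ∀ z ∈ halfBall x₀ r, ∑ i, ∑ j, |partialDeriv i (partialDeriv j v) z|
      ≤ C₁ * (1 + n * n * C₀ + ∑ a ∈ T, ∑ j, |partialDeriv j (w a) z|) := fun z hz => by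
    obtain ⟨b, -, hb2, hb3, hb4, -⟩ := hb z hz
    refine (sum_abs_hessian_le hθ hΘ hb2 hb3 (hsymm z hz) hb4).trans ?_
    rw [add_assoc 1]
    refine mul_le_mul_of_nonneg_left (add_le_add le_rfl ?_) hC₁0
    calc ∑ a ∈ T, ∑ j, |partialDeriv j (partialDeriv a v) z|
        ≤ ∑ a ∈ T, ∑ j, (C₀ + |partialDeriv j (w a) z|) := by
          refine Finset.sum_le_sum fun a _ => Finset.sum_le_sum fun j _ => ?_
          have e : partialDeriv j (partialDeriv a v) z
            = partialDeriv j (partialDeriv a φ) z + partialDeriv j (w a) z := by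
            rw [hw1 z hz]; ring
          rw [e]
          exact (abs_add_le _ _).trans (add_le_add (hφ2 z hz j a) le_rfl)
      _ = T.card * (n * C₀) + ∑ a ∈ T, ∑ j, |partialDeriv j (w a) z| := by
          simp [Finset.sum_add_distrib]
      _ ≤ n * (n * C₀) + ∑ a ∈ T, ∑ j, |partialDeriv j (w a) z| := by gcongr
      _ = _ := by ring
  have hflat : ∀ z ∈ halfBall x₀ r, z 0 = 0 → dist z x₀ < r → ∀ a ∈ T, w a z = 0 := by
    intro z hz hz0 hzr a ha
    have h1 : w a z = partialDeriv a (fun y => v y - φ y) z :=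
      (partialDeriv_sub (hDH z hz) ((hv z hz).diffAt (by simp)) ((hφ z hz).diffAt (by simp)) a).symm
    rw [h1]
    refine partialDeriv_eq_zero_of_flat hz0 (((hv z hz).diffAt (by simp)).sub
      ((hφ z hz).diffAt (by simp))) ?_ (Finset.ne_of_mem_erase ha)
    have : ∀ᶠ y in 𝓝[halfSpace n] z, dist y x₀ < r :=
      nhdsWithin_le_nhds (Metric.isOpen_ball.mem_nhds hzr)
    filter_upwards [this, self_mem_nhdsWithin] with y hy hyH hy0
    simp [hbd y ⟨hy.le, hyH⟩ hy0]
  have hx₀H : x₀ ∈ halfSpace n := mem_halfSpace.2 h0.ge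
  have hx₀ : x₀ ∈ halfBall x₀ r := ⟨Metric.mem_closedBall_self hr.le, hx₀H⟩
  have hx₀r : dist x₀ x₀ < r := by simpa using hr
  have hnear : ∀ᶠ y in 𝓝[halfSpace n] x₀, y ∈ halfBall x₀ r ∧ dist y x₀ < r := by
    have : ∀ᶠ y in 𝓝[halfSpace n] x₀, dist y x₀ < r :=
      nhdsWithin_le_nhds (Metric.isOpen_ball.mem_nhds hx₀r)
    filter_upwards [this, self_mem_nhdsWithin] with y hy hyH using ⟨⟨hy.le, hyH⟩, hy⟩
  -- mixed derivatives
  have hmixed : ∀ a ∈ T, ∀ s : ℝ, |s| ≤ 1 → s * partialDeriv 0 (w a) x₀ ≤ C₅ := by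
    intro a ha s hs
    have hus : ∀ z ∈ halfBall x₀ r,
        SmoothAt 2 (fun y => s * w a y + ∑ c ∈ T, w c y * w c y) z := fun z hz =>
      (contDiffWithinAt_const.mul (hws z hz a)).add
        (ContDiffWithinAt.sum fun c _ => (hws z hz c).mul (hws z hz c))
    -- The squares do not disturb the conclusion: the functions `w c` vanish at `x₀`, so only `s *
    -- partialDeriv 0 (w a) x₀` survives in the normal derivative.
    have h1 := hbar x₀ (fun y => s * w a y + ∑ c ∈ T, w c y * w c y) h0 hus ?_ ?_ ?_
    · refine le_trans (le_of_eq ?_) h1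
      have hd : ∀ c, DifferentiableWithinAt ℝ (w c) (halfSpace n) x₀ := fun c =>
        (hws x₀ hx₀ c).diffAt (by simp)
      rw [partialDeriv_add hx₀H ((differentiableWithinAt_const s).fun_mul (hd a))
        (DifferentiableWithinAt.fun_sum fun c _ => (hd c).fun_mul (hd c)),
        partialDeriv_const_mul hx₀H (hd a),
        partialDeriv_sum T hx₀H fun c _ => (hd c).fun_mul (hd c), Finset.sum_eq_zero, add_zero]
      intro c hc
      rw [partialDeriv_mul hx₀H (hd c) (hd c), hflat x₀ hx₀ h0 hx₀r c hc]
      ring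
    · intro z hz
      have e1 : s * w a z ≤ 2 * C₀ := by
        refine (le_abs_self _).trans ?_
        rw [abs_mul]
        calc |s| * |w a z| ≤ 1 * (2 * C₀) :=
              mul_le_mul hs (hwb z hz a) (abs_nonneg _) zero_le_one
          _ = _ := one_mul _
      have e2 : ∑ c ∈ T, w c z * w c z ≤ n * (2 * C₀ * (2 * C₀)) := by
        calc ∑ c ∈ T, w c z * w c z ≤ ∑ c ∈ T, 2 * C₀ * (2 * C₀) := by
              refine Finset.sum_le_sum fun c _ => ?_
              rw [← abs_mul_abs_self]
              exact mul_le_mul (hwb z hz c) (hwb z hz c) (abs_nonneg _) (by positivity)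
          _ = T.card * (2 * C₀ * (2 * C₀)) := by simp
          _ ≤ _ := by gcongr
      exact add_le_add e1 e2
    · intro z hz hz0 hzr
      simp only [hflat z hz hz0 hzr a ha]
      rw [Finset.sum_eq_zero fun c hc => by rw [hflat z hz hz0 hzr c hc, mul_zero]]
      ring
    · intro z hz
      obtain ⟨b, hb1, hb2, hb3, hb4, hb5⟩ := hb z hz
      refine ⟨b, hb1, hb2, hb3, ?_⟩
      refine habs z w b (hDH z hz) (hws z hz) hb2 (fun c _ => hwb z hz c) ?_ a ha s hs
      intro c _
      have e1 : ∑ i, ∑ j, b i j * partialDeriv i (partialDeriv j (w c)) z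
          = (∑ i, ∑ j, b i j * partialDeriv i (partialDeriv j (partialDeriv c v)) z)
            - ∑ i, ∑ j, b i j * partialDeriv i (partialDeriv j (partialDeriv c φ)) z := by
        simp only [hw2 z hz, mul_sub, Finset.sum_sub_distrib]
      have e2 : |∑ i, ∑ j, b i j * partialDeriv i (partialDeriv j (partialDeriv c φ)) z|
          ≤ n * n * Θ * C₀ := by
        calc |∑ i, ∑ j, b i j * partialDeriv i (partialDeriv j (partialDeriv c φ)) z|
            ≤ ∑ i : Fin n, ∑ j : Fin n, Θ * C₀ := by
              refine (Finset.abs_sum_le_sum_abs _ _).trans (Finset.sum_le_sum fun i _ => ?_)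
              refine (Finset.abs_sum_le_sum_abs _ _).trans (Finset.sum_le_sum fun j _ => ?_)
              rw [abs_mul]
              exact mul_le_mul (hb3 i j) (hφ3 z hz i j c) (abs_nonneg _) hΘ
          _ = _ := by simp; ring
      rw [e1]
      refine (abs_sub _ _).trans ((add_le_add (hb5 c) e2).trans ?_)
      set S := ∑ a ∈ T, ∑ j, |partialDeriv j (w a) z| with hS
      have hS0 : 0 ≤ S := by positivity
      calc C₀ * (1 + ∑ i, ∑ j, |partialDeriv i (partialDeriv j v) z|) + n * n * Θ * C₀
          ≤ C₀ * (1 + C₁ * (1 + n * n * C₀ + S)) + n * n * Θ * C₀ := by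
            gcongr; exact hN z hz
        _ ≤ C₀ * (1 + C₁ * (1 + n * n * C₀)) + n * n * Θ * C₀
            + (C₀ * (1 + C₁ * (1 + n * n * C₀)) + n * n * Θ * C₀) * S := by
            have q : 0 ≤ C₀ * S + C₀ * C₁ * (n * n * C₀) * S + n * n * Θ * C₀ * S := by positivity
            nlinarith [q]
        _ = C₂ * (1 + S) := by rw [hC₂]; ring
  have hwx : ∀ a ∈ T, ∀ j, |partialDeriv j (w a) x₀| ≤ C₅ := by
    intro a ha j
    by_cases hj : j = 0
    · subst hj
      rw [abs_le]
      have h1 := hmixed a ha 1 (by simp)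
      have h2 := hmixed a ha (-1) (by simp)
      constructor <;> linarith
    · rw [partialDeriv_eq_zero_of_flat h0 ((hws x₀ hx₀ a).diffAt (by simp)) ?_ hj, abs_zero]
      · exact hC₅
      · exact hnear.mono fun y hy hy0 => hflat y hy.1 hy0 hy.2 a ha
  intro i j
  have hle : |partialDeriv i (partialDeriv j v) x₀|
      ≤ ∑ i, ∑ j, |partialDeriv i (partialDeriv j v) x₀| := by
    refine le_trans ?_ (Finset.single_le_sum
      (f := fun i => ∑ j, |partialDeriv i (partialDeriv j v) x₀|)
      (fun _ _ => by positivity) (Finset.mem_univ i))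
    exact Finset.single_le_sum (f := fun j => |partialDeriv i (partialDeriv j v) x₀|)
      (fun _ _ => abs_nonneg _) (Finset.mem_univ j)
  -- `hN` contains the solution of the equation for the double normal derivative, so the bounds on
  -- the derivatives of the tangential `w a` suffice.
  refine hle.trans ((hN x₀ hx₀).trans ?_)
  refine mul_le_mul_of_nonneg_left ?_ hC₁0
  have : ∑ a ∈ T, ∑ j, |partialDeriv j (w a) x₀| ≤ n * (n * C₅) := by
    calc ∑ a ∈ T, ∑ j, |partialDeriv j (w a) x₀| ≤ ∑ a ∈ T, ∑ _j : Fin n, C₅ :=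
          Finset.sum_le_sum fun a ha => Finset.sum_le_sum fun j _ => hwx a ha j
      _ = T.card * (n * C₅) := by simp
      _ ≤ _ := by gcongr
  linarith

end BoundaryHessian

/-! ### Uniform ellipticity from the trace term -/

section EllipticMatrix

open Matrix

theorem abs_le_one_add_of_sq_le {x L : ℝ} (h : x ^ 2 ≤ L) : |x| ≤ 1 + L := by
  rw [abs_le]
  constructor <;> nlinarith [sq_nonneg (x + 1 / 2), sq_nonneg (x - 1 / 2)]

/-- The coefficient matrix of the linearised operator and its ellipticity. -/
theorem exists_elliptic_matrix (n : ℕ) (hn : 3 ≤ n) (L : ℝ) (hL : 1 ≤ L) :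
    ∃ θ Θ : ℝ, 0 < θ ∧ 0 ≤ Θ ∧ ∀ (G P Q : Matrix (Fin n) (Fin n) ℝ) (q : Fin n → ℝ),
      P * Q = 1 → Q * P = 1 → P * Pᵀ = G⁻¹ → Qᵀ * Q = G → (∀ i, 0 ≤ q i) → ∑ i, q i = 1 →
      (∀ i j, |G i j| ≤ L) → (∀ i j, |G⁻¹ i j| ≤ L) →
      ∃ b : Fin n → Fin n → ℝ,
        (∀ ζ : Fin n → Fin n → ℝ, (∀ ξ : Fin n → ℝ, ∑ i, ∑ j, ζ i j * (ξ i * ξ j) ≤ 0) →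
          ∑ i, ∑ j, b i j * ζ i j ≤ 0) ∧
        (∀ ξ : Fin n → ℝ, θ * ∑ i, ξ i ^ 2 ≤ ∑ i, ∑ j, b i j * (ξ i * ξ j)) ∧
        (∀ i j, |b i j| ≤ Θ) ∧
        (∀ ζ : Matrix (Fin n) (Fin n) ℝ,
          ∑ i, q i * (Q * (G⁻¹ * ζ + (((n : ℝ) - 2)⁻¹ * (G⁻¹ * ζ).trace) • 1) * P) i i
            = ∑ i, ∑ j, b i j * ζ i j) ∧
        ∀ (X : Matrix (Fin n) (Fin n) ℝ) (M : ℝ), (∀ i j, |X i j| ≤ M) →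
          |∑ i, q i * (Q * X * P) i i| ≤ Θ * M := by
  have hn0 : (3 : ℝ) ≤ n := by exact_mod_cast hn
  have hn2 : (0 : ℝ) < (n : ℝ) - 2 := by linarith
  -- Every weight is at least `(n - 2)⁻¹`, and ξ is recovered from Pᵀ ξ through `Q`, whose columns
  -- have squared length at most `L`; summing over n components gives `n * L`. The second constant
  -- serves both the entries of `b` and the weighted traces.
  refine ⟨((n : ℝ) - 2)⁻¹ / (n * L), 2 * n * n * (1 + L) * (1 + L), by positivity, by positivity, ?_⟩
  intro G P Q q hPQ hQP hPP hQQ hq hq1 hG hGi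
  have hPb : ∀ i j, |P i j| ≤ 1 + L := fun i j => by
    refine abs_le_one_add_of_sq_le ?_
    have h1 : ∑ m, P i m ^ 2 = G⁻¹ i i := by
      rw [← hPP, mul_apply]; exact Finset.sum_congr rfl fun m _ => by rw [transpose_apply, sq]
    calc P i j ^ 2 ≤ ∑ m, P i m ^ 2 :=
          Finset.single_le_sum (f := fun m => P i m ^ 2) (fun _ _ => sq_nonneg _) (Finset.mem_univ j)
      _ ≤ L := by rw [h1]; exact (le_abs_self _).trans (hGi i i)
  have hQs : ∀ j, ∑ m, Q m j ^ 2 ≤ L := fun j => by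
    have h1 : ∑ m, Q m j ^ 2 = G j j := by
      rw [← hQQ, mul_apply]; exact Finset.sum_congr rfl fun m _ => by rw [transpose_apply, sq]
    rw [h1]; exact (le_abs_self _).trans (hG j j)
  have hQb : ∀ i j, |Q i j| ≤ 1 + L := fun i j => by
    refine abs_le_one_add_of_sq_le (le_trans ?_ (hQs j))
    exact Finset.single_le_sum (f := fun m => Q m j ^ 2) (fun _ _ => sq_nonneg _) (Finset.mem_univ i)
  -- As the `q i` sum to 1, the multiple of the identity contributes `(n - 2)⁻¹` times the full
  -- trace. Each direction receives this weight even if `q i = 0`, which is the source of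
  -- ellipticity.
  set wt : Fin n → ℝ := fun i => q i + ((n : ℝ) - 2)⁻¹ with hwt
  have hqle : ∀ i, q i ≤ 1 := fun i => by
    rw [← hq1]; exact Finset.single_le_sum (fun i _ => hq i) (Finset.mem_univ i)
  have hwt0 : ∀ i, ((n : ℝ) - 2)⁻¹ ≤ wt i := fun i => by simp only [hwt]; linarith [hq i]
  have hinv0 : 0 < ((n : ℝ) - 2)⁻¹ := by positivity
  have hwt2 : ∀ i, wt i ≤ 2 := fun i => by
    have : ((n : ℝ) - 2)⁻¹ ≤ 1 := inv_le_one_of_one_le₀ (by linarith)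
    simp only [hwt]; linarith [hqle i]
  set b : Fin n → Fin n → ℝ := fun i j => ∑ m, wt m * (P i m * P j m) with hb
  have hbζ : ∀ ζ : Fin n → Fin n → ℝ, ∑ i, ∑ j, b i j * ζ i j
      = ∑ m, wt m * ∑ i, ∑ j, ζ i j * (P i m * P j m) := fun ζ => by
    simp only [hb, Finset.sum_mul, Finset.mul_sum]
    rw [Finset.sum_comm' (t' := Finset.univ) (s' := fun _ => Finset.univ) (by simp)]
    calc ∑ j, ∑ i, ∑ m, wt m * (P i m * P j m) * ζ i j
        = ∑ j, ∑ m, ∑ i, wt m * (P i m * P j m) * ζ i j :=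
          Finset.sum_congr rfl fun j _ => Finset.sum_comm
      _ = ∑ m, ∑ j, ∑ i, wt m * (P i m * P j m) * ζ i j := Finset.sum_comm
      _ = ∑ m, ∑ i, ∑ j, wt m * (P i m * P j m) * ζ i j :=
          Finset.sum_congr rfl fun m _ => Finset.sum_comm
      _ = _ := Finset.sum_congr rfl fun m _ => Finset.sum_congr rfl fun i _ =>
          Finset.sum_congr rfl fun j _ => by ring
  refine ⟨b, ?_, ?_, ?_, ?_, ?_⟩
  · intro ζ hζ
    rw [hbζ]
    exact Finset.sum_nonpos fun m _ =>
      mul_nonpos_of_nonneg_of_nonpos (hinv0.le.trans (hwt0 m)) (hζ fun i => P i m)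
  · intro ξ
    rw [hbζ]
    set y : Fin n → ℝ := fun m => ∑ i, ξ i * P i m with hy
    have h1 : ∀ m, ∑ i, ∑ j, ξ i * ξ j * (P i m * P j m) = y m ^ 2 := fun m => by
      rw [sq, hy, Finset.sum_mul_sum]
      exact Finset.sum_congr rfl fun i _ => Finset.sum_congr rfl fun j _ => by ring
    have h2 : ∀ i, ξ i = ∑ m, Q m i * y m := fun i => by
      have : ∑ m, Q m i * y m = ∑ j, ξ j * (P * Q) j i := by
        simp only [hy, mul_apply, Finset.mul_sum]
        rw [Finset.sum_comm]
        exact Finset.sum_congr rfl fun j _ => Finset.sum_congr rfl fun m _ => by ring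
      rw [this, hPQ]
      simp [Matrix.one_apply]
    have h3 : ∀ i, ξ i ^ 2 ≤ L * ∑ m, y m ^ 2 := fun i => by
      conv_lhs => rw [h2 i]
      refine (Finset.sum_mul_sq_le_sq_mul_sq _ _ _).trans ?_
      exact mul_le_mul_of_nonneg_right (hQs i) (by positivity)
    have h4 : ∑ i, ξ i ^ 2 ≤ n * L * ∑ m, y m ^ 2 := by
      calc ∑ i, ξ i ^ 2 ≤ ∑ _i : Fin n, L * ∑ m, y m ^ 2 := Finset.sum_le_sum fun i _ => h3 i
        _ = _ := by simp; ring
    calc ((n : ℝ) - 2)⁻¹ / (n * L) * ∑ i, ξ i ^ 2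
        ≤ ((n : ℝ) - 2)⁻¹ / (n * L) * (n * L * ∑ m, y m ^ 2) := by gcongr
      _ = ∑ m, ((n : ℝ) - 2)⁻¹ * y m ^ 2 := by rw [← Finset.mul_sum]; field_simp
      _ ≤ ∑ m, wt m * y m ^ 2 :=
          Finset.sum_le_sum fun m _ => mul_le_mul_of_nonneg_right (hwt0 m) (sq_nonneg _)
      _ = _ := Finset.sum_congr rfl fun m _ => by rw [h1]
  · intro i j
    calc |b i j| ≤ ∑ m, |wt m * (P i m * P j m)| := Finset.abs_sum_le_sum_abs _ _
      _ ≤ ∑ _m : Fin n, 2 * ((1 + L) * (1 + L)) := by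
          refine Finset.sum_le_sum fun m _ => ?_
          rw [abs_mul, abs_mul, abs_of_nonneg (hinv0.le.trans (hwt0 m))]
          gcongr
          · exact hwt2 m
          · exact hPb i m
          · exact hPb j m
      _ = 2 * n * 1 * (1 + L) * (1 + L) := by simp; ring
      _ ≤ 2 * n * n * (1 + L) * (1 + L) := by gcongr; linarith
  · intro ζ
    have hQG : Q * G⁻¹ = Pᵀ := by rw [← hPP, ← mul_assoc, hQP, one_mul]
    have h1 : Q * (G⁻¹ * ζ + (((n : ℝ) - 2)⁻¹ * (G⁻¹ * ζ).trace) • 1) * P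
        = Pᵀ * ζ * P + (((n : ℝ) - 2)⁻¹ * (G⁻¹ * ζ).trace) • 1 := by
      rw [mul_add, add_mul, ← mul_assoc, hQG, Matrix.mul_smul, Matrix.smul_mul, mul_one, hQP]
    have h2 : (G⁻¹ * ζ).trace = ∑ i, (Pᵀ * ζ * P) i i := by
      rw [← hPP, mul_assoc, trace_mul_comm]; rfl
    have h3 : ∀ m, (Pᵀ * ζ * P) m m = ∑ i, ∑ j, ζ i j * (P i m * P j m) := fun m => by
      rw [mul_apply]
      simp only [mul_apply, transpose_apply, Finset.sum_mul]
      rw [Finset.sum_comm]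
      exact Finset.sum_congr rfl fun i _ => Finset.sum_congr rfl fun j _ => by ring
    rw [h1]
    refine Eq.trans ?_ (hbζ fun i j => ζ i j).symm
    simp only [Matrix.add_apply, Matrix.smul_apply, Matrix.one_apply_eq, smul_eq_mul, mul_one,
      mul_add, Finset.sum_add_distrib, ← Finset.sum_mul, hq1, one_mul, h2, ← h3, hwt, add_mul]
    rw [← Finset.mul_sum (f := fun i => (Pᵀ * ζ * P) i i)]
  · intro X M hX
    have hM : 0 ≤ M := (abs_nonneg _).trans (hX ⟨0, by omega⟩ ⟨0, by omega⟩)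
    have h1 : ∀ i, |(Q * X * P) i i| ≤ n * n * ((1 + L) * M * (1 + L)) := fun i => by
      rw [mul_apply]
      simp only [mul_apply, Finset.sum_mul]
      calc |∑ j, ∑ m, Q i m * X m j * P j i|
          ≤ ∑ _j : Fin n, ∑ _m : Fin n, (1 + L) * M * (1 + L) := by
            refine (Finset.abs_sum_le_sum_abs _ _).trans (Finset.sum_le_sum fun j _ => ?_)
            refine (Finset.abs_sum_le_sum_abs _ _).trans (Finset.sum_le_sum fun m _ => ?_)
            rw [abs_mul, abs_mul]
            gcongr
            · exact hQb i m
            · exact hX m j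
            · exact hPb j i
        _ = _ := by simp; ring
    calc |∑ i, q i * (Q * X * P) i i| ≤ ∑ i, q i * (n * n * ((1 + L) * M * (1 + L))) := by
          refine (Finset.abs_sum_le_sum_abs _ _).trans (Finset.sum_le_sum fun i _ => ?_)
          rw [abs_mul, abs_of_nonneg (hq i)]
          exact mul_le_mul_of_nonneg_left (h1 i) (hq i)
      _ = 1 * n * n * (1 + L) * (1 + L) * M := by rw [← Finset.sum_mul, hq1]; ring
      _ ≤ 2 * n * n * (1 + L) * (1 + L) * M := by gcongr; norm_num

end EllipticMatrix

/-! ### The equation in a half ball and its first derivatives -/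

section LocalEstimate

open Filter Topology Matrix

variable {n : ℕ} [NeZero n]

theorem partialDeriv_symCoeff (k : ℕ) {A : EuclideanSpace ℝ (Fin n) → Matrix (Fin n) (Fin n) ℝ}
    {z : EuclideanSpace ℝ (Fin n)} (hz : z ∈ halfSpace n)
    (hA : ∀ i j, DifferentiableWithinAt ℝ (fun y => A y i j) (halfSpace n) z) (a : Fin n) :
    partialDeriv a (fun y => symCoeff k (ent (A y))) z
      = dSym k (A z) (Matrix.of fun i j => partialDeriv a (fun y => A y i j) z) := by
  have h1 : HasFDerivWithinAt (fun y => ent (A y)) (ContinuousLinearMap.pi fun i =>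
      ContinuousLinearMap.pi fun j => fderivWithin ℝ (fun y => A y i j) (halfSpace n) z)
      (halfSpace n) z :=
    hasFDerivWithinAt_pi.2 fun i => hasFDerivWithinAt_pi.2 fun j => (hA i j).hasFDerivWithinAt
  have h2 := (differentiable_symCoeff k (ent (A z))).hasFDerivAt.comp_hasFDerivWithinAt z h1
  rw [partialDeriv_def]
  change fderivWithin ℝ (symCoeff k ∘ fun y => ent (A y)) (halfSpace n) z _ = _
  rw [h2.fderivWithin (uniqueDiffOn_halfSpace z hz)]
  rfl

theorem differentiableWithinAt_symCoeff (k : ℕ)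
    {A : EuclideanSpace ℝ (Fin n) → Matrix (Fin n) (Fin n) ℝ}
    {z : EuclideanSpace ℝ (Fin n)}
    (hA : ∀ i j, DifferentiableWithinAt ℝ (fun y => A y i j) (halfSpace n) z) :
    DifferentiableWithinAt ℝ (fun y => symCoeff k (ent (A y))) (halfSpace n) z := by
  have h1 : DifferentiableWithinAt ℝ (fun y => ent (A y)) (halfSpace n) z :=
    differentiableWithinAt_pi.2 fun i => differentiableWithinAt_pi.2 fun j => hA i j
  exact DifferentiableAt.comp_differentiableWithinAt (g := symCoeff k) z
    (differentiable_symCoeff k (ent (A z))) h1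

theorem partialDeriv_three_comm {v : EuclideanSpace ℝ (Fin n) → ℝ} {z : EuclideanSpace ℝ (Fin n)}
    (hz : z ∈ halfSpace n) (hv : SmoothAt 3 v z) (a i j : Fin n) :
    partialDeriv a (partialDeriv i (partialDeriv j v)) z
      = partialDeriv i (partialDeriv j (partialDeriv a v)) z := by
  rw [partialDeriv_comm hz (SmoothAt.partialDeriv hv hz (by norm_num) j) a i]
  refine partialDeriv_congr hz ?_ i
  have : ∀ᶠ y in 𝓝[halfSpace n] z, SmoothAt (3 : ℕ) v y := SmoothAt.eventually_smoothAt hv hz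
  filter_upwards [this, self_mem_nhdsWithin] with y hy hyH
  exact partialDeriv_comm hyH (ContDiffWithinAt.of_le hy (by norm_num)) a j

/-- The zeroth and first order part of the operator: a quadratic polynomial in the gradient. -/
def lowerOrder (Y₀ : Fin n → Fin n → EuclideanSpace ℝ (Fin n) → ℝ)
    (Y₁ : Fin n → Fin n → Fin n → EuclideanSpace ℝ (Fin n) → ℝ)
    (Y₂ : Fin n → Fin n → Fin n → Fin n → EuclideanSpace ℝ (Fin n) → ℝ)
    (v : EuclideanSpace ℝ (Fin n) → ℝ) (i j : Fin n) (y : EuclideanSpace ℝ (Fin n)) : ℝ :=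
  Y₀ i j y + ∑ l, Y₁ i j l y * partialDeriv l v y
    + ∑ l, ∑ m, Y₂ i j l m y * (partialDeriv l v y * partialDeriv m v y)

/-- The second order part `G⁻¹ D²v + (n - 2)⁻¹ tr(G⁻¹ D²v) I`. -/
def principalPart (Gi : Matrix (Fin n) (Fin n) ℝ) (ζ : Matrix (Fin n) (Fin n) ℝ) :
    Matrix (Fin n) (Fin n) ℝ :=
  Gi * ζ + (((n : ℝ) - 2)⁻¹ * (Gi * ζ).trace) • 1

/-- A solution of the equation in a half ball, in coordinates, with all data bounded by `L`. -/
structure IsLocalSolution (k : ℕ) (m₀ L r : ℝ) (x₀ : EuclideanSpace ℝ (Fin n))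
    (V : Set (EuclideanSpace ℝ (Fin n)))
    (G W : EuclideanSpace ℝ (Fin n) → Matrix (Fin n) (Fin n) ℝ)
    (Y₀ : Fin n → Fin n → EuclideanSpace ℝ (Fin n) → ℝ)
    (Y₁ : Fin n → Fin n → Fin n → EuclideanSpace ℝ (Fin n) → ℝ)
    (Y₂ : Fin n → Fin n → Fin n → Fin n → EuclideanSpace ℝ (Fin n) → ℝ)
    (v φ α α₀ : EuclideanSpace ℝ (Fin n) → ℝ) : Prop where
  flat : x₀ 0 = 0
  subset : V ⊆ halfSpace n
  mem_nhds : ∀ z ∈ V, V ∈ 𝓝[halfSpace n] z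
  halfBall_subset : halfBall x₀ r ⊆ V
  smooth_v : ∀ z ∈ V, SmoothAt 3 v z
  smooth_φ : ∀ z ∈ V, SmoothAt 3 φ z
  smooth_α : ∀ z ∈ V, SmoothAt 1 α z
  smooth_Gi : ∀ z ∈ V, ∀ i j, SmoothAt 1 (fun y => (G y)⁻¹ i j) z
  smooth_Y₀ : ∀ z ∈ V, ∀ i j, SmoothAt 1 (Y₀ i j) z
  smooth_Y₁ : ∀ z ∈ V, ∀ i j l, SmoothAt 1 (Y₁ i j l) z
  smooth_Y₂ : ∀ z ∈ V, ∀ i j l m, SmoothAt 1 (Y₂ i j l m) z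
  posDef : ∀ z ∈ V, (G z).PosDef
  symm : ∀ z ∈ V, ∃ S : Matrix (Fin n) (Fin n) ℝ, Sᵀ = S ∧ W z = (G z)⁻¹ * S
  formula : ∀ z ∈ V, W z = principalPart (G z)⁻¹
    (Matrix.of fun i j => partialDeriv i (partialDeriv j v) z)
      + Matrix.of fun i j => lowerOrder Y₀ Y₁ Y₂ v i j z
  admissible : ∀ z ∈ V, ∀ j, 1 ≤ j → j ≤ k - 1 →
    0 < sigma j ((((n : ℝ) - 2) * Real.exp (-2 * v z)) • W z)
  equation : ∀ z ∈ V, sigma k ((((n : ℝ) - 2) * Real.exp (-2 * v z)) • W z)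
    + α z * sigma (k - 1) ((((n : ℝ) - 2) * Real.exp (-2 * v z)) • W z) = α₀ z
  boundary : ∀ z ∈ V, z 0 = 0 → v z = φ z
  bound_G : ∀ z ∈ halfBall x₀ r, ∀ i j, |G z i j| ≤ L
  bound_Gi : ∀ z ∈ halfBall x₀ r, ∀ i j, |(G z)⁻¹ i j| ≤ L
  bound_dGi : ∀ z ∈ halfBall x₀ r, ∀ a i j, |partialDeriv a (fun y => (G y)⁻¹ i j) z| ≤ L
  bound_Y₀ : ∀ z ∈ halfBall x₀ r, ∀ i j, |Y₀ i j z| ≤ L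
  bound_Y₁ : ∀ z ∈ halfBall x₀ r, ∀ i j l, |Y₁ i j l z| ≤ L
  bound_Y₂ : ∀ z ∈ halfBall x₀ r, ∀ i j l m, |Y₂ i j l m z| ≤ L
  bound_dY₀ : ∀ z ∈ halfBall x₀ r, ∀ a i j, |partialDeriv a (Y₀ i j) z| ≤ L
  bound_dY₁ : ∀ z ∈ halfBall x₀ r, ∀ a i j l, |partialDeriv a (Y₁ i j l) z| ≤ L
  bound_dY₂ : ∀ z ∈ halfBall x₀ r, ∀ a i j l m, |partialDeriv a (Y₂ i j l m) z| ≤ L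
  bound_v : ∀ z ∈ halfBall x₀ r, |v z| ≤ L
  bound_dv : ∀ z ∈ halfBall x₀ r, ∀ i, |partialDeriv i v z| ≤ L
  bound_dφ : ∀ z ∈ halfBall x₀ r, ∀ i, |partialDeriv i φ z| ≤ L
  bound_ddφ : ∀ z ∈ halfBall x₀ r, ∀ i j, |partialDeriv i (partialDeriv j φ) z| ≤ L
  bound_dddφ : ∀ z ∈ halfBall x₀ r, ∀ i j a,
    |partialDeriv i (partialDeriv j (partialDeriv a φ)) z| ≤ L
  bound_α : ∀ z ∈ halfBall x₀ r, |α z| ≤ L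
  bound_dα : ∀ z ∈ halfBall x₀ r, ∀ i, |partialDeriv i α z| ≤ L
  bound_α₀ : ∀ z ∈ halfBall x₀ r, |α₀ z| ≤ L
  bound_dα₀ : ∀ z ∈ halfBall x₀ r, ∀ i, |partialDeriv i α₀ z| ≤ L
  lower_α₀ : ∀ z ∈ halfBall x₀ r, m₀ ≤ α₀ z

theorem abs_sum_le_of_le {ι : Type*} (s : Finset ι) {f g : ι → ℝ} (h : ∀ i ∈ s, |f i| ≤ g i) :
    |∑ i ∈ s, f i| ≤ ∑ i ∈ s, g i :=
  (Finset.abs_sum_le_sum_abs _ _).trans (Finset.sum_le_sum h)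

theorem lowerOrder_bound {L : ℝ} (hL : 0 ≤ L)
    {Y₀ : Fin n → Fin n → EuclideanSpace ℝ (Fin n) → ℝ}
    {Y₁ : Fin n → Fin n → Fin n → EuclideanSpace ℝ (Fin n) → ℝ}
    {Y₂ : Fin n → Fin n → Fin n → Fin n → EuclideanSpace ℝ (Fin n) → ℝ}
    {v : EuclideanSpace ℝ (Fin n) → ℝ} {i j : Fin n} {z : EuclideanSpace ℝ (Fin n)}
    (h0 : |Y₀ i j z| ≤ L) (h1 : ∀ l, |Y₁ i j l z| ≤ L) (h2 : ∀ l m, |Y₂ i j l m z| ≤ L)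
    (hv : ∀ l, |partialDeriv l v z| ≤ L) :
    |lowerOrder Y₀ Y₁ Y₂ v i j z| ≤ L + n * (L * L) + n * n * (L * (L * L)) := by
  refine (abs_add_le _ _).trans (add_le_add ((abs_add_le _ _).trans (add_le_add h0 ?_)) ?_)
  · refine (abs_sum_le_of_le (g := fun _ => L * L) _ fun l _ => ?_).trans (by simp)
    rw [abs_mul]
    exact mul_le_mul (h1 l) (hv l) (abs_nonneg _) hL
  · refine (abs_sum_le_of_le (g := fun _ => ∑ _m : Fin n, L * (L * L)) _ fun l _ =>
      abs_sum_le_of_le _ fun m _ => ?_).trans (by simp [mul_assoc])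
    rw [abs_mul, abs_mul]
    exact mul_le_mul (h2 l m) (mul_le_mul (hv l) (hv m) (abs_nonneg _) hL) (by positivity) hL

theorem abs_le_sum_abs {n : ℕ} (ζ : Fin n → Fin n → ℝ) (i j : Fin n) : |ζ i j| ≤ ∑ i, ∑ j, |ζ i j| := by
  refine le_trans ?_ (Finset.single_le_sum (f := fun i => ∑ j, |ζ i j|)
    (fun _ _ => by positivity) (Finset.mem_univ i))
  exact Finset.single_le_sum (f := fun j => |ζ i j|) (fun _ _ => abs_nonneg _) (Finset.mem_univ j)

/-- The derivative falls on at most one gradient factor and the gradient is bounded, so the growth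
in D²v is only linear. -/
theorem lowerOrder_deriv_bound {L : ℝ} (hL : 0 ≤ L)
    {Y₀ : Fin n → Fin n → EuclideanSpace ℝ (Fin n) → ℝ}
    {Y₁ : Fin n → Fin n → Fin n → EuclideanSpace ℝ (Fin n) → ℝ}
    {Y₂ : Fin n → Fin n → Fin n → Fin n → EuclideanSpace ℝ (Fin n) → ℝ}
    {v : EuclideanSpace ℝ (Fin n) → ℝ} {i j a : Fin n} {z : EuclideanSpace ℝ (Fin n)}
    (hz : z ∈ halfSpace n) (hv3 : SmoothAt 3 v z)
    (s0 : SmoothAt 1 (Y₀ i j) z) (s1 : ∀ l, SmoothAt 1 (Y₁ i j l) z)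
    (s2 : ∀ l m, SmoothAt 1 (Y₂ i j l m) z)
    (h1 : ∀ l, |Y₁ i j l z| ≤ L) (h2 : ∀ l m, |Y₂ i j l m z| ≤ L)
    (d0 : |partialDeriv a (Y₀ i j) z| ≤ L) (d1 : ∀ l, |partialDeriv a (Y₁ i j l) z| ≤ L)
    (d2 : ∀ l m, |partialDeriv a (Y₂ i j l m) z| ≤ L)
    (hv : ∀ l, |partialDeriv l v z| ≤ L) :
    DifferentiableWithinAt ℝ (lowerOrder Y₀ Y₁ Y₂ v i j) (halfSpace n) z ∧
    |partialDeriv a (lowerOrder Y₀ Y₁ Y₂ v i j) z| ≤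
      (L + n * (L * L + L) + n * n * (L * (L * L) + L * (L + L)))
        * (1 + ∑ i, ∑ j, |partialDeriv i (partialDeriv j v) z|) := by
  set N := ∑ i, ∑ j, |partialDeriv i (partialDeriv j v) z| with hN
  have hN0 : 0 ≤ N := by positivity
  have hζ : ∀ l, |partialDeriv a (partialDeriv l v) z| ≤ N := fun l =>
    abs_le_sum_abs (fun i j => partialDeriv i (partialDeriv j v) z) a l
  have dv : ∀ l, DifferentiableWithinAt ℝ (partialDeriv l v) (halfSpace n) z := fun l =>
    (SmoothAt.partialDeriv (m := 2) hv3 hz (by norm_num) l).diffAt (by simp)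
  have e0 := s0.diffAt (by simp)
  have e1 := fun l => (s1 l).diffAt (by simp)
  have e2 := fun l m => (s2 l m).diffAt (by simp)
  have D1 : DifferentiableWithinAt ℝ (fun y => ∑ l, Y₁ i j l y * partialDeriv l v y)
      (halfSpace n) z := DifferentiableWithinAt.fun_sum fun l _ => (e1 l).fun_mul (dv l)
  have D2' : ∀ l, DifferentiableWithinAt ℝ
      (fun y => ∑ m, Y₂ i j l m y * (partialDeriv l v y * partialDeriv m v y))
      (halfSpace n) z := fun l => DifferentiableWithinAt.fun_sum fun m _ =>
        (e2 l m).fun_mul ((dv l).fun_mul (dv m))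
  have D2 : DifferentiableWithinAt ℝ
      (fun y => ∑ l, ∑ m, Y₂ i j l m y * (partialDeriv l v y * partialDeriv m v y))
      (halfSpace n) z := DifferentiableWithinAt.fun_sum fun l _ => D2' l
  refine ⟨(e0.fun_add D1).fun_add D2, ?_⟩
  have hder : partialDeriv a (lowerOrder Y₀ Y₁ Y₂ v i j) z
      = partialDeriv a (Y₀ i j) z + ∑ l, (partialDeriv a (Y₁ i j l) z * partialDeriv l v z
          + Y₁ i j l z * partialDeriv a (partialDeriv l v) z)
        + ∑ l, ∑ m, (partialDeriv a (Y₂ i j l m) z * (partialDeriv l v z * partialDeriv m v z)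
          + Y₂ i j l m z * (partialDeriv a (partialDeriv l v) z * partialDeriv m v z
            + partialDeriv l v z * partialDeriv a (partialDeriv m v) z)) := by
    unfold lowerOrder
    rw [partialDeriv_add hz (e0.fun_add D1) D2, partialDeriv_add hz e0 D1,
      partialDeriv_sum _ hz fun l _ => (e1 l).fun_mul (dv l), partialDeriv_sum _ hz fun l _ => D2' l]
    congr 1
    · congr 1
      exact Finset.sum_congr rfl fun l _ => partialDeriv_mul hz (e1 l) (dv l) a
    · refine Finset.sum_congr rfl fun l _ => ?_
      rw [partialDeriv_sum _ hz fun m _ => (e2 l m).fun_mul ((dv l).fun_mul (dv m))]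
      refine Finset.sum_congr rfl fun m _ => ?_
      rw [partialDeriv_mul hz (e2 l m) ((dv l).fun_mul (dv m)), partialDeriv_mul hz (dv l) (dv m)]
  rw [hder]
  have b1 : |∑ l, (partialDeriv a (Y₁ i j l) z * partialDeriv l v z
          + Y₁ i j l z * partialDeriv a (partialDeriv l v) z)| ≤ n * (L * L + L * N) := by
    refine (abs_sum_le_of_le (g := fun _ => L * L + L * N) _ fun l _ => ?_).trans
      (le_of_eq (by simp; ring))
    refine (abs_add_le _ _).trans (add_le_add ?_ ?_) <;> rw [abs_mul]
    · exact mul_le_mul (d1 l) (hv l) (abs_nonneg _) hL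
    · exact mul_le_mul (h1 l) (hζ l) (abs_nonneg _) hL
  have b2 : |∑ l, ∑ m, (partialDeriv a (Y₂ i j l m) z * (partialDeriv l v z * partialDeriv m v z)
          + Y₂ i j l m z * (partialDeriv a (partialDeriv l v) z * partialDeriv m v z
            + partialDeriv l v z * partialDeriv a (partialDeriv m v) z))|
      ≤ n * n * (L * (L * L) + L * (N * L + L * N)) := by
    refine (abs_sum_le_of_le (g := fun _ => ∑ _m : Fin n, (L * (L * L) + L * (N * L + L * N))) _
      fun l _ => abs_sum_le_of_le _ fun m _ => ?_).trans (le_of_eq (by simp; ring))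
    refine (abs_add_le _ _).trans (add_le_add ?_ ?_) <;> rw [abs_mul]
    · rw [abs_mul]
      exact mul_le_mul (d2 l m) (mul_le_mul (hv l) (hv m) (abs_nonneg _) hL) (by positivity) hL
    · refine mul_le_mul (h2 l m) ?_ (abs_nonneg _) hL
      refine (abs_add_le _ _).trans (add_le_add ?_ ?_) <;> rw [abs_mul]
      · exact mul_le_mul (hζ l) (hv m) (abs_nonneg _) hN0
      · exact mul_le_mul (hv l) (hζ m) (abs_nonneg _) hL
  calc _ ≤ L + n * (L * L + L * N) + n * n * (L * (L * L) + L * (N * L + L * N)) :=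
        (abs_add_le _ _).trans (add_le_add ((abs_add_le _ _).trans (add_le_add d0 b1)) b2)
    _ ≤ _ := by
        have hn : (0 : ℝ) ≤ n := n.cast_nonneg
        have : 0 ≤ L * N + n * (L * L * N + L) + n * n * (L * (L * L) * N + L * (L + L)) := by
          positivity
        nlinarith [this]

/-- Commuting partial derivatives, the third-order terms are exactly the principal part applied to
the Hessian of ∂_a v. The rest pairs derivatives of the inverse metric with second derivatives of v.
-/
theorem principalPart_deriv_bound (hn : 3 ≤ n) {L : ℝ} (hL : 0 ≤ L)
    {Gi : EuclideanSpace ℝ (Fin n) → Matrix (Fin n) (Fin n) ℝ}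
    {v : EuclideanSpace ℝ (Fin n) → ℝ} {a : Fin n} {z : EuclideanSpace ℝ (Fin n)}
    (hz : z ∈ halfSpace n) (hv3 : SmoothAt 3 v z)
    (s : ∀ i j, SmoothAt 1 (fun y => Gi y i j) z)
    (d : ∀ i j, |partialDeriv a (fun y => Gi y i j) z| ≤ L) (i j : Fin n) :
    DifferentiableWithinAt ℝ (fun y => principalPart (Gi y)
      (Matrix.of fun i j => partialDeriv i (partialDeriv j v) y) i j) (halfSpace n) z ∧
    |partialDeriv a (fun y => principalPart (Gi y)
      (Matrix.of fun i j => partialDeriv i (partialDeriv j v) y) i j) z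
      - principalPart (Gi z)
        (Matrix.of fun i j => partialDeriv i (partialDeriv j (partialDeriv a v)) z) i j|
      ≤ 2 * L * ∑ i, ∑ j, |partialDeriv i (partialDeriv j v) z| := by
  have hn0 : (3 : ℝ) ≤ n := by exact_mod_cast hn
  set N := ∑ i, ∑ j, |partialDeriv i (partialDeriv j v) z| with hN
  have hN0 : 0 ≤ N := by positivity
  have e := fun i j => (s i j).diffAt (by simp)
  have dv : ∀ l m, DifferentiableWithinAt ℝ (partialDeriv l (partialDeriv m v)) (halfSpace n) z :=
    fun l m => (SmoothAt.partialDeriv (m := 1) (SmoothAt.partialDeriv (m := 2) hv3 hz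
      (by norm_num) m) hz (by norm_num) l).diffAt (by simp)
  set δ : ℝ := (1 : Matrix (Fin n) (Fin n) ℝ) i j with hδ
  have hδ1 : |δ| ≤ 1 := by
    rw [hδ, Matrix.one_apply]; split_ifs <;> simp
  have hexp : ∀ (X : Matrix (Fin n) (Fin n) ℝ) (ζ : Fin n → Fin n → ℝ),
      principalPart X (Matrix.of ζ) i j
        = ∑ l, X i l * ζ l j + (((n : ℝ) - 2)⁻¹ * δ) * ∑ l, ∑ m, X l m * ζ m l := fun X ζ => by
    simp only [principalPart, Matrix.add_apply, Matrix.smul_apply, Matrix.mul_apply,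
      Matrix.trace, Matrix.diag_apply, smul_eq_mul, Matrix.of_apply, ← hδ]
    ring
  have hfun : (fun y => principalPart (Gi y)
      (Matrix.of fun i j => partialDeriv i (partialDeriv j v) y) i j)
      = fun y => ∑ l, Gi y i l * partialDeriv l (partialDeriv j v) y
        + (((n : ℝ) - 2)⁻¹ * δ) * ∑ l, ∑ m, Gi y l m * partialDeriv m (partialDeriv l v) y :=
    funext fun y => hexp _ _
  have D1 : DifferentiableWithinAt ℝ (fun y => ∑ l, Gi y i l * partialDeriv l (partialDeriv j v) y)
      (halfSpace n) z := DifferentiableWithinAt.fun_sum fun l _ => (e i l).fun_mul (dv l j)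
  have D2' : ∀ l, DifferentiableWithinAt ℝ
      (fun y => ∑ m, Gi y l m * partialDeriv m (partialDeriv l v) y) (halfSpace n) z := fun l =>
    DifferentiableWithinAt.fun_sum fun m _ => (e l m).fun_mul (dv m l)
  have D2 : DifferentiableWithinAt ℝ
      (fun y => ∑ l, ∑ m, Gi y l m * partialDeriv m (partialDeriv l v) y) (halfSpace n) z :=
    DifferentiableWithinAt.fun_sum fun l _ => D2' l
  rw [hfun]
  refine ⟨D1.fun_add ((differentiableWithinAt_const _).fun_mul D2), ?_⟩
  rw [hexp, partialDeriv_add hz D1 ((differentiableWithinAt_const _).fun_mul D2),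
    partialDeriv_const_mul hz D2, partialDeriv_sum _ hz fun l _ => (e i l).fun_mul (dv l j),
    partialDeriv_sum _ hz fun l _ => D2' l]
  have h1 : ∑ l, partialDeriv a (fun y => Gi y i l * partialDeriv l (partialDeriv j v) y) z
      = ∑ l, partialDeriv a (fun y => Gi y i l) z * partialDeriv l (partialDeriv j v) z
        + ∑ l, Gi z i l * partialDeriv l (partialDeriv j (partialDeriv a v)) z := by
    rw [← Finset.sum_add_distrib]
    refine Finset.sum_congr rfl fun l _ => ?_
    rw [partialDeriv_mul hz (e i l) (dv l j), partialDeriv_three_comm hz hv3]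
  have h2 : ∑ l, partialDeriv a (fun y => ∑ m, Gi y l m * partialDeriv m (partialDeriv l v) y) z
      = ∑ l, ∑ m, partialDeriv a (fun y => Gi y l m) z * partialDeriv m (partialDeriv l v) z
        + ∑ l, ∑ m, Gi z l m * partialDeriv m (partialDeriv l (partialDeriv a v)) z := by
    rw [← Finset.sum_add_distrib]
    refine Finset.sum_congr rfl fun l _ => ?_
    rw [partialDeriv_sum _ hz fun m _ => (e l m).fun_mul (dv m l), ← Finset.sum_add_distrib]
    refine Finset.sum_congr rfl fun m _ => ?_
    rw [partialDeriv_mul hz (e l m) (dv m l), partialDeriv_three_comm hz hv3]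
  rw [h1, h2]
  have b1 : |∑ l, partialDeriv a (fun y => Gi y i l) z * partialDeriv l (partialDeriv j v) z|
      ≤ L * N := by
    calc _ ≤ ∑ l, L * |partialDeriv l (partialDeriv j v) z| := by
          refine abs_sum_le_of_le _ fun l _ => ?_
          rw [abs_mul]
          exact mul_le_mul_of_nonneg_right (d i l) (abs_nonneg _)
      _ = L * ∑ l, |partialDeriv l (partialDeriv j v) z| := by rw [Finset.mul_sum]
      _ ≤ L * N := by
          refine mul_le_mul_of_nonneg_left (Finset.sum_le_sum fun l _ => ?_) hL
          exact Finset.single_le_sum (f := fun j => |partialDeriv l (partialDeriv j v) z|)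
            (fun _ _ => abs_nonneg _) (Finset.mem_univ j)
  have b2 : |∑ l, ∑ m, partialDeriv a (fun y => Gi y l m) z * partialDeriv m (partialDeriv l v) z|
      ≤ L * N := by
    calc _ ≤ ∑ l, ∑ m, L * |partialDeriv m (partialDeriv l v) z| := by
          refine abs_sum_le_of_le _ fun l _ => abs_sum_le_of_le _ fun m _ => ?_
          rw [abs_mul]
          exact mul_le_mul_of_nonneg_right (d l m) (abs_nonneg _)
      _ = L * N := by
          rw [Finset.sum_comm]
          simp only [hN, Finset.mul_sum]
  have b3 : |((n : ℝ) - 2)⁻¹ * δ| ≤ 1 := by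
    rw [abs_mul, abs_of_nonneg (inv_nonneg.2 (by linarith))]
    exact mul_le_one₀ (inv_le_one_of_one_le₀ (by linarith)) (abs_nonneg _) hδ1
  have hb : ∀ p q c t t' : ℝ, p + q + c * (t + t') - (q + c * t') = p + c * t := by
    intros; ring
  rw [hb]
  refine (abs_add_le _ _).trans ?_
  rw [abs_mul]
  have := mul_le_mul b3 b2 (abs_nonneg _) zero_le_one
  linarith

end LocalEstimate

/-! ### The linear inequalities for v and ∂_a v, and the local Hessian bound -/

section LocalTheorem

open Filter Topology Matrix

/-- The weighted trace `∑ q_i (Q B P)_ii` is linear in `B`. -/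
theorem weightedTrace_add_smul {n : ℕ} (P Q : Matrix (Fin n) (Fin n) ℝ) (q : Fin n → ℝ)
    (A B : Matrix (Fin n) (Fin n) ℝ) (s t : ℝ) :
    ∑ i, q i * (Q * (s • A + t • B) * P) i i
      = s * ∑ i, q i * (Q * A * P) i i + t * ∑ i, q i * (Q * B * P) i i := by
  rw [Matrix.mul_add, Matrix.add_mul, Matrix.mul_smul, Matrix.mul_smul, Matrix.smul_mul,
    Matrix.smul_mul, Finset.mul_sum, Finset.mul_sum, ← Finset.sum_add_distrib]
  refine Finset.sum_congr rfl fun i _ => ?_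
  rw [Matrix.add_apply, Matrix.smul_apply, Matrix.smul_apply, smul_eq_mul, smul_eq_mul]
  ring

theorem weightedTrace_add {n : ℕ} (P Q : Matrix (Fin n) (Fin n) ℝ) (q : Fin n → ℝ)
    (A B : Matrix (Fin n) (Fin n) ℝ) :
    ∑ i, q i * (Q * (A + B) * P) i i
      = ∑ i, q i * (Q * A * P) i i + ∑ i, q i * (Q * B * P) i i := by
  have := weightedTrace_add_smul P Q q A B 1 1
  simpa using this

variable {n : ℕ} [NeZero n]

/-- The normalised linearisation is taken at the matrix in the equation, (n-2) e^{-2v} W. Its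
weighted trace of W and of ∂_a W is bounded; removing the lower-order parts leaves the contraction
of `b` with second derivatives. -/
theorem IsLocalSolution.exists_linearization (hn : 3 ≤ n) {k : ℕ} (hk : 2 ≤ k) (hkn : k ≤ n)
    {m₀ L r : ℝ} (hm₀ : 0 < m₀) (hL : 1 ≤ L) :
    ∃ θ Θ C : ℝ, 0 < θ ∧ 0 ≤ Θ ∧ 0 ≤ C ∧ ∀ {x₀ V G W Y₀ Y₁ Y₂ v φ α α₀},
      IsLocalSolution (n := n) k m₀ L r x₀ V G W Y₀ Y₁ Y₂ v φ α α₀ →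
      ∀ z ∈ halfBall x₀ r, ∃ b : Fin n → Fin n → ℝ,
        (∀ ζ : Fin n → Fin n → ℝ, (∀ ξ : Fin n → ℝ, ∑ i, ∑ j, ζ i j * (ξ i * ξ j) ≤ 0) →
          ∑ i, ∑ j, b i j * ζ i j ≤ 0) ∧
        (∀ ξ : Fin n → ℝ, θ * ∑ i, ξ i ^ 2 ≤ ∑ i, ∑ j, b i j * (ξ i * ξ j)) ∧
        (∀ i j, |b i j| ≤ Θ) ∧
        |∑ i, ∑ j, b i j * partialDeriv i (partialDeriv j v) z| ≤ C ∧
        ∀ a, |∑ i, ∑ j, b i j * partialDeriv i (partialDeriv j (partialDeriv a v)) z|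
          ≤ C * (1 + ∑ i, ∑ j, |partialDeriv i (partialDeriv j v) z|) := by
  obtain ⟨C₁, hC₁, hlin⟩ := exists_normalized_linearization n k hk hkn m₀ L hm₀
  obtain ⟨θ, Θ, hθ, hΘ, hell⟩ := exists_elliptic_matrix n hn L hL
  have hL0 : 0 ≤ L := by linarith
  have hn0 : (3 : ℝ) ≤ n := by exact_mod_cast hn
  set Cy : ℝ := L + n * (L * L) + n * n * (L * (L * L)) with hCy
  set Cx : ℝ := (L + n * (L * L + L) + n * n * (L * (L * L) + L * (L + L))) + 2 * L with hCx
  set E : ℝ := Real.exp (2 * L) with hE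
  have hE0 : 0 < E := Real.exp_pos _
  have hCy0 : 0 ≤ Cy := by positivity
  have hCx0 : 0 ≤ Cx := by positivity
  refine ⟨θ, Θ, C₁ * E + Θ * Cy + ((C₁ + 2 * L * C₁) * E + Θ * Cx), hθ, hΘ, by positivity, ?_⟩
  intro x₀ V G W Y₀ Y₁ Y₂ v φ α α₀ h z hz
  have hzV := h.halfBall_subset hz
  have hzH := h.subset hzV
  set c : EuclideanSpace ℝ (Fin n) → ℝ := fun y => ((n : ℝ) - 2) * Real.exp (-2 * v y) with hc
  have hcpos : 0 < c z := mul_pos (by linarith) (Real.exp_pos _)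
  -- The conformal factor is bounded below by `1 / E`, since n - 2 ≥ 1 and v ≤ L; bounds for `A`
  -- therefore pass to `W` at the cost of a factor `E`.
  have hcE : 1 ≤ c z * E := by
    have h1 : 1 ≤ Real.exp (-2 * v z) * E := by
      rw [hE, ← Real.exp_add]
      refine Real.one_le_exp ?_
      have := (abs_le.1 (h.bound_v z hz)).2
      linarith
    calc (1 : ℝ) = 1 * 1 := (one_mul 1).symm
      _ ≤ ((n : ℝ) - 2) * (Real.exp (-2 * v z) * E) :=
          mul_le_mul (by linarith) h1 zero_le_one (by linarith)
      _ = c z * E := by rw [hc]; ring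
  set A : EuclideanSpace ℝ (Fin n) → Matrix (Fin n) (Fin n) ℝ := fun y => c y • W y with hA
  have hAS : ∀ y ∈ V, ∃ S : Matrix (Fin n) (Fin n) ℝ, Sᵀ = S ∧ A y = (G y)⁻¹ * S := fun y hy => by
    obtain ⟨S, hS, hW⟩ := h.symm y hy
    refine ⟨c y • S, by rw [Matrix.transpose_smul, hS], ?_⟩
    rw [hA, Matrix.mul_smul, ← hW]
  -- Needed at all points near `z`, so that the equation becomes an identity between differentiable
  -- functions.
  have hsig : ∀ y ∈ V, ∀ j ≤ n, sigma j (A y) = symCoeff j (ent (A y)) := fun y hy j hj => by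
    obtain ⟨S, hS, hAy⟩ := hAS y hy
    obtain ⟨P, Q, l, hPQ, -, -, -, hD⟩ := exists_simultaneous_diagonalization (h.posDef y hy) hS
    rw [hAy]
    exact sigma_eq_symCoeff hj hPQ hD
  obtain ⟨S, hS, hAz⟩ := hAS z hzV
  have hadm := h.admissible z hzV
  have heqz := h.equation z hzV
  change ∀ j, 1 ≤ j → j ≤ k - 1 → 0 < sigma j (A z) at hadm
  change sigma k (A z) + α z * sigma (k - 1) (A z) = α₀ z at heqz
  rw [hAz] at hadm heqz
  obtain ⟨P, Q, q, hPQ, hQP, hPP, hQQ, hq, hq1, hLA, hLB⟩ := hlin (G z) S (α z) (α₀ z)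
    (h.posDef z hzV) hS hadm heqz (h.lower_α₀ z hz) ((le_abs_self _).trans (h.bound_α₀ z hz))
    (h.bound_α z hz)
  rw [← hAz] at hLA hLB
  obtain ⟨b, hb1, hb2, hb3, hb4, hb5⟩ := hell (G z) P Q q hPQ hQP hPP hQQ hq hq1
    (h.bound_G z hz) (h.bound_Gi z hz)
  have hdivc : ∀ x y : ℝ, c z * x = y → |x| ≤ |y| * E := fun x y hxy => by
    have h1 : |y| = c z * |x| := by rw [← hxy, abs_mul, abs_of_pos hcpos]
    rw [h1]
    have := mul_le_mul_of_nonneg_right hcE (abs_nonneg x)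
    linarith
  have hLW : |∑ i, q i * (Q * W z * P) i i| ≤ C₁ * E := by
    refine (hdivc _ (∑ i, q i * (Q * A z * P) i i) ?_).trans (by gcongr)
    have := weightedTrace_add_smul P Q q (W z) 0 (c z) 0
    simp only [zero_smul, add_zero, zero_mul] at this
    exact this.symm
  set N := ∑ i, ∑ j, |partialDeriv i (partialDeriv j v) z| with hN
  have hN0 : 0 ≤ N := by positivity
  refine ⟨b, hb1, hb2, hb3, ?_, ?_⟩
  · have h1 := hb4 (Matrix.of fun i j => partialDeriv i (partialDeriv j v) z)
    simp only [Matrix.of_apply] at h1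
    have h2 := hb5 (Matrix.of fun i j => lowerOrder Y₀ Y₁ Y₂ v i j z) Cy fun i j =>
      lowerOrder_bound hL0 (h.bound_Y₀ z hz i j) (h.bound_Y₁ z hz i j) (h.bound_Y₂ z hz i j)
        (h.bound_dv z hz)
    have h3 := weightedTrace_add P Q q (principalPart (G z)⁻¹
      (Matrix.of fun i j => partialDeriv i (partialDeriv j v) z))
      (Matrix.of fun i j => lowerOrder Y₀ Y₁ Y₂ v i j z)
    rw [← h.formula z hzV] at h3
    rw [← h1]
    have h4 : ∑ i, q i * (Q * principalPart (G z)⁻¹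
        (Matrix.of fun i j => partialDeriv i (partialDeriv j v) z) * P) i i
        = (∑ i, q i * (Q * W z * P) i i)
          - ∑ i, q i * (Q * (Matrix.of fun i j => lowerOrder Y₀ Y₁ Y₂ v i j z) * P) i i := by
      linarith
    rw [principalPart] at h4
    rw [h4]
    refine (abs_sub _ _).trans ((add_le_add hLW h2).trans ?_)
    have : 0 ≤ (C₁ + 2 * L * C₁) * E + Θ * Cx := by positivity
    linarith
  · intro a
    have hv3 := h.smooth_v z hzV
    have hvd : DifferentiableWithinAt ℝ v (halfSpace n) z := hv3.diffAt (by simp)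
    have hVn := h.mem_nhds z hzV
    -- the first derivative of `W`
    have hWfun : ∀ i j, (fun y => W y i j) =ᶠ[𝓝[halfSpace n] z]
        fun y => principalPart (G y)⁻¹
          (Matrix.of fun i j => partialDeriv i (partialDeriv j v) y) i j
            + lowerOrder Y₀ Y₁ Y₂ v i j y := fun i j => by
      filter_upwards [hVn] with y hy
      rw [h.formula y hy]; rfl
    have hpp := fun i j => principalPart_deriv_bound hn hL0 hzH hv3 (h.smooth_Gi z hzV)
      (h.bound_dGi z hz a) i j
    have hlo := fun i j => lowerOrder_deriv_bound (a := a) hL0 hzH hv3 (h.smooth_Y₀ z hzV i j)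
      (h.smooth_Y₁ z hzV i j) (h.smooth_Y₂ z hzV i j) (h.bound_Y₁ z hz i j) (h.bound_Y₂ z hz i j)
      (h.bound_dY₀ z hz a i j) (h.bound_dY₁ z hz a i j) (h.bound_dY₂ z hz a i j) (h.bound_dv z hz)
    have hWd : ∀ i j, DifferentiableWithinAt ℝ (fun y => W y i j) (halfSpace n) z := fun i j =>
      ((hpp i j).1.fun_add (hlo i j).1).congr_of_eventuallyEq (hWfun i j)
        ((hWfun i j).eq_of_nhdsWithin hzH)
    set dW : Matrix (Fin n) (Fin n) ℝ := Matrix.of fun i j => partialDeriv a (fun y => W y i j) z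
      with hdW
    set Z : Matrix (Fin n) (Fin n) ℝ :=
      Matrix.of fun i j => partialDeriv i (partialDeriv j (partialDeriv a v)) z with hZ
    -- All of ∂_a W except the third-order terms is at most linear in second derivatives.
    have hX : ∀ i j, |(dW - principalPart (G z)⁻¹ Z) i j| ≤ Cx * (1 + N) := fun i j => by
      have e : (dW - principalPart (G z)⁻¹ Z) i j
          = partialDeriv a (fun y => W y i j) z - principalPart (G z)⁻¹ Z i j := rfl
      rw [e, partialDeriv_congr hzH (hWfun i j), partialDeriv_add hzH (hpp i j).1 (hlo i j).1,
        add_sub_right_comm]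
      refine (abs_add_le _ _).trans ((add_le_add (hpp i j).2 (hlo i j).2).trans ?_)
      rw [hCx]
      nlinarith
    -- the first derivative of `A`
    have hcd : DifferentiableWithinAt ℝ c (halfSpace n) z :=
      (differentiableWithinAt_const _).fun_mul
        (((differentiableWithinAt_const _).fun_mul hvd).exp)
    have hdc : partialDeriv a c z = -2 * partialDeriv a v z * c z := by
      have h1 : HasDerivAt (fun t : ℝ => ((n : ℝ) - 2) * Real.exp (-2 * t))
          (((n : ℝ) - 2) * (Real.exp (-2 * v z) * (-2))) (v z) := by
        have h2 : HasDerivAt (fun t : ℝ => -2 * t) (-2) (v z) := by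
          simpa using (hasDerivAt_id (v z)).const_mul (-2 : ℝ)
        exact (h2.exp).const_mul _
      rw [hc, partialDeriv_comp_real hzH hvd h1]
      ring
    have hAd : ∀ i j, DifferentiableWithinAt ℝ (fun y => A y i j) (halfSpace n) z := fun i j =>
      hcd.fun_mul (hWd i j)
    have hdA : (Matrix.of fun i j => partialDeriv a (fun y => A y i j) z)
        = (-2 * partialDeriv a v z) • A z + c z • dW := by
      ext i j
      have : partialDeriv a (fun y => A y i j) z
          = partialDeriv a c z * W z i j + c z * partialDeriv a (fun y => W y i j) z :=
        partialDeriv_mul hzH hcd (hWd i j) a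
      rw [Matrix.of_apply, this, hdc]
      simp only [hA, hdW, Matrix.add_apply, Matrix.smul_apply, smul_eq_mul, Matrix.of_apply]
      ring
    have hαd : DifferentiableWithinAt ℝ α (halfSpace n) z := (h.smooth_α z hzV).diffAt (by simp)
    have heqd : dSym k (A z) (Matrix.of fun i j => partialDeriv a (fun y => A y i j) z)
        + α z * dSym (k - 1) (A z) (Matrix.of fun i j => partialDeriv a (fun y => A y i j) z)
        + partialDeriv a α z * symCoeff (k - 1) (ent (A z)) = partialDeriv a α₀ z := by
      have hfun : α₀ =ᶠ[𝓝[halfSpace n] z]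
          fun y => symCoeff k (ent (A y)) + α y * symCoeff (k - 1) (ent (A y)) := by
        filter_upwards [hVn] with y hy
        have := h.equation y hy
        change sigma k (A y) + α y * sigma (k - 1) (A y) = α₀ y at this
        rw [← this, hsig y hy k hkn, hsig y hy (k - 1) (by omega)]
      rw [partialDeriv_congr hzH hfun, partialDeriv_add hzH (differentiableWithinAt_symCoeff k hAd)
        (hαd.fun_mul (differentiableWithinAt_symCoeff (k - 1) hAd)),
        partialDeriv_mul hzH hαd (differentiableWithinAt_symCoeff (k - 1) hAd),
        partialDeriv_symCoeff k hzH hAd, partialDeriv_symCoeff (k - 1) hzH hAd]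
      ring
    -- The derivative of the conformal factor adds the multiple -2 ∂_a v of `A`, whose weighted
    -- trace is already bounded by `hLA`; this isolates ∂_a W.
    have hLdA := hLB _ _ _ (h.bound_dα z hz a) (h.bound_dα₀ z hz a) heqd
    rw [hdA, weightedTrace_add_smul] at hLdA
    have hLdW : |∑ i, q i * (Q * dW * P) i i| ≤ (C₁ + 2 * L * C₁) * E := by
      refine (hdivc _ _ rfl).trans (mul_le_mul_of_nonneg_right ?_ hE0.le)
      have e : c z * ∑ i, q i * (Q * dW * P) i i
          = (-2 * partialDeriv a v z * ∑ i, q i * (Q * A z * P) i i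
              + c z * ∑ i, q i * (Q * dW * P) i i)
            - -2 * partialDeriv a v z * ∑ i, q i * (Q * A z * P) i i := by ring
      rw [e]
      refine (abs_sub _ _).trans (add_le_add hLdA ?_)
      rw [abs_mul, abs_mul]
      have h2 : |(-2 : ℝ)| = 2 := by norm_num
      rw [h2]
      gcongr
      exact h.bound_dv z hz a
    have h1 := hb4 Z
    have h2 := hb5 _ _ hX
    have h3 := weightedTrace_add P Q q (dW - principalPart (G z)⁻¹ Z) (principalPart (G z)⁻¹ Z)
    rw [sub_add_cancel] at h3
    change ∑ i, q i * (Q * principalPart (G z)⁻¹ Z * P) i i = _ at h1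
    have h4 : ∑ i, ∑ j, b i j * partialDeriv i (partialDeriv j (partialDeriv a v)) z
        = (∑ i, q i * (Q * dW * P) i i)
          - ∑ i, q i * (Q * (dW - principalPart (G z)⁻¹ Z) * P) i i := by
      have e : ∑ i, ∑ j, b i j * partialDeriv i (partialDeriv j (partialDeriv a v)) z
          = ∑ i, ∑ j, b i j * Z i j := rfl
      rw [e, ← h1]
      linarith
    rw [h4]
    refine (abs_sub _ _).trans ((add_le_add hLdW h2).trans ?_)
    have p1 : 0 ≤ (C₁ + 2 * L * C₁) * E := by positivity
    have p2 : 0 ≤ C₁ * E + Θ * Cy := by positivity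
    have p3 := mul_nonneg p1 hN0
    have p4 := mul_nonneg p2 (by linarith : 0 ≤ 1 + N)
    nlinarith

theorem IsLocalSolution.exists_hessian_bound (hn : 3 ≤ n) {k : ℕ} (hk : 2 ≤ k) (hkn : k ≤ n)
    {m₀ L r : ℝ} (hm₀ : 0 < m₀) (hL : 1 ≤ L) (hr : 0 < r) :
    ∃ C : ℝ, 0 ≤ C ∧ ∀ {x₀ V G W Y₀ Y₁ Y₂ v φ α α₀},
      IsLocalSolution (n := n) k m₀ L r x₀ V G W Y₀ Y₁ Y₂ v φ α α₀ →
      ∀ i j, |partialDeriv i (partialDeriv j v) x₀| ≤ C := by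
  obtain ⟨θ, Θ, C₁, hθ, hΘ, hC₁, hlin⟩ :=
    IsLocalSolution.exists_linearization (n := n) (r := r) hn hk hkn hm₀ hL
  obtain ⟨C, hC, hbd⟩ := exists_boundary_hessian_bound n θ Θ (L + C₁) r hθ hΘ (by positivity) hr
  have hLC : L ≤ L + C₁ := by linarith
  refine ⟨C, hC, fun {x₀ V G W Y₀ Y₁ Y₂ v φ α α₀} h => ?_⟩
  have hsub := h.halfBall_subset
  refine hbd x₀ v φ h.flat (fun z hz => h.smooth_v z (hsub hz)) (fun z hz => h.smooth_φ z (hsub hz))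
    (fun z hz => h.boundary z (hsub hz)) (fun z hz i => (h.bound_dv z hz i).trans hLC)
    (fun z hz i => (h.bound_dφ z hz i).trans hLC)
    (fun z hz i j => (h.bound_ddφ z hz i j).trans hLC)
    (fun z hz i j a => (h.bound_dddφ z hz i j a).trans hLC) ?_
  intro z hz
  obtain ⟨b, h1, h2, h3, h4, h5⟩ := hlin h z hz
  refine ⟨b, h1, h2, h3, h4.trans (by linarith), fun a => (h5 a).trans ?_⟩
  gcongr
  linarith

end LocalTheorem

/-! ### Metrics on coordinate domains; symmetry of the Ricci tensor -/

section CoordinateGeometry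

open Filter Topology

variable {n : ℕ} [NeZero n]

/-- The entrywise partial derivative of a matrix-valued function. -/
def matDeriv (i : Fin n) (A : EuclideanSpace ℝ (Fin n) → Matrix (Fin n) (Fin n) ℝ)
    (z : EuclideanSpace ℝ (Fin n)) : Matrix (Fin n) (Fin n) ℝ :=
  Matrix.of fun a b => partialDeriv i (fun y => A y a b) z

/-- The entries of `A` are of class `C^m` at `z`. -/
def MatSmoothAt (m : WithTop ℕ∞) (A : EuclideanSpace ℝ (Fin n) → Matrix (Fin n) (Fin n) ℝ)
    (z : EuclideanSpace ℝ (Fin n)) : Prop :=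
  ∀ a b, SmoothAt m (fun y => A y a b) z

section MatrixCalculus

variable {A B : EuclideanSpace ℝ (Fin n) → Matrix (Fin n) (Fin n) ℝ}
  {z : EuclideanSpace ℝ (Fin n)} {m : WithTop ℕ∞}

theorem MatSmoothAt.mul (hA : MatSmoothAt m A z) (hB : MatSmoothAt m B z) :
    MatSmoothAt m (fun y => A y * B y) z := fun a b => by
  simp only [Matrix.mul_apply]
  exact ContDiffWithinAt.sum fun c _ => (hA a c).mul (hB c b)

theorem MatSmoothAt.of_le {m' : WithTop ℕ∞} (hA : MatSmoothAt m A z) (h : m' ≤ m) :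
    MatSmoothAt m' A z := fun a b => (hA a b).of_le h

theorem matDeriv_mul (hz : z ∈ halfSpace n) (hA : MatSmoothAt 1 A z) (hB : MatSmoothAt 1 B z)
    (i : Fin n) :
    matDeriv i (fun y => A y * B y) z = matDeriv i A z * B z + A z * matDeriv i B z := by
  ext a b
  simp only [matDeriv, Matrix.of_apply, Matrix.add_apply, Matrix.mul_apply]
  rw [partialDeriv_sum Finset.univ (F := fun c y => A y a c * B y c b) hz
    fun c _ => ((hA a c).diffAt one_ne_zero).fun_mul ((hB c b).diffAt one_ne_zero),
    ← Finset.sum_add_distrib]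
  exact Finset.sum_congr rfl fun c _ =>
    partialDeriv_mul hz ((hA a c).diffAt one_ne_zero) ((hB c b).diffAt one_ne_zero) i

theorem matDeriv_add (hz : z ∈ halfSpace n) (hA : MatSmoothAt 1 A z) (hB : MatSmoothAt 1 B z)
    (i : Fin n) :
    matDeriv i (fun y => A y + B y) z = matDeriv i A z + matDeriv i B z := by
  ext a b
  exact partialDeriv_add hz ((hA a b).diffAt one_ne_zero) ((hB a b).diffAt one_ne_zero) i

theorem matDeriv_sum_smul {ι : Type*} (s : Finset ι) (hz : z ∈ halfSpace n)
    {c : ι → EuclideanSpace ℝ (Fin n) → ℝ}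
    {F : ι → EuclideanSpace ℝ (Fin n) → Matrix (Fin n) (Fin n) ℝ}
    (hc : ∀ a, SmoothAt 1 (c a) z) (hF : ∀ a, MatSmoothAt 1 (F a) z) (i : Fin n) :
    matDeriv i (fun y => ∑ a ∈ s, c a y • F a y) z
      = ∑ a ∈ s, (partialDeriv i (c a) z • F a z + c a z • matDeriv i (F a) z) := by
  ext a b
  simp only [matDeriv, Matrix.of_apply, Matrix.add_apply, Matrix.sum_apply, Matrix.smul_apply,
    smul_eq_mul]
  rw [partialDeriv_sum s (F := fun q y => c q y * F q y a b) hz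
    fun q _ => ((hc q).diffAt one_ne_zero).fun_mul ((hF q a b).diffAt one_ne_zero)]
  exact Finset.sum_congr rfl fun q _ =>
    partialDeriv_mul hz ((hc q).diffAt one_ne_zero) ((hF q a b).diffAt one_ne_zero) i

theorem matDeriv_congr (hz : z ∈ halfSpace n) (h : A =ᶠ[𝓝[halfSpace n] z] B) (i : Fin n) :
    matDeriv i A z = matDeriv i B z := by
  ext a b
  exact partialDeriv_congr hz (h.mono fun y hy => by simp only [hy]) i

theorem MatSmoothAt.matDeriv (hA : MatSmoothAt ∞ A z) (hz : z ∈ halfSpace n) (i : Fin n) :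
    MatSmoothAt ∞ (matDeriv i A) z := fun a b =>
  (hA a b).partialDeriv hz (by simp) i

theorem MatSmoothAt.inv (hA : MatSmoothAt m A z) (hdet : (A z).det ≠ 0) :
    MatSmoothAt m (fun y => (A y)⁻¹) z := fun a b => by
  have hprod : ∀ {ι : Type} (s : Finset ι) (F : ι → EuclideanSpace ℝ (Fin n) → ℝ),
      (∀ q ∈ s, SmoothAt m (F q) z) → SmoothAt m (fun y => ∏ q ∈ s, F q y) z :=
    fun s F h => contDiffWithinAt_prod h
  have hd : ∀ D : EuclideanSpace ℝ (Fin n) → Matrix (Fin n) (Fin n) ℝ, MatSmoothAt m D z →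
      SmoothAt m (fun y => (D y).det) z := fun D hD => by
    simp only [Matrix.det_apply']
    exact ContDiffWithinAt.sum fun σ _ =>
      contDiffWithinAt_const.mul (hprod _ (fun q y => D y (σ q) q) fun q _ => hD _ _)
  have h1 : (fun y => (A y)⁻¹ a b) = fun y => (A y).det⁻¹ * (A y).adjugate a b := by
    ext y
    simp [Matrix.inv_def]
  rw [h1]
  refine ((hd A hA).inv hdet).mul ?_
  simp only [Matrix.adjugate_apply]
  refine hd (fun y => (A y).updateRow b (Pi.single a 1)) fun p q => ?_
  by_cases hp : p = b
  · subst hp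
    simpa using contDiffWithinAt_const
  · simpa [Matrix.updateRow_apply, hp] using hA p q

end MatrixCalculus

/-- The Christoffel symbols of a matrix-valued function. -/
def christoffelOf (G : EuclideanSpace ℝ (Fin n) → Matrix (Fin n) (Fin n) ℝ) (l i j : Fin n)
    (y : EuclideanSpace ℝ (Fin n)) : ℝ :=
  (1 / 2) * ∑ m, (G y)⁻¹ l m *
    (partialDeriv i (fun z => G z m j) y + partialDeriv j (fun z => G z i m) y
      - partialDeriv m (fun z => G z i j) y)

/-- The Ricci tensor of a connection. -/
def ricciOf (Γ : Fin n → Fin n → Fin n → EuclideanSpace ℝ (Fin n) → ℝ)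
    (y : EuclideanSpace ℝ (Fin n)) : Matrix (Fin n) (Fin n) ℝ :=
  Matrix.of fun i j =>
    ∑ l, partialDeriv l (Γ l i j) y
      - ∑ l, partialDeriv j (Γ l i l) y
      + ∑ l, ∑ m, Γ l l m y * Γ m i j y
      - ∑ l, ∑ m, Γ l j m y * Γ m i l y

/-- `G` is a smooth Riemannian metric on the relatively open subset `V` of the half-space. -/
structure IsMetricOn (V : Set (EuclideanSpace ℝ (Fin n)))
    (G : EuclideanSpace ℝ (Fin n) → Matrix (Fin n) (Fin n) ℝ) : Prop where
  subset : V ⊆ halfSpace n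
  mem_nhds : ∀ z ∈ V, V ∈ 𝓝[halfSpace n] z
  smooth : ∀ z ∈ V, MatSmoothAt ∞ G z
  posDef : ∀ z ∈ V, (G z).PosDef

namespace IsMetricOn

variable {V : Set (EuclideanSpace ℝ (Fin n))}
  {G : EuclideanSpace ℝ (Fin n) → Matrix (Fin n) (Fin n) ℝ} {z : EuclideanSpace ℝ (Fin n)}

theorem det_ne_zero (h : IsMetricOn V G) (hz : z ∈ V) : (G z).det ≠ 0 := (h.posDef z hz).det_pos.ne'

theorem symm (h : IsMetricOn V G) (hz : z ∈ V) (i j : Fin n) : G z i j = G z j i := by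
  have := (h.posDef z hz).1.apply j i
  simpa using this

theorem inv_symm (h : IsMetricOn V G) (hz : z ∈ V) (i j : Fin n) : (G z)⁻¹ i j = (G z)⁻¹ j i := by
  have := (h.posDef z hz).inv.1.apply j i
  simpa using this

theorem smooth_inv (h : IsMetricOn V G) (hz : z ∈ V) : MatSmoothAt ∞ (fun y => (G y)⁻¹) z :=
  (h.smooth z hz).inv (h.det_ne_zero hz)

theorem partialDeriv_symm (h : IsMetricOn V G) (hz : z ∈ V) (a i j : Fin n) :
    partialDeriv a (fun y => G y i j) z = partialDeriv a (fun y => G y j i) z :=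
  partialDeriv_congr (h.subset hz) (by
    filter_upwards [h.mem_nhds z hz] with y hy using h.symm hy i j) a

theorem smooth_christoffelOf (h : IsMetricOn V G) (hz : z ∈ V) (l i j : Fin n) :
    SmoothAt ∞ (christoffelOf G l i j) z := by
  have hp : ∀ a i j, SmoothAt ∞ (partialDeriv a (fun y => G y i j)) z := fun a i j =>
    (h.smooth z hz i j).partialDeriv (h.subset hz) (by simp) a
  unfold christoffelOf
  exact contDiffWithinAt_const.mul (ContDiffWithinAt.sum fun m _ =>
    (h.smooth_inv hz l m).mul (((hp i m j).add (hp j i m)).sub (hp m i j)))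

theorem christoffelOf_symm (h : IsMetricOn V G) (hz : z ∈ V) (l i j : Fin n) :
    christoffelOf G l i j z = christoffelOf G l j i z := by
  unfold christoffelOf
  congr 1
  refine Finset.sum_congr rfl fun m _ => ?_
  rw [h.partialDeriv_symm hz i m j, h.partialDeriv_symm hz j i m, h.partialDeriv_symm hz m i j]
  ring

theorem smooth_ricciOf (h : IsMetricOn V G) (hz : z ∈ V) :
    MatSmoothAt ∞ (ricciOf (christoffelOf G)) z := fun i j => by
  have hΓ := fun l i j => h.smooth_christoffelOf hz l i j
  have hp : ∀ a l i j, SmoothAt ∞ (partialDeriv a (christoffelOf G l i j)) z := fun a l i j =>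
    (hΓ l i j).partialDeriv (h.subset hz) (by simp) a
  simp only [ricciOf, Matrix.of_apply]
  refine ((ContDiffWithinAt.sub (ContDiffWithinAt.sum fun l _ => hp _ _ _ _)
    (ContDiffWithinAt.sum fun l _ => hp _ _ _ _)).add
    (ContDiffWithinAt.sum fun l _ => ContDiffWithinAt.sum fun m _ => ?_)).sub
    (ContDiffWithinAt.sum fun l _ => ContDiffWithinAt.sum fun m _ => ?_)
  · exact (hΓ _ _ _).mul (hΓ _ _ _)
  · exact (hΓ _ _ _).mul (hΓ _ _ _)

theorem matDeriv_inv (h : IsMetricOn V G) (hz : z ∈ V) (i : Fin n) :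
    matDeriv i (fun y => (G y)⁻¹) z = -((G z)⁻¹ * matDeriv i G z * (G z)⁻¹) := by
  have hH := h.subset hz
  have h1 := matDeriv_mul hH ((h.smooth z hz).of_le (by simp)) ((h.smooth_inv hz).of_le (by simp)) i
  have h2 : matDeriv i (fun y => G y * (G y)⁻¹) z = 0 := by
    rw [matDeriv_congr (B := fun _ => (1 : Matrix (Fin n) (Fin n) ℝ)) hH]
    · ext a b
      exact partialDeriv_const _ i
    · filter_upwards [h.mem_nhds z hz] with y hy
      exact Matrix.mul_nonsing_inv _ (h.det_ne_zero hy).isUnit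
  rw [h2] at h1
  have h3 : (G z)⁻¹ * G z = 1 := Matrix.nonsing_inv_mul _ (h.det_ne_zero hz).isUnit
  calc matDeriv i (fun y => (G y)⁻¹) z
      = (G z)⁻¹ * G z * matDeriv i (fun y => (G y)⁻¹) z := by rw [h3, one_mul]
    _ = (G z)⁻¹ * (matDeriv i G z * (G z)⁻¹ + G z * matDeriv i (fun y => (G y)⁻¹) z)
        - (G z)⁻¹ * matDeriv i G z * (G z)⁻¹ := by noncomm_ring
    _ = _ := by rw [← h1]; simp

/-- In the contraction over an upper and a lower index two of the three metric derivatives cancel,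
because the inverse metric is symmetric. The result is ½ ∂_i log det G. -/
theorem sum_christoffelOf (h : IsMetricOn V G) (hz : z ∈ V) (i : Fin n) :
    ∑ l, christoffelOf G l i l z = (1 / 2) * ((G z)⁻¹ * matDeriv i G z).trace := by
  simp only [christoffelOf, ← Finset.mul_sum, Matrix.trace, Matrix.diag, Matrix.mul_apply, matDeriv,
    Matrix.of_apply]
  congr 1
  simp only [mul_sub, mul_add, Finset.sum_sub_distrib, Finset.sum_add_distrib]
  have : ∑ l, ∑ m, (G z)⁻¹ l m * partialDeriv l (fun y => G y i m) z
      = ∑ l, ∑ m, (G z)⁻¹ l m * partialDeriv m (fun y => G y i l) z := by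
    rw [Finset.sum_comm]
    exact Finset.sum_congr rfl fun l _ => Finset.sum_congr rfl fun m _ => by rw [h.inv_symm hz m l]
  rw [this]; ring

theorem partialDeriv_sum_christoffelOf (h : IsMetricOn V G) (hz : z ∈ V) (i j : Fin n) :
    ∑ l, partialDeriv j (christoffelOf G l i l) z
      = (1 / 2) * ((G z)⁻¹ * matDeriv j (matDeriv i G) z).trace
        - (1 / 2) * ((G z)⁻¹ * matDeriv j G z * ((G z)⁻¹ * matDeriv i G z)).trace := by
  have hH := h.subset hz
  have hs := ((h.smooth_inv hz).mul ((h.smooth z hz).matDeriv hH i)).of_le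
    (m' := 1) (by simp)
  rw [← partialDeriv_sum Finset.univ hH
    fun l _ => (h.smooth_christoffelOf hz l i l).diffAt (by simp)]
  rw [partialDeriv_congr (f' := fun y => (1 / 2) * ∑ a, ((G y)⁻¹ * matDeriv i G y) a a) hH
    (by filter_upwards [h.mem_nhds z hz] with y hy using h.sum_christoffelOf hy i)]
  rw [partialDeriv_const_mul hH (DifferentiableWithinAt.fun_sum
      fun a _ => (hs a a).diffAt one_ne_zero),
    partialDeriv_sum Finset.univ (F := fun a y => ((G y)⁻¹ * matDeriv i G y) a a) hH
      fun a _ => (hs a a).diffAt one_ne_zero]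
  have h1 := matDeriv_mul hH ((h.smooth_inv hz).of_le (m' := 1) (by simp))
    (((h.smooth z hz).matDeriv hH i).of_le (m' := 1) (by simp)) j
  have h2 : ∑ a, partialDeriv j (fun y => ((G y)⁻¹ * matDeriv i G y) a a) z
      = (matDeriv j (fun y => (G y)⁻¹ * matDeriv i G y) z).trace := rfl
  rw [h2, h1, h.matDeriv_inv hz, Matrix.trace_add, Matrix.neg_mul, Matrix.trace_neg]
  simp only [Matrix.mul_assoc]
  ring

/-- The derivative of the contracted Christoffel symbol is not visibly symmetric; it is a second
derivative of ½ log det G, written as traces that are symmetric under cyclic permutation. Symmetry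
of Ricci makes `𝒲` self-adjoint, hence diagonalisable. -/
theorem ricciOf_symm (h : IsMetricOn V G) (hz : z ∈ V) (i j : Fin n) :
    ricciOf (christoffelOf G) z i j = ricciOf (christoffelOf G) z j i := by
  have hH := h.subset hz
  simp only [ricciOf, Matrix.of_apply]
  rw [h.partialDeriv_sum_christoffelOf hz i j, h.partialDeriv_sum_christoffelOf hz j i]
  have h1 : ∀ l, partialDeriv l (christoffelOf G l i j) z = partialDeriv l (christoffelOf G l j i) z :=
    fun l => partialDeriv_congr hH (by
      filter_upwards [h.mem_nhds z hz] with y hy using h.christoffelOf_symm hy l i j) l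
  have h2 : matDeriv j (matDeriv i G) z = matDeriv i (matDeriv j G) z := by
    ext a b
    exact partialDeriv_comm hH ((h.smooth z hz a b).of_le (by norm_cast)) j i
  have h3 : ∑ l, ∑ m, christoffelOf G l j m z * christoffelOf G m i l z
      = ∑ l, ∑ m, christoffelOf G l i m z * christoffelOf G m j l z := by
    rw [Finset.sum_comm]
    exact Finset.sum_congr rfl fun l _ => Finset.sum_congr rfl fun m _ => mul_comm _ _
  simp only [h1, h2, h3, h.christoffelOf_symm hz _ i j]
  rw [Matrix.trace_mul_comm ((G z)⁻¹ * matDeriv i G z)]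

end IsMetricOn

end CoordinateGeometry

/-! ### Transformation of the metric and of the Christoffel symbols -/

section CoordinateChange

open Filter Topology
open scoped Matrix

variable {n : ℕ} [NeZero n]

/-- The transposed Jacobian matrix `∂_i ψ^k`. -/
def jac (ψ : EuclideanSpace ℝ (Fin n) → EuclideanSpace ℝ (Fin n)) (z : EuclideanSpace ℝ (Fin n)) :
    Matrix (Fin n) (Fin n) ℝ :=
  Matrix.of fun i k => partialDeriv i (fun y => ψ y k) z

/-- The metric `G` on `V` is the pull-back of the metric `G'` on `U` under the smooth map `ψ`. -/
structure IsCoordChange (V U : Set (EuclideanSpace ℝ (Fin n)))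
    (ψ : EuclideanSpace ℝ (Fin n) → EuclideanSpace ℝ (Fin n))
    (G G' : EuclideanSpace ℝ (Fin n) → Matrix (Fin n) (Fin n) ℝ) : Prop where
  left : IsMetricOn V G
  right : IsMetricOn U G'
  mapsTo : Set.MapsTo ψ V U
  smooth : ∀ z ∈ V, SmoothAt ∞ ψ z
  law : ∀ z ∈ V, G z = jac ψ z * G' (ψ z) * (jac ψ z)ᵀ

namespace IsCoordChange

variable {V U : Set (EuclideanSpace ℝ (Fin n))}
  {ψ : EuclideanSpace ℝ (Fin n) → EuclideanSpace ℝ (Fin n)}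
  {G G' : EuclideanSpace ℝ (Fin n) → Matrix (Fin n) (Fin n) ℝ} {z : EuclideanSpace ℝ (Fin n)}

theorem smooth_coord (h : IsCoordChange V U ψ G G') (hz : z ∈ V) (k : Fin n) :
    SmoothAt ∞ (fun y => ψ y k) z :=
  (EuclideanSpace.proj (𝕜 := ℝ) k).contDiff.contDiffAt.comp_contDiffWithinAt z (h.smooth z hz)

theorem smooth_jac (h : IsCoordChange V U ψ G G') (hz : z ∈ V) : MatSmoothAt ∞ (jac ψ) z :=
  fun i k => (h.smooth_coord hz k).partialDeriv (h.left.subset hz) (by simp) i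

theorem eventually_mem (h : IsCoordChange V U ψ G G') (hz : z ∈ V) :
    ∀ᶠ y in 𝓝[halfSpace n] z, ψ y ∈ halfSpace n := by
  filter_upwards [h.left.mem_nhds z hz] with y hy using h.right.subset (h.mapsTo hy)

theorem partialDeriv_comp (h : IsCoordChange V U ψ G G') (hz : z ∈ V)
    {f : EuclideanSpace ℝ (Fin n) → ℝ} (hf : SmoothAt 1 f (ψ z)) (i : Fin n) :
    partialDeriv i (fun y => f (ψ y)) z = ∑ j, jac ψ z i j * partialDeriv j f (ψ z) :=
  KRicci.partialDeriv_comp (h.left.subset hz) ((h.smooth z hz).diffAt (by simp))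
    (h.eventually_mem hz) (hf.diffAt one_ne_zero) i

theorem smooth_comp (h : IsCoordChange V U ψ G G') (hz : z ∈ V) {m : WithTop ℕ∞} (hm : m ≤ (∞ : WithTop ℕ∞))
    {f : EuclideanSpace ℝ (Fin n) → ℝ} (hf : SmoothAt m f (ψ z)) :
    SmoothAt m (fun y => f (ψ y)) z :=
  SmoothAt.comp hf ((h.smooth z hz).of_le hm) (h.eventually_mem hz)

theorem matDeriv_jac_comm (h : IsCoordChange V U ψ G G') (hz : z ∈ V) (i j k : Fin n) :
    matDeriv i (jac ψ) z j k = matDeriv j (jac ψ) z i k :=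
  partialDeriv_comm (h.left.subset hz) ((h.smooth_coord hz k).of_le (by norm_cast)) i j

theorem det_jac_ne_zero (h : IsCoordChange V U ψ G G') (hz : z ∈ V) : (jac ψ z).det ≠ 0 := by
  intro h0
  have := h.left.det_ne_zero hz
  rw [h.law z hz, Matrix.det_mul, Matrix.det_mul, h0] at this
  simp at this

theorem inv_law (h : IsCoordChange V U ψ G G') (hz : z ∈ V) :
    (jac ψ z)ᵀ * (G z)⁻¹ * jac ψ z = (G' (ψ z))⁻¹ := by
  have hM := (h.det_jac_ne_zero hz).isUnit
  have hMt : IsUnit (jac ψ z)ᵀ.det := by rwa [Matrix.det_transpose]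
  rw [h.law z hz, Matrix.mul_inv_rev, Matrix.mul_inv_rev, ← Matrix.mul_assoc, ← Matrix.mul_assoc,
    Matrix.mul_nonsing_inv _ hMt, Matrix.mul_assoc, Matrix.mul_assoc, Matrix.nonsing_inv_mul _ hM]
  simp

/-- The product and chain rules for the pull-back law, with the two terms in second derivatives of
`ψ` written alike so that they cancel in the Christoffel combination. -/
theorem partialDeriv_metric (h : IsCoordChange V U ψ G G') (hz : z ∈ V) (m i j : Fin n) :
    partialDeriv m (fun y => G y i j) z
      = ∑ k, ∑ l, matDeriv m (jac ψ) z i k * jac ψ z j l * G' (ψ z) k l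
      + ∑ k, ∑ l, matDeriv m (jac ψ) z j k * jac ψ z i l * G' (ψ z) k l
      + ∑ k, ∑ l, jac ψ z i k * jac ψ z j l *
        ∑ q, jac ψ z m q * partialDeriv q (fun y => G' y k l) (ψ z) := by
  have hH := h.left.subset hz
  have hM : MatSmoothAt 1 (jac ψ) z := (h.smooth_jac hz).of_le (by simp)
  have hG' : ∀ k l, SmoothAt 1 (fun y => G' (ψ y) k l) z := fun k l =>
    h.smooth_comp hz (by simp) ((h.right.smooth _ (h.mapsTo hz) k l).of_le (by simp))
  have hMM : ∀ k l, SmoothAt 1 (fun y => jac ψ y i k * jac ψ y j l) z := fun k l =>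
    (hM i k).mul (hM j l)
  rw [partialDeriv_congr (f' := fun y => ∑ k, ∑ l, jac ψ y i k * jac ψ y j l * G' (ψ y) k l) hH
    (by
      filter_upwards [h.left.mem_nhds z hz] with y hy
      rw [h.law y hy]
      simp only [Matrix.mul_apply, Matrix.transpose_apply, Finset.sum_mul]
      rw [Finset.sum_comm]
      exact Finset.sum_congr rfl fun _ _ => Finset.sum_congr rfl fun _ _ => by ring)]
  rw [partialDeriv_sum Finset.univ (F := fun k y => ∑ l, jac ψ y i k * jac ψ y j l * G' (ψ y) k l)
    hH fun k _ => DifferentiableWithinAt.fun_sum fun l _ =>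
      SmoothAt.diffAt ((hMM k l).mul (hG' k l)) one_ne_zero]
  have key : ∀ k l, partialDeriv m (fun y => jac ψ y i k * jac ψ y j l * G' (ψ y) k l) z
      = matDeriv m (jac ψ) z i k * jac ψ z j l * G' (ψ z) k l
      + matDeriv m (jac ψ) z j l * jac ψ z i k * G' (ψ z) k l
      + jac ψ z i k * jac ψ z j l *
        ∑ q, jac ψ z m q * partialDeriv q (fun y => G' y k l) (ψ z) := fun k l => by
    rw [partialDeriv_mul hH ((hMM k l).diffAt one_ne_zero) ((hG' k l).diffAt one_ne_zero),
      partialDeriv_mul hH ((hM i k).diffAt one_ne_zero) ((hM j l).diffAt one_ne_zero),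
      h.partialDeriv_comp hz ((h.right.smooth _ (h.mapsTo hz) k l).of_le (by simp))]
    simp only [matDeriv, Matrix.of_apply]
    ring
  have : ∀ k, partialDeriv m (fun y => ∑ l, jac ψ y i k * jac ψ y j l * G' (ψ y) k l) z
      = ∑ l, (matDeriv m (jac ψ) z i k * jac ψ z j l * G' (ψ z) k l
      + matDeriv m (jac ψ) z j l * jac ψ z i k * G' (ψ z) k l
      + jac ψ z i k * jac ψ z j l *
        ∑ q, jac ψ z m q * partialDeriv q (fun y => G' y k l) (ψ z)) := fun k => by
    rw [partialDeriv_sum Finset.univ (F := fun l y => jac ψ y i k * jac ψ y j l * G' (ψ y) k l)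
      hH fun l _ => SmoothAt.diffAt ((hMM k l).mul (hG' k l)) one_ne_zero]
    exact Finset.sum_congr rfl fun l _ => key k l
  simp only [this, Finset.sum_add_distrib]
  congr 2
  rw [Finset.sum_comm]
  exact Finset.sum_congr rfl fun k _ => Finset.sum_congr rfl fun l _ => by
    rw [h.right.symm (h.mapsTo hz) l k]

/-- The transformation law of the Christoffel symbols. -/
theorem christoffel_law (h : IsCoordChange V U ψ G G') (hz : z ∈ V) (i j s : Fin n) :
    ∑ l, christoffelOf G l i j z * jac ψ z l s
      = matDeriv i (jac ψ) z j s
        + ∑ k, ∑ l, jac ψ z i k * jac ψ z j l * christoffelOf G' s k l (ψ z) := by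
  set M := jac ψ z with hM
  have hz' := h.mapsTo hz
  set Γ : Fin n → Fin n → Fin n → ℝ := fun k l q =>
    (1 / 2) * (partialDeriv k (fun y => G' y q l) (ψ z) + partialDeriv l (fun y => G' y k q) (ψ z)
      - partialDeriv q (fun y => G' y k l) (ψ z)) with hΓ
  set d : Fin n → ℝ := fun k => matDeriv i (jac ψ) z j k with hd
  set e : Fin n → ℝ := fun q => ∑ k, ∑ l, M i k * M j l * Γ k l q with he
  set c : Fin n → ℝ := fun m => (1 / 2) * (partialDeriv i (fun y => G y m j) z
    + partialDeriv j (fun y => G y i m) z - partialDeriv m (fun y => G y i j) z) with hc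
  -- `c` is the Christoffel symbol of the first kind. Of its six terms in second derivatives of `ψ`,
  -- four cancel by symmetry and two coincide, which yields `d`.
  have h1 : c = M.mulVec ((G' (ψ z)).mulVec d + e) := by
    funext m
    have e1 : M.mulVec ((G' (ψ z)).mulVec d) m
        = ∑ k, ∑ l, matDeriv i (jac ψ) z j k * jac ψ z m l * G' (ψ z) k l := by
      simp only [Matrix.mulVec, dotProduct, Finset.mul_sum]
      rw [Finset.sum_comm]
      exact Finset.sum_congr rfl fun k _ => Finset.sum_congr rfl fun l _ => by
        rw [h.right.symm hz' k l]; ring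
    have e2 : M.mulVec e m = (1 / 2) * (∑ k, ∑ l, M m k * M j l *
        ∑ q, M i q * partialDeriv q (fun y => G' y k l) (ψ z)
        + ∑ k, ∑ l, M i k * M m l * ∑ q, M j q * partialDeriv q (fun y => G' y k l) (ψ z)
        - ∑ k, ∑ l, M i k * M j l * ∑ q, M m q * partialDeriv q (fun y => G' y k l) (ψ z)) := by
      have s1 : ∑ k, ∑ l, M m k * M j l *
          ∑ q, M i q * partialDeriv q (fun y => G' y k l) (ψ z)
          = ∑ q, ∑ k, ∑ l, M m q * (M i k * M j l * partialDeriv k (fun y => G' y q l) (ψ z)) := by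
        simp only [Finset.mul_sum]
        refine Finset.sum_congr rfl fun k _ => ?_
        rw [Finset.sum_comm]
        exact Finset.sum_congr rfl fun l _ => Finset.sum_congr rfl fun q _ => by ring
      have s2 : ∑ k, ∑ l, M i k * M m l *
          ∑ q, M j q * partialDeriv q (fun y => G' y k l) (ψ z)
          = ∑ q, ∑ k, ∑ l, M m q * (M i k * M j l * partialDeriv l (fun y => G' y k q) (ψ z)) := by
        simp only [Finset.mul_sum]
        rw [Finset.sum_comm]
        exact Finset.sum_congr rfl fun l _ => Finset.sum_congr rfl fun q _ =>
          Finset.sum_congr rfl fun r _ => by ring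
      have s3 : ∑ k, ∑ l, M i k * M j l *
          ∑ q, M m q * partialDeriv q (fun y => G' y k l) (ψ z)
          = ∑ q, ∑ k, ∑ l, M m q * (M i k * M j l * partialDeriv q (fun y => G' y k l) (ψ z)) := by
        simp only [Finset.mul_sum]
        rw [Finset.sum_comm' (t' := Finset.univ) (s' := fun _ => Finset.univ) (by simp)]
        rw [Finset.sum_comm]
        rw [Finset.sum_congr rfl fun k _ => Finset.sum_comm, Finset.sum_comm]
        exact Finset.sum_congr rfl fun l _ => Finset.sum_congr rfl fun q _ =>
          Finset.sum_congr rfl fun r _ => by ring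
      rw [s1, s2, s3]
      simp only [he, hΓ, Matrix.mulVec, dotProduct, Finset.mul_sum, ← Finset.sum_add_distrib,
        ← Finset.sum_sub_distrib]
      exact Finset.sum_congr rfl fun l _ => Finset.sum_congr rfl fun q _ =>
          Finset.sum_congr rfl fun r _ => by ring
    rw [Matrix.mulVec_add, Pi.add_apply, e1, e2, hc]
    simp only
    rw [h.partialDeriv_metric hz i m j, h.partialDeriv_metric hz j i m,
      h.partialDeriv_metric hz m i j]
    simp only [h.matDeriv_jac_comm hz m, h.matDeriv_jac_comm hz j i]
    ring
  have h2 : ∀ l, christoffelOf G l i j z = ((G z)⁻¹.mulVec c) l := fun l => by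
    simp only [christoffelOf, hc, Matrix.mulVec, dotProduct, Finset.mul_sum]
    exact Finset.sum_congr rfl fun m _ => by ring
  have h3 : ∑ l, christoffelOf G l i j z * M l s = (Mᵀ.mulVec ((G z)⁻¹.mulVec c)) s := by
    simp only [Matrix.mulVec, dotProduct, Matrix.transpose_apply, h2]
    exact Finset.sum_congr rfl fun m _ => by ring
  have h4 : (G' (ψ z))⁻¹ * G' (ψ z) = 1 :=
    Matrix.nonsing_inv_mul _ (h.right.det_ne_zero hz').isUnit
  -- Raising the index and applying the Jacobian gives Mᵀ G⁻¹ M, which is the inverse of `G'`; it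
  -- cancels `G'` in front of `d` and raises the index of `e`.
  rw [h3, h1, Matrix.mulVec_mulVec, Matrix.mulVec_mulVec, h.inv_law hz,
    Matrix.mulVec_add, Matrix.mulVec_mulVec, h4, Matrix.one_mulVec, Pi.add_apply]
  congr 1
  simp only [he, hΓ, christoffelOf, Matrix.mulVec, dotProduct, Finset.mul_sum]
  rw [Finset.sum_comm]
  refine Finset.sum_congr rfl fun k _ => ?_
  rw [Finset.sum_comm]
  exact Finset.sum_congr rfl fun l _ => Finset.sum_congr rfl fun q _ => by ring

end IsCoordChange

end CoordinateChange

/-! ### Covariant derivatives as tensors -/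

section Tensors

open Filter Topology
open scoped Matrix

variable {n : ℕ} [NeZero n]

/-- The covariant derivative of a covariant tensor with respect to the connection `Γ`. -/
def covDerivOf (Γ : Fin n → Fin n → Fin n → EuclideanSpace ℝ (Fin n) → ℝ) {m : ℕ}
    (T : EuclideanSpace ℝ (Fin n) → (Fin m → Fin n) → ℝ) :
    EuclideanSpace ℝ (Fin n) → (Fin (m + 1) → Fin n) → ℝ :=
  fun y J => partialDeriv (J 0) (fun z => T z (Fin.tail J)) y
    - ∑ a : Fin m, ∑ l, Γ l (J 0) (J a.succ) y * T y (Function.update (Fin.tail J) a l)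

/-- The iterated covariant derivative of a function with respect to the connection `Γ`. -/
def iterCovDerivOf (Γ : Fin n → Fin n → Fin n → EuclideanSpace ℝ (Fin n) → ℝ)
    (f : EuclideanSpace ℝ (Fin n) → ℝ) :
    (m : ℕ) → EuclideanSpace ℝ (Fin n) → (Fin m → Fin n) → ℝ
  | 0 => fun y _ => f y
  | m + 1 => covDerivOf Γ (iterCovDerivOf Γ f m)

/-- The tensor power of a matrix. -/
def tensorPow {n : ℕ} (m : ℕ) (A : Matrix (Fin n) (Fin n) ℝ) :
    Matrix (Fin m → Fin n) (Fin m → Fin n) ℝ :=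
  Matrix.of fun I J => ∏ a, A (I a) (J a)

theorem tensorPow_mul {n : ℕ} (m : ℕ) (A B : Matrix (Fin n) (Fin n) ℝ) :
    tensorPow m (A * B) = tensorPow m A * tensorPow m B := by
  ext I J
  simp only [tensorPow, Matrix.of_apply, Matrix.mul_apply, Finset.prod_univ_sum,
    Fintype.piFinset_univ, Finset.prod_mul_distrib]

theorem tensorPow_transpose {n : ℕ} (m : ℕ) (A : Matrix (Fin n) (Fin n) ℝ) :
    tensorPow m Aᵀ = (tensorPow m A)ᵀ := rfl

theorem tensorPow_one {n : ℕ} (m : ℕ) : tensorPow m (1 : Matrix (Fin n) (Fin n) ℝ) = 1 := by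
  ext I J
  by_cases h : I = J
  · subst h; simp [tensorPow]
  · obtain ⟨a, ha⟩ := Function.ne_iff.1 h
    rw [Matrix.one_apply_ne h]
    exact Finset.prod_eq_zero (Finset.mem_univ a) (Matrix.one_apply_ne ha)

/-- Exchanging the entry `J a` with the extra index is an involution; it renames the contracted
index in the connection terms. -/
theorem sum_update_swap {n m : ℕ} (a : Fin m) (F : (Fin m → Fin n) → Fin n → ℝ) :
    ∑ J, ∑ l, F J l = ∑ J : Fin m → Fin n, ∑ l, F (Function.update J a l) (J a) := by
  have hinv : Function.Involutive
      (fun p : (Fin m → Fin n) × Fin n => (Function.update p.1 a p.2, p.1 a)) := fun p => by simp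
  rw [← Fintype.sum_prod_type', ← Fintype.sum_prod_type']
  exact (Equiv.sum_comp (Function.Involutive.toPerm _ hinv)
    (fun p : (Fin m → Fin n) × Fin n => F p.1 p.2)).symm

theorem partialDeriv_prod {m : ℕ} {F : Fin m → EuclideanSpace ℝ (Fin n) → ℝ}
    {z : EuclideanSpace ℝ (Fin n)} (hz : z ∈ halfSpace n)
    (hF : ∀ a, DifferentiableWithinAt ℝ (F a) (halfSpace n) z) (i : Fin n) :
    partialDeriv i (fun y => ∏ a, F a y) z
      = ∑ a, (∏ b ∈ Finset.univ.erase a, F b z) * partialDeriv i (F a) z := by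
  have h := HasFDerivWithinAt.finsetProd (u := Finset.univ) fun a _ => (hF a).hasFDerivWithinAt
  rw [partialDeriv_def, h.fderivWithin (uniqueDiffOn_halfSpace z hz)]
  simp [partialDeriv_def]

theorem smoothAt_iterCovDerivOf {U : Set (EuclideanSpace ℝ (Fin n))}
    {G : EuclideanSpace ℝ (Fin n) → Matrix (Fin n) (Fin n) ℝ} (h : IsMetricOn U G)
    {f : EuclideanSpace ℝ (Fin n) → ℝ} {z : EuclideanSpace ℝ (Fin n)} (hz : z ∈ U) {N : ℕ}
    (hf : SmoothAt N f z) (m : ℕ) : ∀ (j : ℕ), m + j ≤ N → ∀ I,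
      SmoothAt j (fun y => iterCovDerivOf (christoffelOf G) f m y I) z := by
  induction m with
  | zero => intro j hj I; exact hf.of_le (by exact_mod_cast (by omega : j ≤ N))
  | succ m ih =>
    intro j hj I
    have h1 := ih (j + 1) (by omega)
    have h2 : ∀ J, SmoothAt j (fun y => iterCovDerivOf (christoffelOf G) f m y J) z := fun J =>
      (h1 J).of_le (by exact_mod_cast (by omega : j ≤ j + 1))
    refine ContDiffWithinAt.sub ((h1 _).partialDeriv (h.subset hz) (by push_cast; rfl) _)
      (ContDiffWithinAt.sum fun a _ => ContDiffWithinAt.sum fun l _ => ?_)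
    exact ((h.smooth_christoffelOf hz _ _ _).of_le (by exact_mod_cast le_top)).mul (h2 _)

namespace IsCoordChange

variable {V U : Set (EuclideanSpace ℝ (Fin n))}
  {ψ : EuclideanSpace ℝ (Fin n) → EuclideanSpace ℝ (Fin n)}
  {G G' : EuclideanSpace ℝ (Fin n) → Matrix (Fin n) (Fin n) ℝ} {z : EuclideanSpace ℝ (Fin n)}

/-- The covariant derivative of a tensor is a tensor. -/
theorem covDerivOf_law (h : IsCoordChange V U ψ G G') (hz : z ∈ V) {m : ℕ}
    {T T' : EuclideanSpace ℝ (Fin n) → (Fin m → Fin n) → ℝ}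
    (hT : ∀ y ∈ V, ∀ I, T y I = ∑ J, (∏ a, jac ψ y (I a) (J a)) * T' (ψ y) J)
    (hT' : ∀ J, SmoothAt 1 (fun y => T' y J) (ψ z)) (I : Fin (m + 1) → Fin n) :
    covDerivOf (christoffelOf G) T z I
      = ∑ J, (∏ a, jac ψ z (I a) (J a)) * covDerivOf (christoffelOf G') T' (ψ z) J := by
  have hH := h.left.subset hz
  have hM : ∀ i k, DifferentiableWithinAt ℝ (fun y => jac ψ y i k) (halfSpace n) z := fun i k =>
    SmoothAt.diffAt (h.smooth_jac hz i k) (by simp)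
  have hTc : ∀ J, DifferentiableWithinAt ℝ (fun y => T' (ψ y) J) (halfSpace n) z := fun J =>
    SmoothAt.diffAt (h.smooth_comp (m := 1) hz (by simp) (hT' J)) one_ne_zero
  set k := I 0
  set K : Fin m → Fin n := Fin.tail I with hK
  have hprod : ∀ J : Fin m → Fin n, DifferentiableWithinAt ℝ
      (fun y => ∏ a, jac ψ y (K a) (J a)) (halfSpace n) z := fun J =>
    (HasFDerivWithinAt.finsetProd (u := Finset.univ)
      fun a _ => (hM (K a) (J a)).hasFDerivWithinAt).differentiableWithinAt
  -- The product of Jacobian entries with the slot `a` removed, the slot where the connection or the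
  -- derivative acts.
  set P : Fin m → (Fin m → Fin n) → ℝ := fun a J =>
    ∏ b ∈ Finset.univ.erase a, jac ψ z (K b) (J b) with hP
  have hPmul : ∀ a J, ∏ b, jac ψ z (K b) (J b) = P a J * jac ψ z (K a) (J a) := fun a J => by
    rw [hP, Finset.prod_erase_mul _ _ (Finset.mem_univ a)]
  have hPupd : ∀ a J l, P a (Function.update J a l) = P a J := fun a J l =>
    Finset.prod_congr rfl fun b hb => by
      rw [Function.update_of_ne (Finset.ne_of_mem_erase hb)]
  -- the derivative of the components
  have h1 : partialDeriv k (fun y => T y K) z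
      = ∑ J, ((∑ a, P a J * matDeriv k (jac ψ) z (K a) (J a)) * T' (ψ z) J
        + (∏ b, jac ψ z (K b) (J b))
          * ∑ q, jac ψ z k q * partialDeriv q (fun y => T' y J) (ψ z)) := by
    rw [partialDeriv_congr (f' := fun y => ∑ J, (∏ a, jac ψ y (K a) (J a)) * T' (ψ y) J) hH
      (by filter_upwards [h.left.mem_nhds z hz] with y hy using hT y hy K),
      partialDeriv_sum Finset.univ (F := fun J y => (∏ a, jac ψ y (K a) (J a)) * T' (ψ y) J) hH
        fun J _ => (hprod J).fun_mul (hTc J)]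
    refine Finset.sum_congr rfl fun J _ => ?_
    rw [partialDeriv_mul hH (hprod J) (hTc J), partialDeriv_prod hH fun a => hM (K a) (J a),
      h.partialDeriv_comp hz (hT' J)]
    rfl
  -- the connection terms on the left
  have h2 : ∀ a, ∑ l, christoffelOf G l k (K a) z * T z (Function.update K a l)
      = ∑ J, P a J * (matDeriv k (jac ψ) z (K a) (J a)
        + ∑ p, ∑ r, jac ψ z k p * jac ψ z (K a) r * christoffelOf G' (J a) p r (ψ z))
          * T' (ψ z) J := fun a => by
    have e1 : ∀ l J, ∏ b, jac ψ z (Function.update K a l b) (J b) = jac ψ z l (J a) * P a J :=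
      fun l J => by
        rw [← Finset.mul_prod_erase _ _ (Finset.mem_univ a), Function.update_self]
        congr 1
        exact Finset.prod_congr rfl fun b hb => by
          rw [Function.update_of_ne (Finset.ne_of_mem_erase hb)]
    simp only [hT z hz, e1, Finset.mul_sum]
    rw [Finset.sum_comm]
    refine Finset.sum_congr rfl fun J _ => ?_
    rw [← h.christoffel_law hz, Finset.mul_sum, Finset.sum_mul]
    exact Finset.sum_congr rfl fun l _ => by ring
  -- the connection terms on the right
  have h3 : ∀ q a, ∑ J, ∑ l, (∏ b, jac ψ z (K b) (J b))
        * (christoffelOf G' l q (J a) (ψ z) * T' (ψ z) (Function.update J a l))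
      = ∑ J, ∑ l, P a J * jac ψ z (K a) l * christoffelOf G' (J a) q l (ψ z) * T' (ψ z) J :=
    fun q a => by
      rw [sum_update_swap a]
      refine Finset.sum_congr rfl fun J _ => Finset.sum_congr rfl fun l _ => ?_
      rw [hPmul a, hPupd]
      simp only [Function.update_self, Function.update_idem, Function.update_eq_self]
      ring
  have h4 : ∑ J, (∏ a, jac ψ z (I a) (J a)) * covDerivOf (christoffelOf G') T' (ψ z) J
      = ∑ q, ∑ J : Fin m → Fin n, jac ψ z k q * (∏ b, jac ψ z (K b) (J b))
          * (partialDeriv q (fun y => T' y J) (ψ z) - ∑ a, ∑ l,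
            christoffelOf G' l q (J a) (ψ z) * T' (ψ z) (Function.update J a l)) := by
    rw [← Equiv.sum_comp (Fin.consEquiv fun _ : Fin (m + 1) => Fin n), Fintype.sum_prod_type]
    refine Finset.sum_congr rfl fun q _ => Finset.sum_congr rfl fun J _ => ?_
    simp only [Fin.consEquiv_apply, Fin.prod_univ_succ, Fin.cons_zero, Fin.cons_succ, covDerivOf]
    rfl
  have h5 : ∑ q, ∑ J : Fin m → Fin n, jac ψ z k q * (∏ b, jac ψ z (K b) (J b))
          * ∑ a, ∑ l, christoffelOf G' l q (J a) (ψ z) * T' (ψ z) (Function.update J a l)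
      = ∑ a, ∑ J, P a J *
        (∑ p, ∑ r, jac ψ z k p * jac ψ z (K a) r * christoffelOf G' (J a) p r (ψ z))
          * T' (ψ z) J := by
    have e : ∀ q, ∑ J : Fin m → Fin n, jac ψ z k q * (∏ b, jac ψ z (K b) (J b))
          * ∑ a, ∑ l, christoffelOf G' l q (J a) (ψ z) * T' (ψ z) (Function.update J a l)
        = ∑ a, ∑ J, ∑ l, jac ψ z k q *
          (P a J * jac ψ z (K a) l * christoffelOf G' (J a) q l (ψ z) * T' (ψ z) J) := fun q => by
      simp only [← Finset.mul_sum, ← h3]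
      rw [Finset.sum_comm]
      simp only [Finset.mul_sum]
      exact Finset.sum_congr rfl fun l _ => Finset.sum_congr rfl fun q _ =>
          Finset.sum_congr rfl fun r _ => by ring
    simp only [e]
    rw [Finset.sum_comm]
    refine Finset.sum_congr rfl fun a _ => ?_
    rw [Finset.sum_comm]
    refine Finset.sum_congr rfl fun J _ => ?_
    simp only [Finset.mul_sum, Finset.sum_mul]
    exact Finset.sum_congr rfl fun l _ => Finset.sum_congr rfl fun q _ => by ring
  rw [h4]
  simp only [mul_sub, Finset.sum_sub_distrib]
  rw [h5]
  change partialDeriv k (fun y => T y K) z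
    - ∑ a, ∑ l, christoffelOf G l k (K a) z * T z (Function.update K a l) = _
  -- The second derivatives of `ψ` in `h1` are exactly the inhomogeneous terms of the Christoffel
  -- law in `h2`, so they cancel.
  simp only [h1, h2, mul_add, add_mul, Finset.sum_add_distrib]
  have h6 : ∑ J, (∑ a, P a J * matDeriv k (jac ψ) z (K a) (J a)) * T' (ψ z) J
      = ∑ a, ∑ J, P a J * matDeriv k (jac ψ) z (K a) (J a) * T' (ψ z) J := by
    simp only [Finset.sum_mul]
    rw [Finset.sum_comm]
  have h7 : ∑ J, (∏ b, jac ψ z (K b) (J b))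
          * ∑ q, jac ψ z k q * partialDeriv q (fun y => T' y J) (ψ z)
      = ∑ q, ∑ J : Fin m → Fin n, jac ψ z k q * (∏ b, jac ψ z (K b) (J b))
          * partialDeriv q (fun y => T' y J) (ψ z) := by
    simp only [Finset.mul_sum]
    rw [Finset.sum_comm]
    exact Finset.sum_congr rfl fun l _ => Finset.sum_congr rfl fun q _ => by ring
  rw [h6, h7]
  ring

theorem iterCovDerivOf_law (h : IsCoordChange V U ψ G G')
    {f f' : EuclideanSpace ℝ (Fin n) → ℝ} (hf : ∀ y ∈ V, f y = f' (ψ y)) (m : ℕ)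
    (hf' : ∀ y ∈ U, SmoothAt m f' y) :
    ∀ z ∈ V, iterCovDerivOf (christoffelOf G) f m z
      = tensorPow m (jac ψ z) *ᵥ iterCovDerivOf (christoffelOf G') f' m (ψ z) := by
  induction m with
  | zero =>
    intro z hz
    funext I
    simp [iterCovDerivOf, hf z hz, tensorPow, Matrix.mulVec, dotProduct]
  | succ m ih =>
    intro z hz
    funext I
    refine h.covDerivOf_law hz (fun y hy I => ?_) (fun J => ?_) I
    · exact congrFun (ih (fun y hy => (hf' y hy).of_le (by exact_mod_cast Nat.le_succ m)) y hy) I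
    · exact smoothAt_iterCovDerivOf h.right (h.mapsTo hz) (hf' _ (h.mapsTo hz)) m 1 le_rfl J

end IsCoordChange

end Tensors

/-! ### The Ricci tensor as a tensor, by gauge covariance of the curvature -/

section Curvature

open Filter Topology
open scoped Matrix

variable {n : ℕ} [NeZero n]

/-- The connection matrices `(Γ_i)_{jl} = Γ^l_{ij}` of a metric. -/
def connMat (G : EuclideanSpace ℝ (Fin n) → Matrix (Fin n) (Fin n) ℝ) (i : Fin n)
    (z : EuclideanSpace ℝ (Fin n)) : Matrix (Fin n) (Fin n) ℝ :=
  Matrix.of fun j l => christoffelOf G l i j z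

/-- The curvature of a family of connection matrices. -/
def curvMat (A : Fin n → EuclideanSpace ℝ (Fin n) → Matrix (Fin n) (Fin n) ℝ) (l j : Fin n)
    (z : EuclideanSpace ℝ (Fin n)) : Matrix (Fin n) (Fin n) ℝ :=
  matDeriv l (A j) z - matDeriv j (A l) z + (A j z * A l z - A l z * A j z)

/-- The pull-back of the connection matrices under `ψ`. -/
def pullConn (ψ : EuclideanSpace ℝ (Fin n) → EuclideanSpace ℝ (Fin n))
    (G' : EuclideanSpace ℝ (Fin n) → Matrix (Fin n) (Fin n) ℝ) (i : Fin n)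
    (z : EuclideanSpace ℝ (Fin n)) : Matrix (Fin n) (Fin n) ℝ :=
  ∑ k, jac ψ z i k • connMat G' k (ψ z)

/-- Seeing Ricci as a contraction of the curvature of matrix-valued connection forms replaces the
index computation of its transformation law by matrix algebra. -/
theorem IsMetricOn.ricciOf_eq_sum_curvMat {V : Set (EuclideanSpace ℝ (Fin n))}
    {G : EuclideanSpace ℝ (Fin n) → Matrix (Fin n) (Fin n) ℝ} {z : EuclideanSpace ℝ (Fin n)}
    (h : IsMetricOn V G) (hz : z ∈ V) (i j : Fin n) :
    ricciOf (christoffelOf G) z i j = ∑ l, curvMat (connMat G) l j z i l := by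
  have hs : ∀ a l i j, partialDeriv a (christoffelOf G l i j) z
      = partialDeriv a (christoffelOf G l j i) z := fun a l i j =>
    partialDeriv_congr (h.subset hz) (by
      filter_upwards [h.mem_nhds z hz] with y hy using h.christoffelOf_symm hy l i j) a
  have hc := fun l i j => h.christoffelOf_symm hz l i j
  simp only [ricciOf, curvMat, connMat, matDeriv, Matrix.of_apply, Matrix.add_apply,
    Matrix.sub_apply, Matrix.mul_apply, Finset.sum_add_distrib, Finset.sum_sub_distrib]
  have e1 : ∑ l, partialDeriv l (christoffelOf G l i j) z
      = ∑ l, partialDeriv l (fun y => christoffelOf G l j i y) z :=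
    Finset.sum_congr rfl fun l _ => hs l l i j
  have e2 : ∑ l, partialDeriv j (christoffelOf G l i l) z
      = ∑ l, partialDeriv j (fun y => christoffelOf G l l i y) z :=
    Finset.sum_congr rfl fun l _ => hs j l i l
  have e3 : ∑ l, ∑ m, christoffelOf G l l m z * christoffelOf G m i j z
      = ∑ l, ∑ m, christoffelOf G m j i z * christoffelOf G l l m z :=
    Finset.sum_congr rfl fun l _ => Finset.sum_congr rfl fun m _ => by rw [hc m i j, mul_comm]
  have e4 : ∑ l, ∑ m, christoffelOf G l j m z * christoffelOf G m i l z
      = ∑ l, ∑ m, christoffelOf G m l i z * christoffelOf G l j m z :=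
    Finset.sum_congr rfl fun l _ => Finset.sum_congr rfl fun m _ => by rw [hc m i l, mul_comm]
  rw [e1, e2, e3, e4]
  ring

namespace IsCoordChange

variable {V U : Set (EuclideanSpace ℝ (Fin n))}
  {ψ : EuclideanSpace ℝ (Fin n) → EuclideanSpace ℝ (Fin n)}
  {G G' : EuclideanSpace ℝ (Fin n) → Matrix (Fin n) (Fin n) ℝ} {z : EuclideanSpace ℝ (Fin n)}

/-- The connection matrices transform by a gauge transformation. -/
theorem connMat_mul_jac (h : IsCoordChange V U ψ G G') (hz : z ∈ V) (i : Fin n) :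
    connMat G i z * jac ψ z = matDeriv i (jac ψ) z + jac ψ z * pullConn ψ G' i z := by
  ext j s
  rw [Matrix.mul_apply, Matrix.add_apply]
  refine (h.christoffel_law hz i j s).trans ?_
  congr 1
  simp only [Matrix.mul_apply, pullConn, connMat, Matrix.sum_apply, Matrix.smul_apply,
    Matrix.of_apply, smul_eq_mul, Finset.mul_sum]
  rw [Finset.sum_comm]
  exact Finset.sum_congr rfl fun l _ => Finset.sum_congr rfl fun q _ => by ring

theorem smooth_connMat_comp (h : IsCoordChange V U ψ G G') (hz : z ∈ V) (k : Fin n) :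
    MatSmoothAt ∞ (fun y => connMat G' k (ψ y)) z := fun j l =>
  h.smooth_comp hz le_rfl (h.right.smooth_christoffelOf (h.mapsTo hz) l k j)

theorem smooth_pullConn (h : IsCoordChange V U ψ G G') (hz : z ∈ V) (i : Fin n) :
    MatSmoothAt ∞ (pullConn ψ G' i) z := fun j l => by
  simp only [pullConn, Matrix.sum_apply, Matrix.smul_apply, smul_eq_mul]
  exact ContDiffWithinAt.sum fun k _ => (h.smooth_jac hz i k).mul (h.smooth_connMat_comp hz k j l)

theorem matDeriv_connMat_mul_jac (h : IsCoordChange V U ψ G G') (hz : z ∈ V) (l j : Fin n) :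
    matDeriv l (connMat G j) z * jac ψ z
      = matDeriv l (matDeriv j (jac ψ)) z + matDeriv l (jac ψ) z * pullConn ψ G' j z
        + jac ψ z * matDeriv l (pullConn ψ G' j) z - connMat G j z * matDeriv l (jac ψ) z := by
  have hH := h.left.subset hz
  have s1 : MatSmoothAt 1 (jac ψ) z := (h.smooth_jac hz).of_le (by simp)
  have s2 : MatSmoothAt 1 (connMat G j) z := fun a b =>
    (h.left.smooth_christoffelOf hz b j a).of_le (by simp)
  have s3 : MatSmoothAt 1 (pullConn ψ G' j) z := (h.smooth_pullConn hz j).of_le (by simp)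
  have s4 : MatSmoothAt 1 (matDeriv j (jac ψ)) z :=
    ((h.smooth_jac hz).matDeriv hH j).of_le (by simp)
  have e := matDeriv_congr (A := fun y => connMat G j y * jac ψ y)
    (B := fun y => matDeriv j (jac ψ) y + jac ψ y * pullConn ψ G' j y) hH
    (by filter_upwards [h.left.mem_nhds z hz] with y hy using h.connMat_mul_jac hy j) l
  rw [matDeriv_mul hH s2 s1, matDeriv_add hH s4 (s1.mul s3), matDeriv_mul hH s1 s3] at e
  rw [eq_sub_iff_add_eq, e]
  abel

/-- Differentiate the gauge relation and antisymmetrise: second derivatives of the Jacobian drop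
out, and its first derivatives are eliminated with the gauge relation itself. -/
theorem curvMat_mul_jac (h : IsCoordChange V U ψ G G') (hz : z ∈ V) (l j : Fin n) :
    curvMat (connMat G) l j z * jac ψ z = jac ψ z * curvMat (pullConn ψ G') l j z := by
  have hH := h.left.subset hz
  have e1 := h.matDeriv_connMat_mul_jac hz l j
  have e2 := h.matDeriv_connMat_mul_jac hz j l
  have e3 : matDeriv j (matDeriv l (jac ψ)) z = matDeriv l (matDeriv j (jac ψ)) z := by
    ext a b
    exact partialDeriv_comm hH ((h.smooth_jac hz a b).of_le (by norm_cast)) j l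
  have d : ∀ i, matDeriv i (jac ψ) z = connMat G i z * jac ψ z - jac ψ z * pullConn ψ G' i z :=
    fun i => by rw [h.connMat_mul_jac hz i]; abel
  rw [e3] at e2
  simp only [curvMat, add_mul, sub_mul]
  rw [e1, e2, d l, d j]
  noncomm_ring

/-- Curvature commutes with pull-back: the second derivatives of `ψ` are symmetric in `l`, `j` and
disappear in the antisymmetrisation. -/
theorem curvMat_pullConn (h : IsCoordChange V U ψ G G') (hz : z ∈ V) (l j : Fin n) :
    curvMat (pullConn ψ G') l j z
      = ∑ q, ∑ k, (jac ψ z l q * jac ψ z j k) • curvMat (connMat G') q k (ψ z) := by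
  have hH := h.left.subset hz
  have d : ∀ l j, matDeriv l (pullConn ψ G' j) z
      = ∑ k, matDeriv l (jac ψ) z j k • connMat G' k (ψ z)
        + ∑ q, ∑ k, (jac ψ z l q * jac ψ z j k) • matDeriv q (connMat G' k) (ψ z) := fun l j => by
    have := matDeriv_sum_smul Finset.univ hH (c := fun k y => jac ψ y j k)
      (F := fun k y => connMat G' k (ψ y)) (fun k => (h.smooth_jac hz j k).of_le (by simp))
      (fun k => (h.smooth_connMat_comp hz k).of_le (by simp)) l
    change matDeriv l (fun y => ∑ k, jac ψ y j k • connMat G' k (ψ y)) z = _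
    rw [this, Finset.sum_add_distrib]
    congr 1
    rw [Finset.sum_comm]
    refine Finset.sum_congr rfl fun k _ => ?_
    ext a b
    simp only [Matrix.smul_apply, Matrix.sum_apply, smul_eq_mul]
    have := h.partialDeriv_comp hz
      ((h.right.smooth_christoffelOf (h.mapsTo hz) b k a).of_le (by simp)) l
    change jac ψ z j k * partialDeriv l (fun y => christoffelOf G' b k a (ψ y)) z = _
    rw [this, Finset.mul_sum]
    exact Finset.sum_congr rfl fun q _ => by
      simp only [matDeriv, connMat, Matrix.of_apply]
      ring
  have p : ∀ l j, pullConn ψ G' l z * pullConn ψ G' j z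
      = ∑ q, ∑ k, (jac ψ z l q * jac ψ z j k) • (connMat G' q (ψ z) * connMat G' k (ψ z)) :=
    fun l j => by
      simp only [pullConn, Finset.sum_mul, Finset.mul_sum, Matrix.smul_mul, Matrix.mul_smul,
        smul_smul]
      rw [Finset.sum_comm]
      exact Finset.sum_congr rfl fun _ _ => Finset.sum_congr rfl fun _ _ => by rw [mul_comm]
  have c : ∀ F : Fin n → Fin n → Matrix (Fin n) (Fin n) ℝ,
      ∑ q, ∑ k, (jac ψ z j q * jac ψ z l k) • F q k
        = ∑ q, ∑ k, (jac ψ z l q * jac ψ z j k) • F k q := fun F => by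
    rw [Finset.sum_comm]
    exact Finset.sum_congr rfl fun _ _ => Finset.sum_congr rfl fun _ _ => by rw [mul_comm]
  have s : ∑ k, matDeriv j (jac ψ) z l k • connMat G' k (ψ z)
      = ∑ k, matDeriv l (jac ψ) z j k • connMat G' k (ψ z) :=
    Finset.sum_congr rfl fun k _ => by rw [h.matDeriv_jac_comm hz]
  simp only [curvMat]
  rw [d l j, d j l, p j l, p l j, s, c, c]
  simp only [smul_add, smul_sub, Finset.sum_add_distrib, Finset.sum_sub_distrib]
  abel

/-- The Ricci tensor is a tensor. -/
theorem ricci_law (h : IsCoordChange V U ψ G G') (hz : z ∈ V) :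
    ricciOf (christoffelOf G) z
      = jac ψ z * ricciOf (christoffelOf G') (ψ z) * (jac ψ z)ᵀ := by
  set M := jac ψ z with hM
  have hu := (h.det_jac_ne_zero hz).isUnit
  have h1 : ∀ l j, curvMat (connMat G) l j z
      = ∑ q, ∑ k, (M l q * M j k) • (M * curvMat (connMat G') q k (ψ z) * M⁻¹) := fun l j => by
    have : curvMat (connMat G) l j z = M * curvMat (pullConn ψ G') l j z * M⁻¹ := by
      rw [← h.curvMat_mul_jac hz, Matrix.mul_assoc, Matrix.mul_nonsing_inv _ hu, mul_one]
    rw [this, h.curvMat_pullConn hz]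
    simp only [Finset.mul_sum, Finset.sum_mul, Matrix.smul_mul, Matrix.mul_smul]
    rfl
  have h2 : ∀ s q, ∑ l, M⁻¹ s l * M l q = if s = q then 1 else 0 := fun s q => by
    have := congrFun (congrFun (Matrix.nonsing_inv_mul _ hu) s) q
    rwa [Matrix.mul_apply, Matrix.one_apply] at this
  ext i j
  rw [h.left.ricciOf_eq_sum_curvMat hz]
  simp only [h1, Matrix.sum_apply, Matrix.smul_apply, smul_eq_mul]
  -- The contraction over `l` pairs the `M⁻¹` of the gauge transformation with the `M` from the form
  -- index, so one factor of each disappears.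
  have h3 : ∀ q k, ∑ l, M l q * M j k * (M * curvMat (connMat G') q k (ψ z) * M⁻¹) i l
      = M j k * (M * curvMat (connMat G') q k (ψ z)) i q := fun q k => by
    have : ∀ l, M l q * M j k * (M * curvMat (connMat G') q k (ψ z) * M⁻¹) i l
        = ∑ s, M j k * (M * curvMat (connMat G') q k (ψ z)) i s * (M⁻¹ s l * M l q) := fun l => by
      rw [Matrix.mul_apply, Finset.mul_sum]
      exact Finset.sum_congr rfl fun _ _ => by ring
    simp only [this]
    rw [Finset.sum_comm]
    simp only [← Finset.mul_sum, h2]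
    simp
  rw [Finset.sum_comm]
  rw [Finset.sum_congr rfl fun q _ => Finset.sum_comm]
  simp only [h3]
  simp only [Matrix.mul_apply, Matrix.transpose_apply, h.right.ricciOf_eq_sum_curvMat (h.mapsTo hz),
    Finset.mul_sum, Finset.sum_mul]
  rw [Finset.sum_comm]
  refine Finset.sum_congr rfl fun k _ => ?_
  rw [Finset.sum_comm]
  exact Finset.sum_congr rfl fun _ _ => Finset.sum_congr rfl fun _ _ => by ring

end IsCoordChange

end Curvature

/-! ### The operator 𝒲 in coordinates and its invariance -/

section CoordinateOperator

open Filter Topology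
open scoped Matrix

variable {n : ℕ} [NeZero n]

theorem sum_fin_one_fun {n : ℕ} (F : (Fin 1 → Fin n) → ℝ) : ∑ J, F J = ∑ p, F ![p] := by
  rw [← Equiv.sum_comp (Equiv.funUnique (Fin 1) (Fin n)).symm]
  refine Finset.sum_congr rfl fun p _ => congrArg F ?_
  funext a; fin_cases a; rfl

theorem sum_fin_two_fun {n : ℕ} (F : (Fin 2 → Fin n) → ℝ) : ∑ J, F J = ∑ p, ∑ q, F ![p, q] := by
  rw [← Equiv.sum_comp (finTwoArrowEquiv (Fin n)).symm, Fintype.sum_prod_type]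
  rfl

section Components

variable (Γ : Fin n → Fin n → Fin n → EuclideanSpace ℝ (Fin n) → ℝ)
  (f : EuclideanSpace ℝ (Fin n) → ℝ) (z : EuclideanSpace ℝ (Fin n))

theorem iterCovDerivOf_one (I : Fin 1 → Fin n) :
    iterCovDerivOf Γ f 1 z I = partialDeriv (I 0) f z := by
  simp only [iterCovDerivOf, covDerivOf, Finset.univ_eq_empty, Finset.sum_empty, sub_zero]

theorem iterCovDerivOf_two (I : Fin 2 → Fin n) :
    iterCovDerivOf Γ f 2 z I = partialDeriv (I 0) (partialDeriv (I 1) f) z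
      - ∑ l, Γ l (I 0) (I 1) z * partialDeriv l f z := by
  rw [iterCovDerivOf, covDerivOf]
  simp only [iterCovDerivOf_one, Fin.sum_univ_one, Function.update_self]
  rfl

theorem iterCovDerivOf_three (I : Fin 3 → Fin n) :
    iterCovDerivOf Γ f 3 z I
      = partialDeriv (I 0) (fun y => partialDeriv (I 1) (partialDeriv (I 2) f) y
          - ∑ l, Γ l (I 1) (I 2) y * partialDeriv l f y) z
        - ∑ a : Fin 2, ∑ l, Γ l (I 0) (I a.succ) z
          * iterCovDerivOf Γ f 2 z (Function.update (Fin.tail I) a l) := by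
  rw [iterCovDerivOf, covDerivOf]
  congr 2
  funext y
  exact iterCovDerivOf_two Γ f y _

end Components

/-- The squared norm of the `m`-th covariant derivative. -/
def normSqOf (G : EuclideanSpace ℝ (Fin n) → Matrix (Fin n) (Fin n) ℝ) (m : ℕ)
    (f : EuclideanSpace ℝ (Fin n) → ℝ) (z : EuclideanSpace ℝ (Fin n)) : ℝ :=
  iterCovDerivOf (christoffelOf G) f m z ⬝ᵥ
    (tensorPow m (G z)⁻¹ *ᵥ iterCovDerivOf (christoffelOf G) f m z)

/-- The Hessian in coordinates. -/
def hessOf (G : EuclideanSpace ℝ (Fin n) → Matrix (Fin n) (Fin n) ℝ)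
    (f : EuclideanSpace ℝ (Fin n) → ℝ) (z : EuclideanSpace ℝ (Fin n)) :
    Matrix (Fin n) (Fin n) ℝ :=
  Matrix.of fun i j => iterCovDerivOf (christoffelOf G) f 2 z ![i, j]

/-- The differential in coordinates. -/
def gradOf (f : EuclideanSpace ℝ (Fin n) → ℝ) (z : EuclideanSpace ℝ (Fin n)) : Fin n → ℝ :=
  fun i => partialDeriv i f z

/-- The covariant two-tensor `∇²f - df ⊗ df + (Δf / (n - 2) + |∇f|²) g - Ric / (n - 2)`. -/
def tensorOf (G : EuclideanSpace ℝ (Fin n) → Matrix (Fin n) (Fin n) ℝ)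
    (f : EuclideanSpace ℝ (Fin n) → ℝ) (z : EuclideanSpace ℝ (Fin n)) :
    Matrix (Fin n) (Fin n) ℝ :=
  hessOf G f z - Matrix.vecMulVec (gradOf f z) (gradOf f z)
    + ((∑ i, ∑ j, (G z)⁻¹ i j * hessOf G f z i j) / ((n : ℝ) - 2) + normSqOf G 1 f z) • G z
    - ((n : ℝ) - 2)⁻¹ • ricciOf (christoffelOf G) z

/-- The coefficients of order zero of the endomorphism `𝒲`. -/
def coeffZero (G : EuclideanSpace ℝ (Fin n) → Matrix (Fin n) (Fin n) ℝ) (i j : Fin n)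
    (y : EuclideanSpace ℝ (Fin n)) : ℝ :=
  -(((n : ℝ) - 2)⁻¹ * ∑ l, (G y)⁻¹ i l * ricciOf (christoffelOf G) y l j)

/-- The coefficients of order one of the endomorphism `𝒲`. -/
def coeffOne (G : EuclideanSpace ℝ (Fin n) → Matrix (Fin n) (Fin n) ℝ) (i j p : Fin n)
    (y : EuclideanSpace ℝ (Fin n)) : ℝ :=
  -(∑ l, (G y)⁻¹ i l * christoffelOf G p l j y)
    - (if i = j then 1 else 0) *
      (((n : ℝ) - 2)⁻¹ * ∑ l, ∑ m, (G y)⁻¹ l m * christoffelOf G p l m y)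

/-- The quadratic gradient coefficients of the endomorphism `𝒲`. -/
def coeffTwo (G : EuclideanSpace ℝ (Fin n) → Matrix (Fin n) (Fin n) ℝ) (i j p q : Fin n)
    (y : EuclideanSpace ℝ (Fin n)) : ℝ :=
  -((G y)⁻¹ i p * (if q = j then 1 else 0)) + (if i = j then 1 else 0) * (G y)⁻¹ p q

theorem normSqOf_one (G : EuclideanSpace ℝ (Fin n) → Matrix (Fin n) (Fin n) ℝ)
    (f : EuclideanSpace ℝ (Fin n) → ℝ) (z : EuclideanSpace ℝ (Fin n)) :
    normSqOf G 1 f z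
      = ∑ p, ∑ q, (G z)⁻¹ p q * (partialDeriv p f z * partialDeriv q f z) := by
  simp only [normSqOf, dotProduct, Matrix.mulVec, sum_fin_one_fun, iterCovDerivOf_one, tensorPow,
    Matrix.of_apply, Fin.prod_univ_one, Matrix.cons_val_zero, Finset.mul_sum]
  exact Finset.sum_congr rfl fun _ _ => Finset.sum_congr rfl fun _ _ => by ring

namespace IsMetricOn

variable {V : Set (EuclideanSpace ℝ (Fin n))}
  {G : EuclideanSpace ℝ (Fin n) → Matrix (Fin n) (Fin n) ℝ} {z : EuclideanSpace ℝ (Fin n)}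
  {f : EuclideanSpace ℝ (Fin n) → ℝ}

theorem hessOf_symm (h : IsMetricOn V G) (hz : z ∈ V) (hf : SmoothAt 2 f z) (i j : Fin n) :
    hessOf G f z i j = hessOf G f z j i := by
  simp only [hessOf, Matrix.of_apply, iterCovDerivOf_two, Matrix.cons_val_zero, Matrix.cons_val_one]
  rw [partialDeriv_comm (h.subset hz) hf]
  simp only [h.christoffelOf_symm hz _ i j]

theorem tensorOf_symm (h : IsMetricOn V G) (hz : z ∈ V) (hf : SmoothAt 2 f z) :
    (tensorOf G f z)ᵀ = tensorOf G f z := by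
  ext i j
  simp only [tensorOf, Matrix.transpose_apply, Matrix.add_apply, Matrix.sub_apply,
    Matrix.smul_apply, Matrix.vecMulVec_apply, smul_eq_mul]
  rw [h.hessOf_symm hz hf j i, h.symm hz j i, h.ricciOf_symm hz j i,
    mul_comm (gradOf f z j)]

/-- Splits off the second partial derivatives. The Christoffel terms of the Hessian and of the
Laplacian form the first-order coefficients, the curvature forms the zeroth-order ones. -/
theorem inv_mul_tensorOf (h : IsMetricOn V G) (hz : z ∈ V) :
    (G z)⁻¹ * tensorOf G f z
      = principalPart (G z)⁻¹ (Matrix.of fun i j => partialDeriv i (partialDeriv j f) z)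
        + Matrix.of fun i j =>
          lowerOrder (coeffZero G) (coeffOne G) (coeffTwo G) f i j z := by
  have h1 : (G z)⁻¹ * G z = 1 := Matrix.nonsing_inv_mul _ (h.det_ne_zero hz).isUnit
  rw [tensorOf, Matrix.mul_sub, Matrix.mul_add, Matrix.mul_sub, Matrix.mul_smul, h1,
    Matrix.mul_smul]
  set ζ : Matrix (Fin n) (Fin n) ℝ := Matrix.of fun i j => partialDeriv i (partialDeriv j f) z
    with hζ
  set d : Fin n → ℝ := fun p => partialDeriv p f z with hd
  have hH : ∀ i j, hessOf G f z i j = ζ i j - ∑ p, christoffelOf G p i j z * d p := fun i j => by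
    simp only [hessOf, Matrix.of_apply, iterCovDerivOf_two, Matrix.cons_val_zero,
      Matrix.cons_val_one, hζ, hd]
  have e0 : ∀ i j, ((G z)⁻¹ * hessOf G f z) i j = ((G z)⁻¹ * ζ) i j
      - ∑ p, (∑ l, (G z)⁻¹ i l * christoffelOf G p l j z) * d p := fun i j => by
    simp only [Matrix.mul_apply, hH, mul_sub, Finset.sum_sub_distrib, Finset.mul_sum,
      Finset.sum_mul]
    congr 1
    rw [Finset.sum_comm]
    exact Finset.sum_congr rfl fun _ _ => Finset.sum_congr rfl fun _ _ => by ring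
  have e1 : ∑ i, ∑ j, (G z)⁻¹ i j * hessOf G f z i j = ((G z)⁻¹ * ζ).trace
      - ∑ p, (∑ l, ∑ m, (G z)⁻¹ l m * christoffelOf G p l m z) * d p := by
    simp only [hH, mul_sub, Finset.sum_sub_distrib, Finset.mul_sum, Finset.sum_mul]
    congr 1
    · simp only [Matrix.trace, Matrix.diag, Matrix.mul_apply]
      rw [Finset.sum_comm]
      exact Finset.sum_congr rfl fun i _ => Finset.sum_congr rfl fun j _ => by
        rw [h.inv_symm hz]
    · rw [Finset.sum_congr rfl fun q _ => Finset.sum_comm, Finset.sum_comm]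
      exact Finset.sum_congr rfl fun _ _ => Finset.sum_congr rfl fun _ _ =>
        Finset.sum_congr rfl fun _ _ => by ring
  have e2 : ∀ i j, ((G z)⁻¹ * Matrix.vecMulVec (gradOf f z) (gradOf f z)) i j
      = ∑ p, ∑ q, (G z)⁻¹ i p * (if q = j then 1 else 0) * (d p * d q) := fun i j => by
    simp [Matrix.mul_apply, Matrix.vecMulVec_apply, gradOf, hd]
  ext i j
  simp only [Matrix.add_apply, Matrix.sub_apply, Matrix.smul_apply, smul_eq_mul, principalPart,
    Matrix.of_apply, Matrix.one_apply, e0, e1, e2, normSqOf_one, lowerOrder, coeffZero, coeffOne,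
    coeffTwo]
  simp only [add_mul, sub_mul, neg_mul, Finset.sum_add_distrib, Finset.sum_sub_distrib,
    Finset.sum_neg_distrib]
  rw [show ∑ p, (if i = j then (1 : ℝ) else 0) * (((n : ℝ) - 2)⁻¹ *
      ∑ l, ∑ m, (G z)⁻¹ l m * christoffelOf G p l m z) * partialDeriv p f z
      = (if i = j then (1 : ℝ) else 0) * (((n : ℝ) - 2)⁻¹ *
      ∑ p, (∑ l, ∑ m, (G z)⁻¹ l m * christoffelOf G p l m z) * partialDeriv p f z) by
    simp only [Finset.mul_sum, Finset.sum_mul]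
    exact Finset.sum_congr rfl fun _ _ => Finset.sum_congr rfl fun _ _ =>
      Finset.sum_congr rfl fun _ _ => by ring]
  rw [show ∑ p, ∑ q, (if i = j then (1 : ℝ) else 0) * (G z)⁻¹ p q
        * (partialDeriv p f z * partialDeriv q f z)
      = (if i = j then (1 : ℝ) else 0) * ∑ p, ∑ q, (G z)⁻¹ p q
        * (partialDeriv p f z * partialDeriv q f z) by
    simp only [Finset.mul_sum]
    exact Finset.sum_congr rfl fun _ _ => Finset.sum_congr rfl fun _ _ => by ring]
  simp only [hd, Matrix.mul_apply]
  ring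

theorem smooth_coeffZero (h : IsMetricOn V G) (hz : z ∈ V) (i j : Fin n) :
    SmoothAt ∞ (coeffZero G i j) z :=
  (contDiffWithinAt_const.mul (ContDiffWithinAt.sum fun l _ =>
    (h.smooth_inv hz i l).mul (h.smooth_ricciOf hz l j))).neg

theorem smooth_coeffOne (h : IsMetricOn V G) (hz : z ∈ V) (i j p : Fin n) :
    SmoothAt ∞ (coeffOne G i j p) z :=
  (ContDiffWithinAt.neg (ContDiffWithinAt.sum fun l _ =>
    (h.smooth_inv hz i l).mul (h.smooth_christoffelOf hz p l j))).sub
  (contDiffWithinAt_const.mul (contDiffWithinAt_const.mul (ContDiffWithinAt.sum fun l _ =>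
    ContDiffWithinAt.sum fun m _ =>
      (h.smooth_inv hz l m).mul (h.smooth_christoffelOf hz p l m))))

theorem smooth_coeffTwo (h : IsMetricOn V G) (hz : z ∈ V) (i j p q : Fin n) :
    SmoothAt ∞ (coeffTwo G i j p q) z :=
  ((h.smooth_inv hz i p).mul contDiffWithinAt_const).neg.add
    (contDiffWithinAt_const.mul (h.smooth_inv hz p q))

end IsMetricOn

namespace IsCoordChange

variable {V U : Set (EuclideanSpace ℝ (Fin n))}
  {ψ : EuclideanSpace ℝ (Fin n) → EuclideanSpace ℝ (Fin n)}
  {G G' : EuclideanSpace ℝ (Fin n) → Matrix (Fin n) (Fin n) ℝ} {z : EuclideanSpace ℝ (Fin n)}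
  {f f' : EuclideanSpace ℝ (Fin n) → ℝ}

/-- Tensor powers are multiplicative, so the Jacobian factors combine with the inverse metric by
`inv_law` in all slots at once. -/
theorem normSqOf_eq (h : IsCoordChange V U ψ G G') (hz : z ∈ V) (hf : ∀ y ∈ V, f y = f' (ψ y))
    (m : ℕ) (hf' : ∀ y ∈ U, SmoothAt m f' y) : normSqOf G m f z = normSqOf G' m f' (ψ z) := by
  rw [normSqOf, normSqOf, h.iterCovDerivOf_law hf m hf' z hz, Matrix.mulVec_mulVec,
    Matrix.dotProduct_mulVec, ← Matrix.vecMul_transpose, Matrix.vecMul_vecMul,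
    ← Matrix.dotProduct_mulVec, ← tensorPow_transpose, ← tensorPow_mul, ← tensorPow_mul,
    ← Matrix.mul_assoc, h.inv_law hz]

theorem hessOf_law (h : IsCoordChange V U ψ G G') (hz : z ∈ V) (hf : ∀ y ∈ V, f y = f' (ψ y))
    (hf' : ∀ y ∈ U, SmoothAt 2 f' y) :
    hessOf G f z = jac ψ z * hessOf G' f' (ψ z) * (jac ψ z)ᵀ := by
  ext i j
  simp only [hessOf, Matrix.of_apply]
  rw [h.iterCovDerivOf_law hf 2 hf' z hz]
  simp only [Matrix.mulVec, dotProduct, sum_fin_two_fun, tensorPow, Matrix.of_apply,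
    Fin.prod_univ_two, Matrix.cons_val_zero, Matrix.cons_val_one, Matrix.mul_apply,
    Matrix.transpose_apply, Finset.sum_mul]
  rw [Finset.sum_comm]
  exact Finset.sum_congr rfl fun _ _ => Finset.sum_congr rfl fun _ _ => by ring

theorem gradOf_law (h : IsCoordChange V U ψ G G') (hz : z ∈ V) (hf : ∀ y ∈ V, f y = f' (ψ y))
    (hf' : ∀ y ∈ U, SmoothAt 2 f' y) : gradOf f z = jac ψ z *ᵥ gradOf f' (ψ z) := by
  funext i
  rw [gradOf, partialDeriv_congr (h.left.subset hz) (f' := fun y => f' (ψ y))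
    (by filter_upwards [h.left.mem_nhds z hz] with y hy using hf y hy),
    h.partialDeriv_comp hz ((hf' _ (h.mapsTo hz)).of_le (by norm_num))]
  rfl

theorem tensorOf_law (h : IsCoordChange V U ψ G G') (hz : z ∈ V) (hf : ∀ y ∈ V, f y = f' (ψ y))
    (hf' : ∀ y ∈ U, SmoothAt 2 f' y) :
    tensorOf G f z = jac ψ z * tensorOf G' f' (ψ z) * (jac ψ z)ᵀ := by
  have hlap : ∑ i, ∑ j, (G z)⁻¹ i j * hessOf G f z i j
      = ∑ i, ∑ j, (G' (ψ z))⁻¹ i j * hessOf G' f' (ψ z) i j := by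
    have e : ∀ A B : Matrix (Fin n) (Fin n) ℝ, ∑ i, ∑ j, A i j * B i j = (A * Bᵀ).trace :=
      fun A B => by simp [Matrix.trace, Matrix.mul_apply]
    rw [e, e, h.hessOf_law hz hf hf', ← h.inv_law hz]
    simp only [Matrix.transpose_mul, Matrix.transpose_transpose]
    rw [← Matrix.mul_assoc, ← Matrix.mul_assoc, Matrix.trace_mul_comm, ← Matrix.mul_assoc,
      ← Matrix.mul_assoc]
  simp only [tensorOf]
  rw [hlap, h.normSqOf_eq hz hf 1 fun y hy => (hf' y hy).of_le (by norm_num),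
    h.hessOf_law hz hf hf', h.gradOf_law hz hf hf', h.law z hz, h.ricci_law hz,
    ← Matrix.mul_vecMulVec, ← Matrix.vecMul_transpose, ← Matrix.vecMulVec_mul]
  simp only [Matrix.mul_sub, Matrix.mul_add, Matrix.sub_mul, Matrix.add_mul, Matrix.mul_smul,
    Matrix.smul_mul, Matrix.mul_assoc]

/-- The matrices of one endomorphism in two coordinate systems are conjugate under the transposed
`jac ψ z`. -/
theorem eigenvalues_smul_inv_mul_tensorOf (h : IsCoordChange V U ψ G G') (hz : z ∈ V)
    (hf : ∀ y ∈ V, f y = f' (ψ y)) (hf' : ∀ y ∈ U, SmoothAt 2 f' y) (c : ℝ) :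
    eigenvalues (c • ((G z)⁻¹ * tensorOf G f z))
      = eigenvalues (c • ((G' (ψ z))⁻¹ * tensorOf G' f' (ψ z))) := by
  have hu : IsUnit (jac ψ z)ᵀ.det := by
    rw [Matrix.det_transpose]; exact (h.det_jac_ne_zero hz).isUnit
  have h1 : c • ((G z)⁻¹ * tensorOf G f z)
      = ((jac ψ z)ᵀ)⁻¹ * (c • ((G' (ψ z))⁻¹ * tensorOf G' f' (ψ z))) * (jac ψ z)ᵀ := by
    rw [← h.inv_law hz, h.tensorOf_law hz hf hf', Matrix.mul_smul, Matrix.smul_mul]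
    congr 1
    simp only [← Matrix.mul_assoc]
    rw [Matrix.nonsing_inv_mul _ hu, Matrix.one_mul]
  obtain ⟨u, hu'⟩ := (Matrix.isUnit_iff_isUnit_det _).2 hu
  rw [eigenvalues, eigenvalues, h1, ← hu', Matrix.charpoly_units_conj']

end IsCoordChange

theorem sigma_smul_inv_mul {n : ℕ} {G S : Matrix (Fin n) (Fin n) ℝ} (hG : G.PosDef) (hS : Sᵀ = S)
    (c : ℝ) (j : ℕ) : sigma j (c • (G⁻¹ * S)) = c ^ j * sigma j (G⁻¹ * S) := by
  obtain ⟨P, Q, l, hPQ, hQP, -, -, hD⟩ := exists_simultaneous_diagonalization hG hS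
  have h1 : eigenvalues (c • (G⁻¹ * S)) = vals (fun i => c * l i) := by
    refine eigenvalues_of_diagonalized hPQ ?_
    rw [Matrix.mul_smul, Matrix.smul_mul, hD]
    ext a b
    by_cases hab : a = b <;> simp [hab]
  rw [sigma, sigma, h1, eigenvalues_of_diagonalized hPQ hD]
  simp only [vals, Finset.esymm_map_val, Finset.mul_sum]
  refine Finset.sum_congr rfl fun t ht => ?_
  rw [Finset.prod_mul_distrib, Finset.prod_const, (Finset.mem_powersetCard.1 ht).2]

end CoordinateOperator

/-! ### Charts of the manifold: metric components and transition maps -/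

section Charts

open Filter Topology Bundle
open scoped Matrix

variable {n : ℕ} [NeZero n] {M : Type*} [TopologicalSpace M]
  [ChartedSpace (EuclideanHalfSpace n) M] [IsManifold (𝓡∂ n) ∞ M]

/-- The coordinate frame of the chart around `x₀`, at a point of `M`. -/
def frame (x₀ p : M) (ξ : EuclideanSpace ℝ (Fin n)) : TangentSpace (𝓡∂ n) p :=
  tangentCoordChange (𝓡∂ n) x₀ p p ξ

/-- Tangent vectors at `p` are represented in the preferred chart at `p`, so a coordinate vector of
the chart around `x₀` is a tangent coordinate change. In this form it is indexed by points of `M`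
and can be treated as a section of the tangent bundle. -/
theorem coordVec_eq_frame (x₀ : M) {p : M} (hp : p ∈ (extChartAt (𝓡∂ n) x₀).source) (i : Fin n) :
    mfderivWithin 𝓘(ℝ, EuclideanSpace ℝ (Fin n)) (𝓡∂ n) (extChartAt (𝓡∂ n) x₀).symm
      (Set.range (𝓡∂ n)) (extChartAt (𝓡∂ n) x₀ p)
      (EuclideanSpace.single i (1 : ℝ) : EuclideanSpace ℝ (Fin n))
      = frame x₀ p (EuclideanSpace.single i 1) := by
  rw [extChartAt_source] at hp
  rw [← TangentBundle.symmL_trivializationAt hp, TangentBundle.symmL_trivializationAt_eq_core hp]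
  rfl

theorem gram_eq (g : Metric n M) (x₀ : M) {z : EuclideanSpace ℝ (Fin n)}
    (hz : z ∈ (extChartAt (𝓡∂ n) x₀).target) (i j : Fin n) :
    gram g x₀ z i j = g.inner ((extChartAt (𝓡∂ n) x₀).symm z)
      (frame x₀ ((extChartAt (𝓡∂ n) x₀).symm z) (EuclideanSpace.single i 1))
      (frame x₀ ((extChartAt (𝓡∂ n) x₀).symm z) (EuclideanSpace.single j 1)) := by
  have h := fun i => coordVec_eq_frame x₀ ((extChartAt (𝓡∂ n) x₀).map_target hz) i
  rw [(extChartAt (𝓡∂ n) x₀).right_inv hz] at h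
  rw [← h i, ← h j]
  rfl

theorem frame_injective (x₀ : M) {p : M} (hp : p ∈ (extChartAt (𝓡∂ n) x₀).source) :
    Function.Injective (frame (n := n) x₀ p) := by
  have hpp := mem_extChartAt_source (I := 𝓡∂ n) p
  intro ξ η h
  have e : ∀ ξ, tangentCoordChange (𝓡∂ n) p x₀ p (frame x₀ p ξ) = ξ := fun ξ => by
    rw [frame, tangentCoordChange_comp ⟨⟨hp, hpp⟩, hp⟩, tangentCoordChange_self hp]
  rw [← e ξ, h, e η]

theorem gram_quadratic (g : Metric n M) (x₀ : M) {z : EuclideanSpace ℝ (Fin n)}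
    (hz : z ∈ (extChartAt (𝓡∂ n) x₀).target) (ξ : Fin n → ℝ) :
    ξ ⬝ᵥ (gram g x₀ z *ᵥ ξ) = g.inner ((extChartAt (𝓡∂ n) x₀).symm z)
      (frame x₀ ((extChartAt (𝓡∂ n) x₀).symm z) (WithLp.toLp 2 ξ))
      (frame x₀ ((extChartAt (𝓡∂ n) x₀).symm z) (WithLp.toLp 2 ξ)) := by
  have e : (WithLp.toLp 2 ξ : EuclideanSpace ℝ (Fin n))
      = ∑ i, ξ i • EuclideanSpace.single i (1 : ℝ) := by
    ext j; simp [Pi.single_apply]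
  set p := (extChartAt (𝓡∂ n) x₀).symm z
  have e2 : frame x₀ p (WithLp.toLp 2 ξ) = ∑ i, ξ i • frame x₀ p (EuclideanSpace.single i 1) := by
    rw [e, frame, map_sum]
    exact Finset.sum_congr rfl fun i _ => map_smul _ _ _
  rw [e2]
  simp only [map_sum, map_smul, sum_apply, smul_apply,
    smul_eq_mul, dotProduct, Matrix.mulVec, gram_eq g x₀ hz, Finset.mul_sum]
  rw [Finset.sum_comm]
  exact Finset.sum_congr rfl fun _ _ => Finset.sum_congr rfl fun _ _ => by ring

theorem gram_posDef (g : Metric n M) (x₀ : M) {z : EuclideanSpace ℝ (Fin n)}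
    (hz : z ∈ (extChartAt (𝓡∂ n) x₀).target) : (gram g x₀ z).PosDef := by
  refine Matrix.PosDef.of_dotProduct_mulVec_pos ?_ fun ξ hξ => ?_
  · ext i j
    simp only [Matrix.conjTranspose_apply, star_trivial, gram_eq g x₀ hz]
    exact g.symm _ _ _
  · rw [star_trivial, gram_quadratic g x₀ hz]
    refine g.pos _ _ fun h0 => hξ ?_
    have h1 : frame x₀ ((extChartAt (𝓡∂ n) x₀).symm z)
        (0 : EuclideanSpace ℝ (Fin n)) = 0 := by
      rw [frame, map_zero]
      rfl
    have := frame_injective x₀ ((extChartAt (𝓡∂ n) x₀).map_target hz) (h0.trans h1.symm)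
    exact (WithLp.toLp_eq_zero 2).1 this

/-- The frame is the inverse of the local trivialisation applied to a constant vector, hence a
smooth section, and the metric is a smooth bilinear form on the bundle. -/
theorem contMDiffAt_inner_frame (g : Metric n M) (x₀ : M) {p : M}
    (hp : p ∈ (extChartAt (𝓡∂ n) x₀).source) (ξ η : EuclideanSpace ℝ (Fin n)) :
    ContMDiffAt (𝓡∂ n) 𝓘(ℝ) ∞ (fun q => g.inner q (frame x₀ q ξ) (frame x₀ q η)) p := by
  rw [extChartAt_source] at hp
  set e := trivializationAt (EuclideanSpace ℝ (Fin n)) (TangentSpace (𝓡∂ n) : M → Type _) x₀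
  have hs : ∀ ξ : EuclideanSpace ℝ (Fin n), ContMDiffAt (𝓡∂ n)
      ((𝓡∂ n).prod 𝓘(ℝ, EuclideanSpace ℝ (Fin n))) ∞
      (fun q => TotalSpace.mk' (EuclideanSpace ℝ (Fin n)) q (e.symmL ℝ q ξ)) p := fun ξ => by
    have hc : ContMDiffAt (𝓡∂ n) ((𝓡∂ n).prod 𝓘(ℝ, EuclideanSpace ℝ (Fin n))) ∞
        (fun q => TotalSpace.mk' (EuclideanSpace ℝ (Fin n)) (E := Bundle.Trivial M _) q ξ) p := by
      rw [contMDiffAt_section]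
      exact contMDiffAt_const
    exact ContMDiffAt.clm_bundle_apply (E₁ := Bundle.Trivial M (EuclideanSpace ℝ (Fin n)))
      (e.contMDiffAt_symmL (n := ∞) hp) hc
  have h := ContMDiffAt.clm_bundle_apply₂ (E₃ := Bundle.Trivial M ℝ) (F₃ := ℝ)
    (g.contMDiff p) (hs ξ) (hs η)
  rw [contMDiffAt_section] at h
  refine ContMDiffAt.congr_of_eventuallyEq h ?_
  filter_upwards [(chartAt (EuclideanHalfSpace n) x₀).open_source.mem_nhds hp] with q hq
  simp only [e, TangentBundle.symmL_trivializationAt_eq_core hq]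
  rfl

theorem smoothAt_of_contMDiffAt {f : M → ℝ} {m : WithTop ℕ∞} (hm : m ≤ (∞ : WithTop ℕ∞)) (x₀ : M)
    {z : EuclideanSpace ℝ (Fin n)} (hz : z ∈ (extChartAt (𝓡∂ n) x₀).target)
    (hf : ContMDiffAt (𝓡∂ n) 𝓘(ℝ) m f ((extChartAt (𝓡∂ n) x₀).symm z)) :
    SmoothAt m (fun y => f ((extChartAt (𝓡∂ n) x₀).symm y)) z := by
  have h1 : ContMDiffWithinAt 𝓘(ℝ, EuclideanSpace ℝ (Fin n)) (𝓡∂ n) m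
      (extChartAt (𝓡∂ n) x₀).symm (Set.range (𝓡∂ n)) z :=
    (contMDiffWithinAt_extChartAt_symm_range (n := ∞) x₀ hz).of_le hm
  exact (ContMDiffAt.comp_contMDiffWithinAt z hf h1).contDiffWithinAt

theorem isMetricOn_gram (g : Metric n M) (x₀ : M) :
    IsMetricOn (extChartAt (𝓡∂ n) x₀).target (gram g x₀) where
  subset := extChartAt_target_subset_range x₀
  mem_nhds z hz := extChartAt_target_mem_nhdsWithin_of_mem hz
  smooth z hz i j := by
    have := smoothAt_of_contMDiffAt le_rfl x₀ hz (contMDiffAt_inner_frame g x₀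
      ((extChartAt (𝓡∂ n) x₀).map_target hz) (EuclideanSpace.single i 1)
      (EuclideanSpace.single j 1))
    refine ContDiffWithinAt.congr_of_eventuallyEq this ?_ (gram_eq g x₀ hz i j)
    filter_upwards [extChartAt_target_mem_nhdsWithin_of_mem hz] with y hy using gram_eq g x₀ hy i j
  posDef z hz := gram_posDef g x₀ hz

/-- The domain of the change of coordinates from the chart around `y` to the chart around `x`. -/
def overlap (x y : M) : Set (EuclideanSpace ℝ (Fin n)) :=
  (extChartAt (𝓡∂ n) y).target ∩
    (extChartAt (𝓡∂ n) y).symm ⁻¹' (extChartAt (𝓡∂ n) x).source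

theorem overlap_mem_nhds (x y : M) {z : EuclideanSpace ℝ (Fin n)} (hz : z ∈ overlap x y) :
    overlap x y ∈ 𝓝[halfSpace n] z := by
  refine inter_mem (extChartAt_target_mem_nhdsWithin_of_mem hz.1) ?_
  have := extChartAt_preimage_mem_nhdsWithin' (I := 𝓡∂ n) (s := Set.univ)
    ((extChartAt (𝓡∂ n) y).map_target hz.1)
    (by
      rw [nhdsWithin_univ]
      exact extChartAt_source_mem_nhds' (I := 𝓡∂ n) hz.2)
  rwa [Set.preimage_univ, Set.univ_inter, (extChartAt (𝓡∂ n) y).right_inv hz.1] at this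

theorem frame_change (x y : M) {z : EuclideanSpace ℝ (Fin n)} (hz : z ∈ overlap x y) (i : Fin n)
    (hψ : DifferentiableWithinAt ℝ (extChartAt (𝓡∂ n) x ∘ (extChartAt (𝓡∂ n) y).symm)
      (halfSpace n) z) :
    frame y ((extChartAt (𝓡∂ n) y).symm z) (EuclideanSpace.single i 1)
      = ∑ k, jac (extChartAt (𝓡∂ n) x ∘ (extChartAt (𝓡∂ n) y).symm) z i k •
        frame x ((extChartAt (𝓡∂ n) y).symm z) (EuclideanSpace.single k 1) := by
  set p := (extChartAt (𝓡∂ n) y).symm z with hp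
  have hpy : p ∈ (extChartAt (𝓡∂ n) y).source := (extChartAt (𝓡∂ n) y).map_target hz.1
  have hpx : p ∈ (extChartAt (𝓡∂ n) x).source := hz.2
  have hpp := mem_extChartAt_source (I := 𝓡∂ n) p
  have h1 : frame y p (EuclideanSpace.single i 1)
      = frame x p (tangentCoordChange (𝓡∂ n) y x p (EuclideanSpace.single i 1)) := by
    rw [frame, frame, tangentCoordChange_comp ⟨⟨hpy, hpx⟩, hpp⟩]
  have h2 : tangentCoordChange (𝓡∂ n) y x p (EuclideanSpace.single i 1)
      = ∑ k, jac (extChartAt (𝓡∂ n) x ∘ (extChartAt (𝓡∂ n) y).symm) z i k •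
        EuclideanSpace.single k (1 : ℝ) := by
    rw [tangentCoordChange_def, hp, (extChartAt (𝓡∂ n) y).right_inv hz.1]
    ext k
    have h5 : HasFDerivWithinAt
        (fun w => (extChartAt (𝓡∂ n) x ∘ (extChartAt (𝓡∂ n) y).symm) w k)
        ((EuclideanSpace.proj (𝕜 := ℝ) k).comp (fderivWithin ℝ
          (extChartAt (𝓡∂ n) x ∘ (extChartAt (𝓡∂ n) y).symm) (halfSpace n) z)) (halfSpace n) z :=
      (EuclideanSpace.proj (𝕜 := ℝ) k).hasFDerivAt.comp_hasFDerivWithinAt z hψ.hasFDerivWithinAt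
    have h6 : jac (extChartAt (𝓡∂ n) x ∘ (extChartAt (𝓡∂ n) y).symm) z i k
        = fderivWithin ℝ (extChartAt (𝓡∂ n) x ∘ (extChartAt (𝓡∂ n) y).symm) (halfSpace n) z
          (EuclideanSpace.single i 1) k := by
      rw [jac, Matrix.of_apply, partialDeriv_def,
        h5.fderivWithin (uniqueDiffOn_halfSpace z (extChartAt_target_subset_range y hz.1))]
      rfl
    rw [← h6]
    simp [Pi.single_apply]
  rw [h1, h2, frame, map_sum]
  exact Finset.sum_congr rfl fun i _ => map_smul _ _ _

/-- Links the manifold to the coordinate computations: the frames of two charts differ by the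
Jacobian of the transition map, so the components of `g` obey the pull-back law. -/
theorem isCoordChange_gram (g : Metric n M) (x y : M) :
    IsCoordChange (overlap x y) (extChartAt (𝓡∂ n) x).target
      (extChartAt (𝓡∂ n) x ∘ (extChartAt (𝓡∂ n) y).symm) (gram g y) (gram g x) := by
  have hm := isMetricOn_gram g y
  have hs : ∀ z ∈ overlap x y, SmoothAt ∞
      (extChartAt (𝓡∂ n) x ∘ (extChartAt (𝓡∂ n) y).symm) z := fun z hz => by
    refine contDiffWithinAt_ext_coord_change (I := 𝓡∂ n) x y ?_
    rw [PartialEquiv.trans_source]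
    exact ⟨hz.1, hz.2⟩
  refine ⟨⟨fun z hz => hm.subset hz.1, fun z hz => overlap_mem_nhds x y hz,
    fun z hz => hm.smooth z hz.1, fun z hz => hm.posDef z hz.1⟩, isMetricOn_gram g x,
    fun z hz => (extChartAt (𝓡∂ n) x).map_source hz.2, hs, fun z hz => ?_⟩
  ext i j
  have hx : (extChartAt (𝓡∂ n) x ∘ (extChartAt (𝓡∂ n) y).symm) z ∈ (extChartAt (𝓡∂ n) x).target :=
    (extChartAt (𝓡∂ n) x).map_source hz.2
  have hinv : (extChartAt (𝓡∂ n) x).symm ((extChartAt (𝓡∂ n) x ∘ (extChartAt (𝓡∂ n) y).symm) z)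
      = (extChartAt (𝓡∂ n) y).symm z := (extChartAt (𝓡∂ n) x).left_inv hz.2
  have hd := (hs z hz).diffAt (by simp)
  have hG : ∀ k l, gram g x ((extChartAt (𝓡∂ n) x ∘ (extChartAt (𝓡∂ n) y).symm) z) k l
      = g.inner ((extChartAt (𝓡∂ n) y).symm z)
        (frame x ((extChartAt (𝓡∂ n) y).symm z) (EuclideanSpace.single k 1))
        (frame x ((extChartAt (𝓡∂ n) y).symm z) (EuclideanSpace.single l 1)) := fun k l => by
    rw [gram_eq g x hx, hinv]
  rw [gram_eq g y hz.1, frame_change x y hz i hd, frame_change x y hz j hd]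
  simp only [map_sum, map_smul, sum_apply, smul_apply,
    smul_eq_mul, Matrix.mul_apply, Matrix.transpose_apply, hG, Finset.mul_sum, Finset.sum_mul]
  exact Finset.sum_congr rfl fun _ _ => Finset.sum_congr rfl fun _ _ => by ring

end Charts

/-! ### Norms of covariant tensors against their components -/

section TensorNorms

open scoped Matrix

/-- With the columns of `P` as an orthonormal frame, the norm is the Euclidean norm of the
components in that frame. -/
theorem tensorPow_gram_eq_sum_sq {n : ℕ} {A P : Matrix (Fin n) (Fin n) ℝ} (hP : P * Pᵀ = A) (m : ℕ)
    (T : (Fin m → Fin n) → ℝ) :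
    T ⬝ᵥ (tensorPow m A *ᵥ T) = ∑ K, ((tensorPow m Pᵀ *ᵥ T) K) ^ 2 := by
  rw [← hP, tensorPow_mul, ← Matrix.mulVec_mulVec, Matrix.dotProduct_mulVec,
    ← Matrix.mulVec_transpose, ← tensorPow_transpose]
  simp only [dotProduct, sq]

theorem tensorPow_inv_nonneg {n : ℕ} {G : Matrix (Fin n) (Fin n) ℝ} (hG : G.PosDef) (m : ℕ)
    (T : (Fin m → Fin n) → ℝ) : 0 ≤ T ⬝ᵥ (tensorPow m G⁻¹ *ᵥ T) := by
  obtain ⟨P, Q, -, -, -, hP, -, -⟩ :=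
    exists_simultaneous_diagonalization hG (S := 0) Matrix.transpose_zero
  rw [tensorPow_gram_eq_sum_sq hP]
  positivity

/-- Components are recovered from those in an orthonormal frame through `Qᵀ`. The columns of `Q`
have squared length `G j j ≤ L`, so its entries are at most `L`; a sum of `n ^ m` products of `m`
entries gives the constant. -/
theorem abs_component_le {n : ℕ} {G : Matrix (Fin n) (Fin n) ℝ} (hG : G.PosDef) {L : ℝ}
    (hL : 1 ≤ L) (hGL : ∀ i, |G i i| ≤ L) (m : ℕ) (T : (Fin m → Fin n) → ℝ) (I : Fin m → Fin n) :
    |T I| ≤ (n : ℝ) ^ m * L ^ m * √(T ⬝ᵥ (tensorPow m G⁻¹ *ᵥ T)) := by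
  obtain ⟨P, Q, -, hPQ, -, hP, hQ, -⟩ :=
    exists_simultaneous_diagonalization hG (S := 0) Matrix.transpose_zero
  have hQL : ∀ i j, |Q i j| ≤ L := fun i j => by
    refine abs_le_of_sq_le_sq (le_trans ?_ (by nlinarith : L ≤ L ^ 2)) (by linarith)
    have h1 : G j j = ∑ k, Q k j ^ 2 := by
      rw [← hQ]; simp [Matrix.mul_apply, sq]
    refine le_trans ?_ ((le_abs_self _).trans (hGL j))
    rw [h1]
    exact Finset.single_le_sum (f := fun k => Q k j ^ 2) (fun _ _ => sq_nonneg _)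
      (Finset.mem_univ i)
  rw [tensorPow_gram_eq_sum_sq hP]
  set S := tensorPow m Pᵀ *ᵥ T with hS
  have hT : T = tensorPow m Qᵀ *ᵥ S := by
    rw [hS, Matrix.mulVec_mulVec, ← tensorPow_mul, ← Matrix.transpose_mul, hPQ,
      Matrix.transpose_one, tensorPow_one, Matrix.one_mulVec]
  have hSK : ∀ K, |S K| ≤ √(∑ K, S K ^ 2) := fun K => by
    rw [← Real.sqrt_sq_eq_abs]
    exact Real.sqrt_le_sqrt (Finset.single_le_sum (f := fun K => S K ^ 2)
      (fun _ _ => sq_nonneg _) (Finset.mem_univ K))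
  have hcard : (Finset.univ : Finset (Fin m → Fin n)).card = n ^ m := by simp
  conv_lhs => rw [hT]
  refine (abs_sum_le_of_le (g := fun _ => L ^ m * √(∑ K, S K ^ 2)) _ fun K _ => ?_).trans ?_
  · rw [abs_mul]
    refine mul_le_mul ?_ (hSK K) (abs_nonneg _) (by positivity)
    change |∏ a, Q (K a) (I a)| ≤ _
    rw [Finset.abs_prod]
    refine (Finset.prod_le_prod (fun _ _ => abs_nonneg _)
      (fun a _ => hQL (K a) (I a))).trans_eq ?_
    simp
  · rw [Finset.sum_const, hcard, nsmul_eq_mul]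
    push_cast
    rw [mul_assoc]

theorem tensorPow_two_le {n : ℕ} {A : Matrix (Fin n) (Fin n) ℝ} {L B : ℝ} (hL : 0 ≤ L)
    (hA : ∀ i j, |A i j| ≤ L) {T : (Fin 2 → Fin n) → ℝ} (hT : ∀ I, |T I| ≤ B) :
    T ⬝ᵥ (tensorPow 2 A *ᵥ T) ≤ ((n : ℝ) ^ 2 * L * B) ^ 2 := by
  rcases Nat.eq_zero_or_pos n with h0 | h0
  · subst h0; simp [dotProduct]
  have hB : 0 ≤ B := (abs_nonneg _).trans (hT fun _ => ⟨0, h0⟩)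
  have hcard : (Finset.univ : Finset (Fin 2 → Fin n)).card = n ^ 2 := by simp
  have h1 : ∀ I, |(tensorPow 2 A *ᵥ T) I| ≤ (n : ℝ) ^ 2 * (L ^ 2 * B) := fun I => by
    refine (abs_sum_le_of_le (g := fun _ => L ^ 2 * B) _ fun K _ => ?_).trans_eq ?_
    · rw [abs_mul]
      refine mul_le_mul ?_ (hT K) (abs_nonneg _) (by positivity)
      change |∏ a, A (I a) (K a)| ≤ _
      rw [Fin.prod_univ_two, abs_mul, sq]
      exact mul_le_mul (hA _ _) (hA _ _) (abs_nonneg _) hL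
    · rw [Finset.sum_const, hcard, nsmul_eq_mul]; push_cast; rfl
  refine (le_abs_self _).trans
    ((abs_sum_le_of_le (g := fun _ => B * ((n : ℝ) ^ 2 * (L ^ 2 * B))) _ fun I _ => ?_).trans_eq ?_)
  · rw [abs_mul]
    exact mul_le_mul (hT I) (h1 I) (abs_nonneg _) hB
  · rw [Finset.sum_const, hcard, nsmul_eq_mul]; push_cast; ring

end TensorNorms

/-! ### Independence of the chart -/

section ChartInvariance

open Filter Topology
open scoped Matrix

variable {n : ℕ} [NeZero n] {M : Type*} [TopologicalSpace M]
  [ChartedSpace (EuclideanHalfSpace n) M] [IsManifold (𝓡∂ n) ∞ M]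

/-- The expression of a function in the chart around `y`. -/
def inChart (f : M → ℝ) (y : M) (z : EuclideanSpace ℝ (Fin n)) : ℝ :=
  f ((extChartAt (𝓡∂ n) y).symm z)

theorem iterCovDeriv_eq (g : Metric n M) (f : M → ℝ) (x₀ : M) (m : ℕ) :
    iterCovDeriv g f x₀ m = iterCovDerivOf (christoffelOf (gram g x₀)) (inChart f x₀) m := by
  induction m with
  | zero => rfl
  | succ m ih =>
    rw [iterCovDeriv, iterCovDerivOf, ih]
    rfl

theorem nablaNorm_eq (g : Metric n M) (m : ℕ) (f : M → ℝ) (x : M) :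
    nablaNorm g m f x = √(normSqOf (gram g x) m (inChart f x) (extChartAt (𝓡∂ n) x x)) := by
  rw [nablaNorm, normSqOf]
  congr 1
  simp only [nablaAt, iterCovDeriv_eq, gramAt, dotProduct, Matrix.mulVec, tensorPow,
    Matrix.of_apply, Finset.mul_sum]
  exact Finset.sum_congr rfl fun _ _ => Finset.sum_congr rfl fun _ _ => by ring

theorem mem_overlap {x y : M} (hx : x ∈ (extChartAt (𝓡∂ n) y).source) :
    extChartAt (𝓡∂ n) y x ∈ overlap x y := by
  refine ⟨(extChartAt (𝓡∂ n) y).map_source hx, ?_⟩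
  rw [Set.mem_preimage, (extChartAt (𝓡∂ n) y).left_inv hx]
  exact mem_extChartAt_source x

theorem transition_apply {x y : M} (hx : x ∈ (extChartAt (𝓡∂ n) y).source) :
    (extChartAt (𝓡∂ n) x ∘ (extChartAt (𝓡∂ n) y).symm) (extChartAt (𝓡∂ n) y x)
      = extChartAt (𝓡∂ n) x x := by
  rw [Function.comp_apply, (extChartAt (𝓡∂ n) y).left_inv hx]

theorem inChart_transition (f : M → ℝ) (x y : M) :
    ∀ z ∈ overlap x y, inChart f y z
      = inChart f x ((extChartAt (𝓡∂ n) x ∘ (extChartAt (𝓡∂ n) y).symm) z) := fun z hz => by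
  rw [inChart, inChart, Function.comp_apply, (extChartAt (𝓡∂ n) x).left_inv hz.2]

theorem smoothAt_inChart {f : M → ℝ} {m : WithTop ℕ∞} (hm : m ≤ (∞ : WithTop ℕ∞))
    (hf : ContMDiff (𝓡∂ n) 𝓘(ℝ) m f) (y : M) :
    ∀ z ∈ (extChartAt (𝓡∂ n) y).target, SmoothAt m (inChart f y) z := fun _ hz =>
  smoothAt_of_contMDiffAt hm y hz (hf _)

/-- The left side uses a chart that varies with `x`. The right side uses one chart for all nearby
points, as coordinate estimates require. -/
theorem nablaNorm_eq_chart (g : Metric n M) {m : ℕ} {f : M → ℝ}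
    (hf : ContMDiff (𝓡∂ n) 𝓘(ℝ) m f) {x y : M} (hx : x ∈ (extChartAt (𝓡∂ n) y).source) :
    nablaNorm g m f x = √(normSqOf (gram g y) m (inChart f y) (extChartAt (𝓡∂ n) y x)) := by
  rw [nablaNorm_eq, (isCoordChange_gram g x y).normSqOf_eq (mem_overlap hx)
    (inChart_transition f x y) m (smoothAt_inChart (by exact_mod_cast le_top) hf x),
    transition_apply hx]

theorem W_eq (g : Metric n M) (v : M → ℝ) (x : M) :
    W g v x = (gram g x (extChartAt (𝓡∂ n) x x))⁻¹
      * tensorOf (gram g x) (inChart v x) (extChartAt (𝓡∂ n) x x) := by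
  have h1 : nablaNorm g 1 v x ^ 2
      = normSqOf (gram g x) 1 (inChart v x) (extChartAt (𝓡∂ n) x x) := by
    rw [nablaNorm_eq]
    exact Real.sq_sqrt (tensorPow_inv_nonneg (gram_posDef g x (mem_extChartAt_target x)) 1 _)
  have h2 : hessAt g v x = hessOf (gram g x) (inChart v x) (extChartAt (𝓡∂ n) x x) := by
    ext i j
    simp only [hessAt, hessOf, nablaAt, iterCovDeriv_eq]
  have h3 : diffAt g v x = gradOf (inChart v x) (extChartAt (𝓡∂ n) x x) := by
    funext i
    simp only [diffAt, nablaAt, iterCovDeriv_eq, iterCovDerivOf_one, gradOf]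
    rfl
  rw [W, h1, laplacian, h2, h3]
  rfl

theorem eigenvalues_smul_W (g : Metric n M) {v : M → ℝ} (hv : ContMDiff (𝓡∂ n) 𝓘(ℝ) 2 v)
    {x y : M} (hx : x ∈ (extChartAt (𝓡∂ n) y).source) (c : ℝ) :
    eigenvalues (c • W g v x) = eigenvalues (c • ((gram g y (extChartAt (𝓡∂ n) y x))⁻¹
      * tensorOf (gram g y) (inChart v y) (extChartAt (𝓡∂ n) y x))) := by
  rw [W_eq, (isCoordChange_gram g x y).eigenvalues_smul_inv_mul_tensorOf (mem_overlap hx)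
    (inChart_transition v x y) (smoothAt_inChart (by norm_cast) hv x),
    transition_apply hx]

/-- Being a boundary point can be tested in any chart of the atlas. There it says that the chart
target is not a full neighbourhood, and since the target is relatively open in the half-space this
means z_0 = 0. -/
theorem isBoundaryPoint_iff_chart {x y : M} (hx : x ∈ (extChartAt (𝓡∂ n) y).source) :
    x ∈ (𝓡∂ n).boundary M ↔ extChartAt (𝓡∂ n) y x 0 = 0 := by
  rw [extChartAt_source] at hx
  have h1 : x ∈ (𝓡∂ n).boundary M ↔ (𝓡∂ n).IsBoundaryPoint x := Iff.rfl
  rw [h1, (𝓡∂ n).isBoundaryPoint_iff_of_mem_atlas (n := 1) one_ne_zero (chart_mem_atlas _ y) hx]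
  set z := extChartAt (𝓡∂ n) y x with hz
  have hzt : z ∈ (extChartAt (𝓡∂ n) y).target :=
    (extChartAt (𝓡∂ n) y).map_source (by rwa [extChartAt_source])
  have hzH : z ∈ halfSpace n := extChartAt_target_subset_range y hzt
  change z ∈ frontier (extChartAt (𝓡∂ n) y).target ↔ _
  rw [frontier, Set.mem_sdiff, mem_interior_iff_mem_nhds, and_iff_right (subset_closure hzt)]
  refine ⟨fun h => ?_, fun h0 hn => ?_⟩
  · by_contra h0
    have hpos : 0 < z 0 := lt_of_le_of_ne (mem_halfSpace.1 hzH) (Ne.symm h0)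
    have := extChartAt_target_mem_nhdsWithin_of_mem hzt
    rw [nhdsWithin_eq_nhds.2 (halfSpace_mem_nhds hpos)] at this
    exact h this
  · have h1 : z ∈ frontier (Set.range (𝓡∂ n)) := by
      rw [frontier_range_modelWithCornersEuclideanHalfSpace]
      exact h0.symm
    exact h1.2 (mem_interior_iff_mem_nhds.2
      (mem_of_superset hn (extChartAt_target_subset_range y)))

end ChartInvariance

/-! ### From covariant to partial derivatives -/

section CoordinateBounds

open Filter Topology
open scoped Matrix

variable {n : ℕ} [NeZero n]

theorem eventually_abs_le_of_continuousOn {ι : Type*} [Finite ι]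
    {K : Set (EuclideanSpace ℝ (Fin n))} (hK : IsCompact K)
    {F : ι → EuclideanSpace ℝ (Fin n) → ℝ} (hF : ∀ i, ContinuousOn (F i) K) :
    ∀ᶠ L : ℝ in atTop, ∀ z ∈ K, ∀ i, |F i z| ≤ L := by
  have h : ∀ i, ∀ᶠ L : ℝ in atTop, ∀ z ∈ K, |F i z| ≤ L := fun i => by
    obtain ⟨C, hC⟩ := hK.exists_bound_of_continuousOn (hF i)
    filter_upwards [eventually_ge_atTop C] with L hL z hz using (hC z hz).trans hL
  filter_upwards [eventually_all.2 h] with L hL z hz i using hL i z hz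

theorem abs_christoffel_sum_le {L B : ℝ} (hL : 0 ≤ L) {c d : Fin n → ℝ} (hc : ∀ l, |c l| ≤ L)
    (hd : ∀ l, |d l| ≤ B) : |∑ l, c l * d l| ≤ n * (L * B) := by
  refine (abs_sum_le_of_le (g := fun _ => L * B) _ fun l _ => ?_).trans_eq (by simp)
  rw [abs_mul]
  exact mul_le_mul (hc l) (hd l) (abs_nonneg _) hL

variable {Γ : Fin n → Fin n → Fin n → EuclideanSpace ℝ (Fin n) → ℝ}
  {f : EuclideanSpace ℝ (Fin n) → ℝ} {z : EuclideanSpace ℝ (Fin n)} {L B : ℝ}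

theorem abs_partialDeriv_le (h1 : ∀ I, |iterCovDerivOf Γ f 1 z I| ≤ B) (i : Fin n) :
    |partialDeriv i f z| ≤ B := by
  simpa only [iterCovDerivOf_one] using h1 fun _ => i

theorem abs_partialDeriv_two_le (hL : 0 ≤ L) (hΓ : ∀ l i j, |Γ l i j z| ≤ L)
    (h1 : ∀ I, |iterCovDerivOf Γ f 1 z I| ≤ B) (h2 : ∀ I, |iterCovDerivOf Γ f 2 z I| ≤ B)
    (i j : Fin n) : |partialDeriv i (partialDeriv j f) z| ≤ B + n * (L * B) := by
  have e := iterCovDerivOf_two Γ f z ![i, j]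
  simp only [Matrix.cons_val_zero, Matrix.cons_val_one] at e
  rw [show partialDeriv i (partialDeriv j f) z = iterCovDerivOf Γ f 2 z ![i, j]
    + ∑ l, Γ l i j z * partialDeriv l f z by rw [e]; ring]
  exact (abs_add_le _ _).trans (add_le_add (h2 _)
    (abs_christoffel_sum_le hL (fun l => hΓ l i j) fun l => abs_partialDeriv_le h1 l))

theorem abs_iterCovDerivOf_two_le (hL : 0 ≤ L) (hΓ : ∀ l i j, |Γ l i j z| ≤ L) {D : ℝ}
    (h1 : ∀ i, |partialDeriv i f z| ≤ B) (h2 : ∀ i j, |partialDeriv i (partialDeriv j f) z| ≤ D)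
    (I : Fin 2 → Fin n) : |iterCovDerivOf Γ f 2 z I| ≤ D + n * (L * B) := by
  rw [iterCovDerivOf_two]
  exact (abs_sub _ _).trans (add_le_add (h2 _ _)
    (abs_christoffel_sum_le hL (fun l => hΓ l _ _) h1))

/-- The formula for ∇³f is solved for the third partial derivatives; besides Γ and lower covariant
derivatives it involves ∂Γ and second partial derivatives, which were bounded before. -/
theorem abs_partialDeriv_three_le (hz : z ∈ halfSpace n) (hf : SmoothAt 3 f z)
    (hs : ∀ l i j, SmoothAt 1 (Γ l i j) z) (hL : 0 ≤ L)
    (hΓ : ∀ l i j, |Γ l i j z| ≤ L) (hdΓ : ∀ a l i j, |partialDeriv a (Γ l i j) z| ≤ L)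
    (h1 : ∀ I, |iterCovDerivOf Γ f 1 z I| ≤ B) (h2 : ∀ I, |iterCovDerivOf Γ f 2 z I| ≤ B)
    (h3 : ∀ I, |iterCovDerivOf Γ f 3 z I| ≤ B) (a i j : Fin n) :
    |partialDeriv a (partialDeriv i (partialDeriv j f)) z|
      ≤ B + (2 * (n * (L * B)) + (n * (L * B) + n * (L * (B + n * (L * B))))) := by
  have e := iterCovDerivOf_three Γ f z ![a, i, j]
  have p1 : ∀ l, DifferentiableWithinAt ℝ (partialDeriv l f) (halfSpace n) z := fun l =>
    SmoothAt.diffAt (hf.partialDeriv (m := 2) hz (by norm_num) l) (by simp)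
  have p2 : ∀ i j, DifferentiableWithinAt ℝ (partialDeriv i (partialDeriv j f)) (halfSpace n) z :=
    fun i j => SmoothAt.diffAt (SmoothAt.partialDeriv (m := 1)
      (hf.partialDeriv (m := 2) hz (by norm_num) j) hz (by norm_num) i) (by simp)
  have p3 : ∀ l, DifferentiableWithinAt ℝ (fun y => Γ l i j y * partialDeriv l f y)
      (halfSpace n) z := fun l => ((hs l i j).diffAt one_ne_zero).fun_mul (p1 l)
  have e2 : partialDeriv a (fun y => partialDeriv i (partialDeriv j f) y
      - ∑ l, Γ l i j y * partialDeriv l f y) z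
      = partialDeriv a (partialDeriv i (partialDeriv j f)) z
        - (∑ l, partialDeriv a (Γ l i j) z * partialDeriv l f z
          + ∑ l, Γ l i j z * partialDeriv a (partialDeriv l f) z) := by
    rw [partialDeriv_sub hz (p2 i j) (DifferentiableWithinAt.fun_sum fun l _ => p3 l),
      partialDeriv_sum Finset.univ (F := fun l y => Γ l i j y * partialDeriv l f y) hz
        fun l _ => p3 l, ← Finset.sum_add_distrib]
    congr 1
    exact Finset.sum_congr rfl fun l _ =>
      partialDeriv_mul hz ((hs l i j).diffAt one_ne_zero) (p1 l) a
  have e3 : partialDeriv a (partialDeriv i (partialDeriv j f)) z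
      = iterCovDerivOf Γ f 3 z ![a, i, j]
        + (∑ b : Fin 2, ∑ l, Γ l a (![a, i, j] b.succ) z
          * iterCovDerivOf Γ f 2 z (Function.update (Fin.tail ![a, i, j]) b l)
        + (∑ l, partialDeriv a (Γ l i j) z * partialDeriv l f z
          + ∑ l, Γ l i j z * partialDeriv a (partialDeriv l f) z)) := by
    rw [e]
    change _ = partialDeriv a (fun y => partialDeriv i (partialDeriv j f) y
      - ∑ l, Γ l i j y * partialDeriv l f y) z - _ + _
    rw [e2]
    simp only [Matrix.cons_val_zero]
    ring
  rw [e3]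
  refine (abs_add_le _ _).trans (add_le_add (h3 _) ((abs_add_le _ _).trans (add_le_add ?_
    ((abs_add_le _ _).trans (add_le_add ?_ ?_)))))
  · refine (abs_sum_le_of_le (g := fun _ => n * (L * B)) _ fun b _ =>
      abs_christoffel_sum_le hL (fun l => hΓ l _ _) fun l => h2 _).trans_eq (by simp)
  · exact abs_christoffel_sum_le hL (fun l => hdΓ a l i j) fun l => abs_partialDeriv_le h1 l
  · exact abs_christoffel_sum_le hL (fun l => hΓ l i j)
      fun l => abs_partialDeriv_two_le hL hΓ h1 h2 a l

end CoordinateBounds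

/-! ### From C^m norms on the manifold to coordinate bounds -/

section ManifoldBounds

variable {n : ℕ} [NeZero n] {M : Type*} [TopologicalSpace M]
  [ChartedSpace (EuclideanHalfSpace n) M] [IsManifold (𝓡∂ n) ∞ M]

theorem nablaNorm_le_of_cNorm_le (g : Metric n M) {m : ℕ} {f : M → ℝ} {K : ℝ≥0}
    (h : cNorm g m f ≤ K) {j : ℕ} (hj : j ≤ m) (x : M) : nablaNorm g j f x ≤ K := by
  have h1 : ENNReal.ofReal (nablaNorm g j f x) ≤ K :=
    (le_iSup (fun x => ENNReal.ofReal (nablaNorm g j f x)) x).trans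
      ((Finset.single_le_sum (f := fun j => ⨆ x : M, ENNReal.ofReal (nablaNorm g j f x))
        (fun _ _ => zero_le) (Finset.mem_range_succ_iff.2 hj)).trans h)
  have h2 := ENNReal.toReal_mono ENNReal.coe_ne_top h1
  have e : (ENNReal.ofReal (nablaNorm g j f x)).toReal = nablaNorm g j f x :=
    ENNReal.toReal_ofReal (Real.sqrt_nonneg _)
  rwa [e, ENNReal.coe_toReal] at h2

theorem abs_iterCovDerivOf_le_of_cNorm_le (g : Metric n M) {N : ℕ} {f : M → ℝ} {K : ℝ≥0}
    (hf : ContMDiff (𝓡∂ n) 𝓘(ℝ) N f) (hK : cNorm g N f ≤ K) {y : M}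
    {z : EuclideanSpace ℝ (Fin n)} (hz : z ∈ (extChartAt (𝓡∂ n) y).target) {L : ℝ} (hL : 1 ≤ L)
    (hG : ∀ i j, |gram g y z i j| ≤ L) {m : ℕ} (hm : m ≤ N) (I : Fin m → Fin n) :
    |iterCovDerivOf (christoffelOf (gram g y)) (inChart f y) m z I| ≤ (n : ℝ) ^ N * L ^ N * K := by
  have hx := (extChartAt (𝓡∂ n) y).map_target hz
  have h1 := nablaNorm_le_of_cNorm_le g hK hm ((extChartAt (𝓡∂ n) y).symm z)
  rw [nablaNorm_eq_chart g (hf.of_le (by exact_mod_cast hm)) hx,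
    (extChartAt (𝓡∂ n) y).right_inv hz] at h1
  refine (abs_component_le (gram_posDef g y hz) hL (fun i => hG i i) m _ I).trans ?_
  have hn : (1 : ℝ) ≤ n := by exact_mod_cast NeZero.one_le
  exact mul_le_mul (mul_le_mul (pow_le_pow_right₀ hn hm) (pow_le_pow_right₀ hL hm) (by positivity)
    (by positivity)) h1 (Real.sqrt_nonneg _) (by positivity)

end ManifoldBounds

/-! ### Uniform bounds in a chart and the local solution -/

section LocalEstimate

open Filter Topology
open scoped Matrix

variable {n : ℕ} [NeZero n]

/-- The metric and the coefficients of the operator are bounded by `L` at `z`, with their first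
derivatives. -/
structure CoeffBounds (G : EuclideanSpace ℝ (Fin n) → Matrix (Fin n) (Fin n) ℝ) (L : ℝ)
    (z : EuclideanSpace ℝ (Fin n)) : Prop where
  bound_G : ∀ i j, |G z i j| ≤ L
  bound_Gi : ∀ i j, |(G z)⁻¹ i j| ≤ L
  bound_dGi : ∀ a i j, |partialDeriv a (fun y => (G y)⁻¹ i j) z| ≤ L
  bound_Γ : ∀ l i j, |christoffelOf G l i j z| ≤ L
  bound_dΓ : ∀ a l i j, |partialDeriv a (christoffelOf G l i j) z| ≤ L
  bound_Y₀ : ∀ i j, |coeffZero G i j z| ≤ L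
  bound_Y₁ : ∀ i j p, |coeffOne G i j p z| ≤ L
  bound_Y₂ : ∀ i j p q, |coeffTwo G i j p q z| ≤ L
  bound_dY₀ : ∀ a i j, |partialDeriv a (coeffZero G i j) z| ≤ L
  bound_dY₁ : ∀ a i j p, |partialDeriv a (coeffOne G i j p) z| ≤ L
  bound_dY₂ : ∀ a i j p q, |partialDeriv a (coeffTwo G i j p q) z| ≤ L

/-- Each listed quantity is continuous on the compact set, and all sufficiently large `L` bound it;
finitely many such conditions hold for a common `L`. -/
theorem IsMetricOn.exists_coeffBounds {V : Set (EuclideanSpace ℝ (Fin n))}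
    {G : EuclideanSpace ℝ (Fin n) → Matrix (Fin n) (Fin n) ℝ} (h : IsMetricOn V G)
    {K : Set (EuclideanSpace ℝ (Fin n))} (hK : IsCompact K) (hKV : K ⊆ V) :
    ∃ L : ℝ, 1 ≤ L ∧ ∀ z ∈ K, CoeffBounds G L z := by
  have hc : ∀ {F : EuclideanSpace ℝ (Fin n) → ℝ}, (∀ z ∈ V, SmoothAt ∞ F z) → ContinuousOn F K :=
    fun hF z hz => (hF z (hKV hz)).continuousWithinAt.mono (hKV.trans h.subset)
  have hd : ∀ {F : EuclideanSpace ℝ (Fin n) → ℝ}, (∀ z ∈ V, SmoothAt ∞ F z) → ∀ a,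
      ContinuousOn (partialDeriv a F) K := fun hF a =>
    hc fun z hz => (hF z hz).partialDeriv (h.subset hz) (by simp) a
  have b1 := eventually_abs_le_of_continuousOn hK
    (F := fun (q : Fin n × Fin n) y => G y q.1 q.2) fun q => hc fun z hz => h.smooth z hz _ _
  have b2 := eventually_abs_le_of_continuousOn hK
    (F := fun (q : Fin n × Fin n) y => (G y)⁻¹ q.1 q.2) fun q =>
      hc fun z hz => h.smooth_inv hz _ _
  have b3 := eventually_abs_le_of_continuousOn hK
    (F := fun (q : Fin n × Fin n × Fin n) => partialDeriv q.1 fun y => (G y)⁻¹ q.2.1 q.2.2)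
    fun q => hd (fun z hz => h.smooth_inv hz _ _) _
  have b4 := eventually_abs_le_of_continuousOn hK
    (F := fun (q : Fin n × Fin n × Fin n) => christoffelOf G q.1 q.2.1 q.2.2)
    fun q => hc fun z hz => h.smooth_christoffelOf hz _ _ _
  have b5 := eventually_abs_le_of_continuousOn hK
    (F := fun (q : Fin n × Fin n × Fin n × Fin n) =>
      partialDeriv q.1 (christoffelOf G q.2.1 q.2.2.1 q.2.2.2))
    fun q => hd (fun z hz => h.smooth_christoffelOf hz _ _ _) _
  have b6 := eventually_abs_le_of_continuousOn hK
    (F := fun (q : Fin n × Fin n) => coeffZero G q.1 q.2)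
    fun q => hc fun z hz => h.smooth_coeffZero hz _ _
  have b7 := eventually_abs_le_of_continuousOn hK
    (F := fun (q : Fin n × Fin n × Fin n) => coeffOne G q.1 q.2.1 q.2.2)
    fun q => hc fun z hz => h.smooth_coeffOne hz _ _ _
  have b8 := eventually_abs_le_of_continuousOn hK
    (F := fun (q : Fin n × Fin n × Fin n × Fin n) => coeffTwo G q.1 q.2.1 q.2.2.1 q.2.2.2)
    fun q => hc fun z hz => h.smooth_coeffTwo hz _ _ _ _
  have b9 := eventually_abs_le_of_continuousOn hK
    (F := fun (q : Fin n × Fin n × Fin n) => partialDeriv q.1 (coeffZero G q.2.1 q.2.2))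
    fun q => hd (fun z hz => h.smooth_coeffZero hz _ _) _
  have b10 := eventually_abs_le_of_continuousOn hK
    (F := fun (q : Fin n × Fin n × Fin n × Fin n) =>
      partialDeriv q.1 (coeffOne G q.2.1 q.2.2.1 q.2.2.2))
    fun q => hd (fun z hz => h.smooth_coeffOne hz _ _ _) _
  have b11 := eventually_abs_le_of_continuousOn hK
    (F := fun (q : Fin n × Fin n × Fin n × Fin n × Fin n) =>
      partialDeriv q.1 (coeffTwo G q.2.1 q.2.2.1 q.2.2.2.1 q.2.2.2.2))
    fun q => hd (fun z hz => h.smooth_coeffTwo hz _ _ _ _) _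
  obtain ⟨L, hL, c1, c2, c3, c4, c5, c6, c7, c8, c9, c10, c11⟩ := ((eventually_ge_atTop (1 : ℝ)).and
    (b1.and (b2.and (b3.and (b4.and (b5.and (b6.and (b7.and (b8.and
      (b9.and (b10.and b11))))))))))).exists
  exact ⟨L, hL, fun z hz => ⟨fun i j => c1 z hz (i, j), fun i j => c2 z hz (i, j),
    fun a i j => c3 z hz (a, i, j), fun l i j => c4 z hz (l, i, j),
    fun a l i j => c5 z hz (a, l, i, j), fun i j => c6 z hz (i, j), fun i j p => c7 z hz (i, j, p),
    fun i j p q => c8 z hz (i, j, p, q), fun a i j => c9 z hz (a, i, j),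
    fun a i j p => c10 z hz (a, i, j, p), fun a i j p q => c11 z hz (a, i, j, p, q)⟩⟩

variable {M : Type*} [TopologicalSpace M]
  [ChartedSpace (EuclideanHalfSpace n) M] [IsManifold (𝓡∂ n) ∞ M]

/-- Here `L₀` bounds the geometry and `B` the covariant derivatives of the data. The summands in
`hBL` are `L₀` and the bounds for second and third partial derivatives, which also dominate `B`. -/
theorem isLocalSolution_inChart (hn : 3 ≤ n) {k : ℕ} (g : Metric n M) {m₀ L₀ L B r : ℝ}
    (hL₀ : 1 ≤ L₀)
    (hBL : L₀ + (B + n * (L₀ * B)) + (B + (2 * (n * (L₀ * B)) + (n * (L₀ * B)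
      + n * (L₀ * (B + n * (L₀ * B)))))) ≤ L)
    {v φ α α₀ : M → ℝ} (hv : ContMDiff (𝓡∂ n) 𝓘(ℝ) 3 v) (hφ : ContMDiff (𝓡∂ n) 𝓘(ℝ) ∞ φ)
    (hα : ContMDiff (𝓡∂ n) 𝓘(ℝ) ∞ α)
    (hadm : Admissible g (k - 1) v) (hsol : Solves g k α α₀ v)
    (hbd : ∀ x ∈ (𝓡∂ n).boundary M, v x = φ x) (hlow : ∀ x : M, m₀ ≤ α₀ x) {y : M}
    {x₀ : EuclideanSpace ℝ (Fin n)} (hflat : x₀ 0 = 0)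
    (hsub : halfBall x₀ r ⊆ (extChartAt (𝓡∂ n) y).target)
    (hcoef : ∀ z ∈ halfBall x₀ r, CoeffBounds (gram g y) L₀ z)
    (hvB : ∀ z ∈ halfBall x₀ r, ∀ m ≤ 1, ∀ I,
      |iterCovDerivOf (christoffelOf (gram g y)) (inChart v y) m z I| ≤ B)
    (hφB : ∀ z ∈ halfBall x₀ r, ∀ m ≤ 3, ∀ I,
      |iterCovDerivOf (christoffelOf (gram g y)) (inChart φ y) m z I| ≤ B)
    (hαB : ∀ z ∈ halfBall x₀ r, ∀ m ≤ 1, ∀ I,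
      |iterCovDerivOf (christoffelOf (gram g y)) (inChart α y) m z I| ≤ B)
    (hα₀B : ∀ z ∈ halfBall x₀ r, ∀ m ≤ 1, ∀ I,
      |iterCovDerivOf (christoffelOf (gram g y)) (inChart α₀ y) m z I| ≤ B) :
    IsLocalSolution k m₀ L r x₀ (extChartAt (𝓡∂ n) y).target (gram g y)
      (fun z => (gram g y z)⁻¹ * tensorOf (gram g y) (inChart v y) z)
      (coeffZero (gram g y)) (coeffOne (gram g y)) (coeffTwo (gram g y))
      (inChart v y) (inChart φ y) (inChart α y) (inChart α₀ y) := by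
  have hm := isMetricOn_gram g y
  have hsv := smoothAt_inChart (by norm_cast) hv y
  have hsφ := smoothAt_inChart le_rfl hφ y
  have hsα := smoothAt_inChart le_rfl hα y
  have hbounds : ∀ z ∈ halfBall x₀ r, L₀ ≤ L ∧ B ≤ L ∧ B + n * (L₀ * B) ≤ L ∧
      B + (2 * (n * (L₀ * B)) + (n * (L₀ * B) + n * (L₀ * (B + n * (L₀ * B))))) ≤ L :=
    fun z hz => by
      have hB : 0 ≤ B := (abs_nonneg _).trans (hvB z hz 0 zero_le_one fun a => a.elim0)
      have h0 : 0 ≤ n * (L₀ * B) := by positivity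
      have h1 : 0 ≤ n * (L₀ * (B + n * (L₀ * B))) := by positivity
      refine ⟨by linarith, by linarith, by linarith, by linarith⟩
  have heig : ∀ z ∈ (extChartAt (𝓡∂ n) y).target, ∀ c : ℝ,
      eigenvalues (c • ((gram g y z)⁻¹ * tensorOf (gram g y) (inChart v y) z))
        = eigenvalues (c • W g v ((extChartAt (𝓡∂ n) y).symm z)) := fun z hz c => by
    rw [eigenvalues_smul_W g (hv.of_le (by norm_cast)) ((extChartAt (𝓡∂ n) y).map_target hz),
      (extChartAt (𝓡∂ n) y).right_inv hz]
  have hn2 : (0 : ℝ) < (n : ℝ) - 2 := by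
    have : (3 : ℝ) ≤ n := by exact_mod_cast hn
    linarith
  have hS : ∀ z ∈ (extChartAt (𝓡∂ n) y).target,
      (tensorOf (gram g y) (inChart v y) z)ᵀ = tensorOf (gram g y) (inChart v y) z := fun z hz =>
    hm.tensorOf_symm hz ((hsv z hz).of_le (by norm_num))
  exact
    { flat := hflat
      subset := hm.subset
      mem_nhds := hm.mem_nhds
      halfBall_subset := hsub
      smooth_v := hsv
      smooth_φ := fun z hz => (hsφ z hz).of_le (by norm_cast)
      smooth_α := fun z hz => (hsα z hz).of_le (by simp)
      smooth_Gi := fun z hz i j => (hm.smooth_inv hz i j).of_le (by simp)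
      smooth_Y₀ := fun z hz i j => (hm.smooth_coeffZero hz i j).of_le (by simp)
      smooth_Y₁ := fun z hz i j l => (hm.smooth_coeffOne hz i j l).of_le (by simp)
      smooth_Y₂ := fun z hz i j l m => (hm.smooth_coeffTwo hz i j l m).of_le (by simp)
      posDef := hm.posDef
      symm := fun z hz => ⟨_, hS z hz, rfl⟩
      formula := fun z hz => hm.inv_mul_tensorOf hz
      admissible := fun z hz j h1 hj => by
        rw [sigma_smul_inv_mul (hm.posDef z hz) (hS z hz)]
        refine mul_pos (pow_pos (mul_pos hn2 (Real.exp_pos _)) _) ?_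
        have h2 := heig z hz 1
        rw [one_smul, one_smul] at h2
        rw [sigma, h2]
        exact hadm _ j h1 hj
      equation := fun z hz => by
        rw [sigma, sigma, heig z hz]
        exact hsol ((extChartAt (𝓡∂ n) y).symm z)
      boundary := fun z hz h0 => by
        refine hbd _ ((isBoundaryPoint_iff_chart ((extChartAt (𝓡∂ n) y).map_target hz)).2 ?_)
        rwa [(extChartAt (𝓡∂ n) y).right_inv hz]
      bound_G := fun z hz i j => ((hcoef z hz).bound_G i j).trans (hbounds z hz).1
      bound_Gi := fun z hz i j => ((hcoef z hz).bound_Gi i j).trans (hbounds z hz).1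
      bound_dGi := fun z hz a i j => ((hcoef z hz).bound_dGi a i j).trans (hbounds z hz).1
      bound_Y₀ := fun z hz i j => ((hcoef z hz).bound_Y₀ i j).trans (hbounds z hz).1
      bound_Y₁ := fun z hz i j l => ((hcoef z hz).bound_Y₁ i j l).trans (hbounds z hz).1
      bound_Y₂ := fun z hz i j l m => ((hcoef z hz).bound_Y₂ i j l m).trans (hbounds z hz).1
      bound_dY₀ := fun z hz a i j => ((hcoef z hz).bound_dY₀ a i j).trans (hbounds z hz).1
      bound_dY₁ := fun z hz a i j l => ((hcoef z hz).bound_dY₁ a i j l).trans (hbounds z hz).1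
      bound_dY₂ := fun z hz a i j l m => ((hcoef z hz).bound_dY₂ a i j l m).trans (hbounds z hz).1
      bound_v := fun z hz => (hvB z hz 0 (by omega) fun a => a.elim0).trans (hbounds z hz).2.1
      bound_dv := fun z hz i =>
        (abs_partialDeriv_le (hvB z hz 1 le_rfl) i).trans (hbounds z hz).2.1
      bound_dφ := fun z hz i =>
        (abs_partialDeriv_le (hφB z hz 1 (by omega)) i).trans (hbounds z hz).2.1
      bound_ddφ := fun z hz i j =>
        (abs_partialDeriv_two_le (by linarith) (hcoef z hz).bound_Γ (hφB z hz 1 (by omega))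
          (hφB z hz 2 (by omega)) i j).trans (hbounds z hz).2.2.1
      bound_dddφ := fun z hz i j a =>
        (abs_partialDeriv_three_le (hm.subset (hsub hz)) ((hsφ z (hsub hz)).of_le (by norm_cast))
          (fun l i j => (hm.smooth_christoffelOf (hsub hz) l i j).of_le (by simp)) (by linarith)
          (hcoef z hz).bound_Γ (hcoef z hz).bound_dΓ (hφB z hz 1 (by omega))
          (hφB z hz 2 (by omega)) (hφB z hz 3 le_rfl) i j a).trans (hbounds z hz).2.2.2
      bound_α := fun z hz => (hαB z hz 0 (by omega) fun a => a.elim0).trans (hbounds z hz).2.1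
      bound_dα := fun z hz i =>
        (abs_partialDeriv_le (hαB z hz 1 le_rfl) i).trans (hbounds z hz).2.1
      bound_α₀ := fun z hz => (hα₀B z hz 0 (by omega) fun a => a.elim0).trans (hbounds z hz).2.1
      bound_dα₀ := fun z hz i =>
        (abs_partialDeriv_le (hα₀B z hz 1 le_rfl) i).trans (hbounds z hz).2.1
      lower_α₀ := fun z hz => hlow _ }

end LocalEstimate

/-! ### Uniformity near a point and the covering argument -/

section GlobalEstimate

open Filter Topology
open scoped Matrix

variable {n : ℕ} [NeZero n] {M : Type*} [TopologicalSpace M]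
  [ChartedSpace (EuclideanHalfSpace n) M] [IsManifold (𝓡∂ n) ∞ M]

theorem nablaNorm_two_le (g : Metric n M) {v : M → ℝ} (hv : ContMDiff (𝓡∂ n) 𝓘(ℝ) 2 v) {x y : M}
    (hx : x ∈ (extChartAt (𝓡∂ n) y).source) {L B D : ℝ} (hL : 0 ≤ L)
    (hc : CoeffBounds (gram g y) L (extChartAt (𝓡∂ n) y x))
    (h1 : ∀ i, |partialDeriv i (inChart v y) (extChartAt (𝓡∂ n) y x)| ≤ B)
    (h2 : ∀ i j, |partialDeriv i (partialDeriv j (inChart v y)) (extChartAt (𝓡∂ n) y x)| ≤ D) :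
    nablaNorm g 2 v x ≤ (n : ℝ) ^ 2 * L * (D + n * (L * B)) := by
  rw [nablaNorm_eq_chart g hv hx]
  have hB : 0 ≤ B := (abs_nonneg _).trans (h1 0)
  have hD : 0 ≤ D := (abs_nonneg _).trans (h2 0 0)
  exact Real.sqrt_le_iff.2 ⟨by positivity,
    tensorPow_two_le hL hc.bound_Gi (abs_iterCovDerivOf_two_le hL hc.bound_Γ h1 h2)⟩

theorem exists_local_hessian_bound (hn : 3 ≤ n) {k : ℕ} (hk : 2 ≤ k) (hkn : k ≤ n) (g : Metric n M)
    (Kv Kφ Kα Kα₀ : ℝ≥0) {m₀ : ℝ} (hm₀ : 0 < m₀) (y : M) :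
    ∃ U ∈ 𝓝 y, ∃ C : ℝ, ∀ v φ α α₀ : M → ℝ,
      ContMDiff (𝓡∂ n) 𝓘(ℝ) 3 v → ContMDiff (𝓡∂ n) 𝓘(ℝ) ∞ φ →
      ContMDiff (𝓡∂ n) 𝓘(ℝ) ∞ α → ContMDiff (𝓡∂ n) 𝓘(ℝ) ∞ α₀ →
      Admissible g (k - 1) v → Solves g k α α₀ v →
      (∀ x ∈ (𝓡∂ n).boundary M, v x = φ x) →
      cNorm g 1 v ≤ Kv → cNorm g 3 φ ≤ Kφ → cNorm g 1 α ≤ Kα → cNorm g 1 α₀ ≤ Kα₀ →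
      (∀ x : M, m₀ ≤ α₀ x) →
      ∀ x ∈ U, x ∈ (𝓡∂ n).boundary M → nablaNorm g 2 v x ≤ C := by
  set e := extChartAt (𝓡∂ n) y with he
  have hm := isMetricOn_gram g y
  obtain ⟨ε, hε, hball⟩ := Metric.mem_nhdsWithin_iff.1
    (extChartAt_target_mem_nhdsWithin (I := 𝓡∂ n) y)
  -- The closed half ball of radius `2 * r` about `e y` lies in the chart target. It contains the
  -- half balls of radius `r` about all points within `r` of `e y`, so one set of constants serves
  -- them all.
  set r := ε / 4 with hr
  have hr0 : 0 < r := by positivity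
  have hsub : halfBall (e y) (2 * r) ⊆ e.target := fun z hz =>
    hball ⟨Metric.mem_ball.2 (lt_of_le_of_lt (Metric.mem_closedBall.1 hz.1) (by linarith)), hz.2⟩
  obtain ⟨L₀, hL₀, hcoef⟩ := hm.exists_coeffBounds (isCompact_halfBall (e y) (2 * r)) hsub
  -- A common bound for the components of the covariant derivatives of all four functions; exponent
  -- 3 is the highest order used, that of φ.
  set B : ℝ := (n : ℝ) ^ 3 * L₀ ^ 3 * (Kv + Kφ + Kα + Kα₀ : ℝ≥0) with hB
  set L : ℝ := L₀ + (B + n * (L₀ * B)) + (B + (2 * (n * (L₀ * B)) + (n * (L₀ * B)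
      + n * (L₀ * (B + n * (L₀ * B)))))) with hL
  have hL1 : 1 ≤ L := by
    have : 0 ≤ (B + n * (L₀ * B)) + (B + (2 * (n * (L₀ * B)) + (n * (L₀ * B)
      + n * (L₀ * (B + n * (L₀ * B)))))) := by positivity
    linarith
  obtain ⟨D, -, hD⟩ := IsLocalSolution.exists_hessian_bound hn hk hkn hm₀ hL1 hr0
  refine ⟨e.source ∩ e ⁻¹' Metric.ball (e y) r, inter_mem (extChartAt_source_mem_nhds y)
    ((continuousAt_extChartAt y).preimage_mem_nhds (Metric.ball_mem_nhds _ hr0)),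
    (n : ℝ) ^ 2 * L₀ * (D + n * (L₀ * B)), ?_⟩
  intro v φ α α₀ hv hφ hα hα₀ hadm hsol hbd hKv hKφ hKα hKα₀ hlow x hx hxb
  have hn1 : (1 : ℝ) ≤ n := by exact_mod_cast NeZero.one_le
  have hbound : ∀ {f : M → ℝ} {N : ℕ} {K : ℝ≥0}, N ≤ 3 → K ≤ Kv + Kφ + Kα + Kα₀ →
      ContMDiff (𝓡∂ n) 𝓘(ℝ) N f → cNorm g N f ≤ K → ∀ z ∈ halfBall (e y) (2 * r), ∀ m ≤ N, ∀ I,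
      |iterCovDerivOf (christoffelOf (gram g y)) (inChart f y) m z I| ≤ B :=
    fun {f N K} hN hKK hf hK z hz m hmN I => by
      refine (abs_iterCovDerivOf_le_of_cNorm_le g hf hK (hsub hz) hL₀ (hcoef z hz).bound_G
        hmN I).trans ?_
      exact mul_le_mul (mul_le_mul (pow_le_pow_right₀ hn1 hN) (pow_le_pow_right₀ hL₀ hN)
        (by positivity) (by positivity)) (by exact_mod_cast hKK) K.2 (by positivity)
  have hv1 := hbound (by norm_num) (by rw [add_assoc, add_assoc]; exact le_self_add)
    (hv.of_le (by norm_cast)) hKv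
  have hφ3 := hbound le_rfl (by
    rw [add_assoc]; exact le_add_self.trans le_self_add) (hφ.of_le (by norm_cast)) hKφ
  have hα1 := hbound (by norm_num) (le_add_self.trans le_self_add) (hα.of_le (by norm_cast)) hKα
  have hα₀1 := hbound (by norm_num) le_add_self (hα₀.of_le (by norm_cast)) hKα₀
  have hsub' : halfBall (e x) r ⊆ halfBall (e y) (2 * r) := fun z hz => by
    refine ⟨Metric.mem_closedBall.2 ((dist_triangle z (e x) (e y)).trans ?_), hz.2⟩
    have h1 := Metric.mem_closedBall.1 hz.1
    have h2 : dist (e x) (e y) < r := hx.2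
    linarith
  have hxH : e x ∈ halfSpace n := hm.subset (e.map_source hx.1)
  have hxx : e x ∈ halfBall (e y) (2 * r) :=
    hsub' ⟨Metric.mem_closedBall_self hr0.le, hxH⟩
  have hloc := isLocalSolution_inChart hn g (m₀ := m₀) (r := r) hL₀ hL.ge hv hφ hα hadm hsol
    hbd hlow ((isBoundaryPoint_iff_chart hx.1).1 hxb) (hsub'.trans hsub)
    (fun z hz => hcoef z (hsub' hz)) (fun z hz => hv1 z (hsub' hz))
    (fun z hz => hφ3 z (hsub' hz)) (fun z hz => hα1 z (hsub' hz)) (fun z hz => hα₀1 z (hsub' hz))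
  exact nablaNorm_two_le g (hv.of_le (by norm_cast)) hx.1 (by linarith) (hcoef _ hxx)
    (fun i => abs_partialDeriv_le (hv1 _ hxx 1 le_rfl) i) (hD hloc)

end GlobalEstimate

end KRicci

end

theorem theorem4p5 (n : ℕ) [NeZero n] (hn : 3 ≤ n) (k : ℕ) (hk : 2 ≤ k) (hkn : k ≤ n)
    (M : Type*) [TopologicalSpace M] [T2Space M] [CompactSpace M]
    [ChartedSpace (EuclideanHalfSpace n) M] [IsManifold (𝓡∂ n) ∞ M]
    (g : KRicci.Metric n M)
    (Kv Kφ Kα Kα₀ : ℝ≥0) (m₀ : ℝ) (hm₀ : 0 < m₀) :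
    ∃ C : ℝ, 0 < C ∧ ∀ v φ α α₀ : M → ℝ,
      ContMDiff (𝓡∂ n) 𝓘(ℝ) 3 v → ContMDiff (𝓡∂ n) 𝓘(ℝ) ∞ φ →
      ContMDiff (𝓡∂ n) 𝓘(ℝ) ∞ α → ContMDiff (𝓡∂ n) 𝓘(ℝ) ∞ α₀ →
      KRicci.Admissible g (k - 1) v → KRicci.Solves g k α α₀ v →
      (∀ x ∈ (𝓡∂ n).boundary M, v x = φ x) →
      KRicci.cNorm g 1 v ≤ Kv → KRicci.cNorm g 3 φ ≤ Kφ →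
      KRicci.cNorm g 1 α ≤ Kα → KRicci.cNorm g 1 α₀ ≤ Kα₀ →
      (∀ x : M, m₀ ≤ α₀ x) →
      ∀ x ∈ (𝓡∂ n).boundary M, KRicci.nablaNorm g 2 v x ≤ C := by
  choose U hU C hC using
    KRicci.exists_local_hessian_bound hn hk hkn g Kv Kφ Kα Kα₀ hm₀
  obtain ⟨t, -, ht⟩ := isCompact_univ.elim_nhds_subcover U fun y _ => hU y
  -- The sum dominates each local constant of the finite cover; the summand 1 makes the constant
  -- positive even if the cover is empty.
  refine ⟨1 + ∑ y ∈ t, |C y|, by positivity, ?_⟩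
  intro v φ α α₀ hv hφ hα hα₀ hadm hsol hbd hKv hKφ hKα hKα₀ hlow x hxb
  obtain ⟨y, hy, hxy⟩ := Set.mem_iUnion₂.1 (ht (Set.mem_univ x))
  have h1 := hC y v φ α α₀ hv hφ hα hα₀ hadm hsol hbd hKv hKφ hKα hKα₀ hlow x hxy hxb
  have h2 : |C y| ≤ ∑ y ∈ t, |C y| :=
    Finset.single_le_sum (f := fun y => |C y|) (fun _ _ => abs_nonneg _) hy
  linarith [le_abs_self (C y)]
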